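/- **Setting.** There are $k$ objects $o_1,\dots,o_k$ ($k\ge 1$); $o_i$ takes values in a non-empty set $V_i$, has initial value $v_i^0$, and is stored at server $s_i$. There are writers $w_1,\dots,w_\ell$ and readers $r_1,\dots,r_m$ (the clients). A WRITE transaction assigns values $v_i\in V_i$ to the objects $o_i$, $i\in I$, and returns $ok$; a READ transaction returns the values of the objects $o_i$, $i\in I$; here $\emptyset\ne I\subseteq\{1,\dots,k\}$. The sequential data type $\mathcal O_T$ has states in $\prod_i V_i$, initially $(v^0_i)_i$: a READ returns the current values on $I$, and a WRITE replaces exactly the values on $I$. All processes are I/O automata, with no failures. Between every client and every server there is, in each direction, a reliable asynchronous channel that may reorder messages. Invocations $INV$ are inputs and responses $RESP$ are outputs of clients; writers invoke WRITEs and readers invoke READs. An execution is *well-formed* if each client invokes a transaction only after its earlier ones have responded. It is *fair* if no task (class of locally controlled actions) is enabled at its end when it is finite, and every task infinitely often either takes a step or is disabled when it is infinite (each message in transit is eventually delivered, and each process that can take a step eventually does). **Algorithm $B$**, with a fixed server $s^*$ as coordinator. Keys are pairs $(z,w)$ of a number and a writer; $\kappa^0=(0,w_0)$ with a placeholder $w_0$.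 Each server $s_i$ has a set $Vals$ of key-value pairs, initially $\{(\kappa^0,v_i^0)\}$, and a list $List$ of entries $(\kappa,(b_1,\dots,b_k))$ with $b_j\in\{0,1\}$, initially $[(\kappa^0,(1,\dots,1))]$; each writer has a counter $z$, initially $0$. * *WRITE of $(v_i)_{i\in I}$ at $w$.* Phase write-value: $w$ increments $z$, sets $\kappa=(z,w)$, sends $(\text{write-value},\kappa,v_i)$ to $s_i$ for every $i\in I$ and awaits all acknowledgements. Phase update-coord: $w$ sends $(\text{update-coord},\kappa,(b_j)_j)$ to $s^*$, where $b_j=1$ iff $j\in I$, and responds $ok$ after the acknowledgement of $s^*$. * *READ of $I$ at $r$.* Phase get-tag-array: $r$ sends get-tag-array (with $I$) to $s^*$ and awaits $(t_r,(\kappa_1,\dots,\kappa_k))$. Phase read-value: $r$ sends $(\text{read-value},\kappa_i)$ to $s_i$ for every $i\in I$, awaits a value from each of these servers, and returns these values. * *Servers.* On write-value, $s_i$ adds $(\kappa,v_i)$ to $Vals$ and acknowledges. On update-coord, the entry is appended to $List$, and the acknowledgement carries $t_w=|List|$. On get-tag-array, the answer has as $\kappa_i$ the key of the last entry of $List$ with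 $b_i=1$, and as $t_r$ the last position of an entry with $b_i=1$ for some $i\in I$. On $(\text{read-value},\kappa)$, $s_i$ answers with a $v$ such that $(\kappa,v)\in Vals$. Answers are queued at once and sent in order. **Theorem.** For all numbers of writers and readers, every $k$, all $V_i$ and $v_i^0$ and every choice of $s^*$, algorithm $B$ has no client-to-client messages, and: * In every well-formed fair execution each response answers exactly one transaction of its client. * **(S)** Every well-formed fair execution is strictly serializable: one can choose a set $\Phi$ of incomplete transactions, a response for each of them, and a serialization point for each complete transaction, between its invocation and its response, and for each transaction in $\Phi$, after its invocation, such that the transactions, in the order of their points and with their responses, form a sequential trace of $\mathcal O_T$. * **(N)** Whenever a server receives a get-tag-array or read-value request from a reader in a well-formed execution, then in every fair continuation of that server alone without further input it sends the answer (for read-value: a value of its object) to that reader. * **(o)** In every well-formed fair execution every complete READ takes exactly two rounds, get-tag-array and then read-value. In a round the reader sends at most one request to each server and gets exactly one answer to each request, and no read-value request is sent before the get-tag-array answer has been received. No message from a server to a reader contains more than one version (object value), and for each object read the reader gets exactly one version in total, from the server of that object, which is the value it returns. * **(W)** In every well-formed fair execution every READ and every WRITE completes, whatever transactions are concurrent with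 it. Moreover a client with no transaction in progress can invoke any transaction of its kind at any time: each finite well-formed execution followed by that invocation extends to a well-formed fair execution. -/

import Mathlib

universe u

namespace SNoW

/-! ## I/O automata -/

/-- An I/O automaton over the universe of actions `A`: a signature of pairwise disjoint sets of
input, output and internal actions, start states, a transition relation in which inputs are always
enabled, and a partition of the locally controlled actions into tasks. -/
structure IOAutomaton (A : Type u) where
  State : Type u
  start : Set State
  inp : Set A
  out : Set A
  int : Set A
  step : State → A → State → Prop
  Task : Type u
  task : Task → Set A
  start_nonempty : start.Nonempty
  inp_out : Disjoint inp out
  inp_int : Disjoint inp int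
  out_int : Disjoint out int
  step_sig : ∀ s a s', step s a s' → a ∈ inp ∪ out ∪ int
  input_enabled : ∀ s, ∀ a ∈ inp, ∃ s', step s a s'
  task_cover : ∀ a, (∃ t, a ∈ task t) ↔ a ∈ out ∪ int
  task_disjoint : ∀ t t', t ≠ t' → Disjoint (task t) (task t')

namespace IOAutomaton

variable {A : Type u}

/-- All actions of the signature. -/
def acts (M : IOAutomaton A) : Set A := M.inp ∪ M.out ∪ M.int

/-- Some action of the set `C` is enabled in state `s`. -/
def EnabledIn (M : IOAutomaton A) (s : M.State) (C : Set A) : Prop :=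
  ∃ a ∈ C, ∃ s', M.step s a s'

/-- Compatibility of a family of automata. -/
def Compatible {ι : Type} (M : ι → IOAutomaton A) : Prop :=
  ∀ i j, i ≠ j → Disjoint (M i).out (M j).out ∧ Disjoint (M i).int (M j).acts

/-- Parallel composition of a compatible family: every component that has the action in its
signature takes a step, all others keep their state. -/
def compose {ι : Type} (M : ι → IOAutomaton A) (h : Compatible M) : IOAutomaton A where
  State := ∀ i, (M i).State
  start := {s | ∀ i, s i ∈ (M i).start}
  inp := {a | (∃ i, a ∈ (M i).inp) ∧ ∀ i, a ∉ (M i).out}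
  out := {a | ∃ i, a ∈ (M i).out}
  int := {a | ∃ i, a ∈ (M i).int}
  step s a s' := (∃ i, a ∈ (M i).acts) ∧
    ∀ i, (a ∈ (M i).acts ∧ (M i).step (s i) a (s' i)) ∨ (a ∉ (M i).acts ∧ s' i = s i)
  Task := Σ i, (M i).Task
  task t := (M t.1).task t.2
  start_nonempty := ⟨fun i => (M i).start_nonempty.some, fun i => (M i).start_nonempty.some_mem⟩
  inp_out := Set.disjoint_left.2 fun _ ha ⟨i, hi⟩ => ha.2 i hi
  inp_int := by
    refine Set.disjoint_left.2 ?_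
    rintro a ⟨⟨i, hi⟩, -⟩ ⟨j, hj⟩
    by_cases hij : j = i
    · subst hij
      exact Set.disjoint_left.1 (M j).inp_int hi hj
    · exact Set.disjoint_left.1 (h j i hij).2 hj (Or.inl (Or.inl hi))
  out_int := by
    refine Set.disjoint_left.2 ?_
    rintro a ⟨i, hi⟩ ⟨j, hj⟩
    by_cases hij : j = i
    · subst hij
      exact Set.disjoint_left.1 (M j).out_int hi hj
    · exact Set.disjoint_left.1 (h j i hij).2 hj (Or.inl (Or.inr hi))
  step_sig := by
    rintro s a s' ⟨⟨i, hi⟩, -⟩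
    by_cases ho : ∃ j, a ∈ (M j).out
    · exact Or.inl (Or.inr ho)
    · rcases hi with (hi | hi) | hi
      · exact Or.inl (Or.inl ⟨⟨i, hi⟩, fun j hj => ho ⟨j, hj⟩⟩)
      · exact Or.inl (Or.inr ⟨i, hi⟩)
      · exact Or.inr ⟨i, hi⟩
  input_enabled := by
    rintro s a ⟨⟨i, hi⟩, ho⟩
    have key : ∀ j, ∃ t, (a ∈ (M j).acts ∧ (M j).step (s j) a t) ∨
        (a ∉ (M j).acts ∧ t = s j) := by
      intro j
      by_cases hj : a ∈ (M j).acts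
      · have hin : a ∈ (M j).inp := by
          rcases hj with (hj | hj) | hj
          · exact hj
          · exact absurd hj (ho j)
          · by_cases hij : j = i
            · subst hij
              exact hi
            · exact absurd (Or.inl (Or.inl hi)) (Set.disjoint_left.1 (h j i hij).2 hj)
        obtain ⟨t, ht⟩ := (M j).input_enabled (s j) a hin
        exact ⟨t, Or.inl ⟨hj, ht⟩⟩
      · exact ⟨s j, Or.inr ⟨hj, rfl⟩⟩
    choose t ht using key
    exact ⟨t, ⟨i, Or.inl (Or.inl hi)⟩, ht⟩
  task_cover := by
    intro a
    constructor
    · rintro ⟨⟨i, t⟩, ht⟩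
      rcases ((M i).task_cover a).1 ⟨t, ht⟩ with h' | h'
      · exact Or.inl ⟨i, h'⟩
      · exact Or.inr ⟨i, h'⟩
    · rintro (⟨i, hi⟩ | ⟨i, hi⟩)
      · obtain ⟨t, ht⟩ := ((M i).task_cover a).2 (Or.inl hi)
        exact ⟨⟨i, t⟩, ht⟩
      · obtain ⟨t, ht⟩ := ((M i).task_cover a).2 (Or.inr hi)
        exact ⟨⟨i, t⟩, ht⟩
  task_disjoint := by
    rintro ⟨i, t⟩ ⟨j, t'⟩ hne
    by_cases hij : i = j
    · subst hij
      exact (M i).task_disjoint t t' fun hh => hne (by rw [hh])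
    · refine Set.disjoint_left.2 fun a ha hb => ?_
      rcases ((M i).task_cover a).1 ⟨t, ha⟩ with h1 | h1 <;>
        rcases ((M j).task_cover a).1 ⟨t', hb⟩ with h2 | h2
      · exact Set.disjoint_left.1 (h i j hij).1 h1 h2
      · exact Set.disjoint_left.1 (h j i (Ne.symm hij)).2 h2 (Or.inl (Or.inr h1))
      · exact Set.disjoint_left.1 (h i j hij).2 h1 (Or.inl (Or.inr h2))
      · exact Set.disjoint_left.1 (h i j hij).2 h1 (Or.inr h2)

/-- A finite or infinite execution fragment `state 0, act 0, state 1, act 1, …` with `len` actions.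
Values of `act n` for `n ≥ len` and of `state n` for `n > len` carry no meaning. -/
structure Fragment (M : IOAutomaton A) where
  len : ℕ∞
  state : ℕ → M.State
  act : ℕ → A
  step : ∀ n : ℕ, (n : ℕ∞) < len → M.step (state n) (act n) (state (n + 1))

/-- An execution is a fragment that begins in a start state. -/
def Fragment.IsExecution {M : IOAutomaton A} (e : M.Fragment) : Prop := e.state 0 ∈ M.start

/-- Fairness: in a finite fragment no task is enabled at the end; in an infinite one every task
infinitely often either takes a step or is not enabled. -/
def Fragment.Fair {M : IOAutomaton A} (e : M.Fragment) : Prop :=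
  ∀ t : M.Task,
    (∀ N : ℕ, e.len = N → ¬ M.EnabledIn (e.state N) (M.task t)) ∧
    (e.len = ⊤ → ∀ n, ∃ j ≥ n, e.act j ∈ M.task t ∨ ¬ M.EnabledIn (e.state j) (M.task t))

end IOAutomaton

/-! ## The data type -/

/-- Invocations: `READ` of, or `WRITE` to, a non-empty set of distinct objects. -/
inductive Inv {k : ℕ} (V : Fin k → Type u) : Type u
  | read (I : Finset (Fin k)) (hI : I.Nonempty) : Inv V
  | write (I : Finset (Fin k)) (hI : I.Nonempty) (v : ∀ i : I, V i) : Inv V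

/-- Responses: the tuple of values read, or `ok`. -/
inductive Resp {k : ℕ} (V : Fin k → Type u) : Type u
  | values (I : Finset (Fin k)) (v : ∀ i : I, V i) : Resp V
  | ok : Resp V

/-- The sequential specification of the `k`-object data type. -/
def apply {k : ℕ} {V : Fin k → Type u} : Inv V → (∀ i, V i) → Resp V × (∀ i, V i)
  | .read I _, x => (.values I (fun i => x i), x)
  | .write I _ v, x => (.ok, fun i => if h : i ∈ I then v ⟨i, h⟩ else x i)

/-! ## Processes, messages and actions -/

/-- Clients: `ℓ` writers and `m` readers. -/
inductive Client (ℓ m : ℕ) : Type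
  | writer (w : Fin ℓ) : Client ℓ m
  | reader (r : Fin m) : Client ℓ m

/-- Processes: clients, and one server for each of the `k` objects. -/
inductive Proc (ℓ m k : ℕ) : Type
  | client (c : Client ℓ m) : Proc ℓ m k
  | server (s : Fin k) : Proc ℓ m k

/-- Keys `(z, w)`; `none` is the placeholder writer of the initial key. -/
abbrev Key (ℓ : ℕ) : Type := ℕ × Option (Fin ℓ)

/-- The key of the initial values. -/
def initKey (ℓ : ℕ) : Key ℓ := (0, none)

/-- Message alphabet. A `getTagArray` request carries the set of objects to be read, on which the
tag in the answer depends. -/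
inductive Msg (ℓ : ℕ) {k : ℕ} (V : Fin k → Type u) : Type u
  | writeValue (κ : Key ℓ) (i : Fin k) (v : V i) : Msg ℓ V
  | ack : Msg ℓ V
  | updateCoord (κ : Key ℓ) (b : Fin k → Bool) : Msg ℓ V
  | ackTag (t : ℕ) : Msg ℓ V
  | getTagArray (I : Finset (Fin k)) : Msg ℓ V
  | tagArray (t : ℕ) (κ : Fin k → Key ℓ) : Msg ℓ V
  | readValue (κ : Key ℓ) : Msg ℓ V
  | value (i : Fin k) (v : V i) : Msg ℓ V

/-- The object values (versions) that a message contains. -/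
def Msg.versions {ℓ k : ℕ} {V : Fin k → Type u} : Msg ℓ V → List (Σ i, V i)
  | .writeValue _ i v => [⟨i, v⟩]
  | .value i v => [⟨i, v⟩]
  | _ => []

/-- The round of a `READ` to which a message belongs: get-tag-array is the first round and
read-value the second; messages of `WRITE`s get `0`. -/
def Msg.round {ℓ k : ℕ} {V : Fin k → Type u} : Msg ℓ V → ℕ
  | .getTagArray _ => 1
  | .tagArray _ _ => 1
  | .readValue _ => 2
  | .value _ _ => 2
  | _ => 0

/-- `Answers s q a`: `q` is a request of a `READ`, and `a` is a proper answer of server `s` to it. -/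
def Answers {ℓ k : ℕ} {V : Fin k → Type u} (s : Fin k) : Msg ℓ V → Msg ℓ V → Prop
  | .getTagArray _, .tagArray _ _ => True
  | .readValue _, .value i _ => i = s
  | _, _ => False

/-- The requests of a `READ`. -/
def Msg.IsReadRequest {ℓ k : ℕ} {V : Fin k → Type u} : Msg ℓ V → Prop
  | .getTagArray _ => True
  | .readValue _ => True
  | _ => False

/-- Actions: `INV` and `RESP` of transactions at clients; `send p q` of a message by `p` for `q`
and `recv p q` of a message from `p` by `q`. -/
inductive Act (ℓ m : ℕ) {k : ℕ} (V : Fin k → Type u) : Type u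
  | inv (c : Client ℓ m) (x : Inv V) : Act ℓ m V
  | resp (c : Client ℓ m) (y : Resp V) : Act ℓ m V
  | send (p q : Proc ℓ m k) (a : Msg ℓ V) : Act ℓ m V
  | recv (p q : Proc ℓ m k) (a : Msg ℓ V) : Act ℓ m V

/-! ## Channels: reliable, asynchronous, with arbitrary reordering -/

/-- Steps of a channel, whose state is the multiset of messages in transit. -/
inductive ChannelStep {ℓ m k : ℕ} {V : Fin k → Type u} (p q : Proc ℓ m k) :
    Multiset (Msg ℓ V) → Act ℓ m V → Multiset (Msg ℓ V) → Prop
  | send (M : Multiset (Msg ℓ V)) (a : Msg ℓ V) : ChannelStep p q M (.send p q a) (a ::ₘ M)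
  | recv (M : Multiset (Msg ℓ V)) (a : Msg ℓ V) : ChannelStep p q (a ::ₘ M) (.recv p q a) M

/-- The channel from `p` to `q`. Each message value has its own task, so under fairness every
message in transit is eventually delivered. -/
def channel {ℓ m k : ℕ} (V : Fin k → Type u) (p q : Proc ℓ m k) : IOAutomaton (Act ℓ m V) where
  State := Multiset (Msg ℓ V)
  start := {0}
  inp := {x | ∃ a, x = .send p q a}
  out := {x | ∃ a, x = .recv p q a}
  int := ∅
  step := ChannelStep p q
  Task := Msg ℓ V
  task a := {.recv p q a}
  start_nonempty := ⟨0, rfl⟩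
  inp_out := by
    refine Set.disjoint_left.2 ?_
    rintro _ ⟨a, rfl⟩ ⟨b, hb⟩
    cases hb
  inp_int := Set.disjoint_empty _
  out_int := Set.disjoint_empty _
  step_sig := by
    rintro s x t (⟨M, a⟩ | ⟨M, a⟩)
    · exact Or.inl (Or.inl ⟨a, rfl⟩)
    · exact Or.inl (Or.inr ⟨a, rfl⟩)
  input_enabled := by
    rintro s _ ⟨a, rfl⟩
    exact ⟨_, ChannelStep.send s a⟩
  task_cover := by
    intro x
    constructor
    · rintro ⟨a, ha⟩
      exact Or.inl ⟨a, ha⟩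
    · rintro (⟨a, ha⟩ | h)
      · exact ⟨a, ha⟩
      · exact h.elim
  task_disjoint := by
    intro a b hab
    refine Set.disjoint_left.2 ?_
    intro x hx hy
    have hx' : x = .recv p q a := hx
    have hy' : x = .recv p q b := hy
    rw [hx'] at hy'
    injection hy' with _ _ h
    exact hab h

/-! ## Algorithm B: writers -/

/-- Program counter of a writer. In `writing I v unsent unacked` the writer is in phase write-value
of `WRITE` of `v` to `I`; `unsent` are the servers it has still to send to, `unacked` those whose
acknowledgement it awaits. In `updating I sent` it is in phase update-coord; in `finished t` it has
received the tag `t` from the coordinator. -/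
inductive WriterPhase {k : ℕ} (V : Fin k → Type u) : Type u
  | idle : WriterPhase V
  | writing (I : Finset (Fin k)) (v : ∀ i : I, V i) (unsent unacked : Finset (Fin k)) :
      WriterPhase V
  | updating (I : Finset (Fin k)) (sent : Bool) : WriterPhase V
  | finished (t : ℕ) : WriterPhase V

/-- State of a writer: the number `z` of `WRITE`s invoked so far, and the program counter. -/
structure WriterState {k : ℕ} (V : Fin k → Type u) : Type u where
  z : ℕ
  phase : WriterPhase V

/-- Effect of the receipt of a message from server `s` at a writer. -/
def writerRecv {ℓ k : ℕ} {V : Fin k → Type u} (coord : Fin k) (σ : WriterState V) (s : Fin k)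
    (a : Msg ℓ V) : WriterState V :=
  match σ.phase, a with
  | .writing I v unsent unacked, .ack =>
      if unacked.erase s = ∅ then ⟨σ.z, .updating I false⟩
      else ⟨σ.z, .writing I v unsent (unacked.erase s)⟩
  | .updating _ true, .ackTag t => if s = coord then ⟨σ.z, .finished t⟩ else σ
  | _, _ => σ

/-- Steps of writer `w`. An invocation at a busy writer (which is not well-formed) is ignored. -/
inductive WriterStep {ℓ m k : ℕ} {V : Fin k → Type u} (coord : Fin k) (w : Fin ℓ) :
    WriterState V → Act ℓ m V → WriterState V → Prop
  | inv (z : ℕ) (I : Finset (Fin k)) (hI : I.Nonempty) (v : ∀ i : I, V i) :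
      WriterStep coord w ⟨z, .idle⟩ (.inv (.writer w) (.write I hI v)) ⟨z + 1, .writing I v I I⟩
  | invBusy (σ : WriterState V) (I : Finset (Fin k)) (hI : I.Nonempty) (v : ∀ i : I, V i) :
      σ.phase ≠ .idle → WriterStep coord w σ (.inv (.writer w) (.write I hI v)) σ
  | sendValue (z : ℕ) (I : Finset (Fin k)) (v : ∀ i : I, V i) (unsent unacked : Finset (Fin k))
      (i : Fin k) (hi : i ∈ I) : i ∈ unsent →
      WriterStep coord w ⟨z, .writing I v unsent unacked⟩
        (.send (.client (.writer w)) (.server i) (.writeValue (z, some w) i (v ⟨i, hi⟩)))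
        ⟨z, .writing I v (unsent.erase i) unacked⟩
  | sendUpdate (z : ℕ) (I : Finset (Fin k)) :
      WriterStep coord w ⟨z, .updating I false⟩
        (.send (.client (.writer w)) (.server coord)
          (.updateCoord (z, some w) (fun i => decide (i ∈ I))))
        ⟨z, .updating I true⟩
  | recv (σ : WriterState V) (s : Fin k) (a : Msg ℓ V) :
      WriterStep coord w σ (.recv (.server s) (.client (.writer w)) a) (writerRecv coord σ s a)
  | resp (z t : ℕ) :
      WriterStep coord w ⟨z, .finished t⟩ (.resp (.writer w) .ok) ⟨z, .idle⟩

/-- The automaton of writer `w`. -/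
def writer {ℓ m k : ℕ} (V : Fin k → Type u) (coord : Fin k) (w : Fin ℓ) :
    IOAutomaton (Act ℓ m V) where
  State := WriterState V
  start := {⟨0, .idle⟩}
  inp := {x | (∃ I hI v, x = .inv (.writer w) (.write I hI v)) ∨
    ∃ s a, x = .recv (.server s) (.client (.writer w)) a}
  out := {x | x = .resp (.writer w) .ok ∨ ∃ s a, x = .send (.client (.writer w)) (.server s) a}
  int := ∅
  step := WriterStep coord w
  Task := PUnit
  task _ := {x | x = .resp (.writer w) .ok ∨ ∃ s a, x = .send (.client (.writer w)) (.server s) a}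
  start_nonempty := ⟨_, rfl⟩
  inp_out := by
    refine Set.disjoint_left.2 ?_
    rintro _ (⟨I, hI, v, rfl⟩ | ⟨s, a, rfl⟩) (h | ⟨s', a', h⟩) <;> cases h
  inp_int := Set.disjoint_empty _
  out_int := Set.disjoint_empty _
  step_sig := by
    rintro σ x τ h
    cases h with
    | inv z I hI v => exact Or.inl (Or.inl (Or.inl ⟨I, hI, v, rfl⟩))
    | invBusy _ I hI v => exact Or.inl (Or.inl (Or.inl ⟨I, hI, v, rfl⟩))
    | sendValue => exact Or.inl (Or.inr (Or.inr ⟨_, _, rfl⟩))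
    | sendUpdate => exact Or.inl (Or.inr (Or.inr ⟨_, _, rfl⟩))
    | recv => exact Or.inl (Or.inl (Or.inr ⟨_, _, rfl⟩))
    | resp => exact Or.inl (Or.inr (Or.inl rfl))
  input_enabled := by
    rintro ⟨z, ph⟩ _ (⟨I, hI, v, rfl⟩ | ⟨s, a, rfl⟩)
    · by_cases h : ph = .idle
      · subst h
        exact ⟨_, WriterStep.inv z I hI v⟩
      · exact ⟨_, WriterStep.invBusy ⟨z, ph⟩ I hI v h⟩
    · exact ⟨_, WriterStep.recv _ s a⟩
  task_cover := by
    intro x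
    constructor
    · rintro ⟨-, h⟩
      exact Or.inl h
    · rintro (h | h)
      · exact ⟨⟨⟩, h⟩
      · exact h.elim
  task_disjoint := fun _ _ h => (h rfl).elim

/-! ## Algorithm B: readers -/

/-- Program counter of a reader. In `getTag I sent` it is in phase get-tag-array of `READ` of `I`;
in `reading I t κ unsent got` it is in phase read-value with the tag `t` and the keys `κ` received
from the coordinator, has still to send requests to `unsent` and has received the values `got`. -/
inductive ReaderState (ℓ : ℕ) {k : ℕ} (V : Fin k → Type u) : Type u
  | idle : ReaderState ℓ V
  | getTag (I : Finset (Fin k)) (sent : Bool) : ReaderState ℓ V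
  | reading (I : Finset (Fin k)) (t : ℕ) (κ : Fin k → Key ℓ) (unsent : Finset (Fin k))
      (got : ∀ i, Option (V i)) : ReaderState ℓ V

/-- Effect of the receipt of a message from server `s` at a reader. -/
def readerRecv {ℓ k : ℕ} {V : Fin k → Type u} (coord : Fin k) (σ : ReaderState ℓ V) (s : Fin k)
    (a : Msg ℓ V) : ReaderState ℓ V :=
  match σ, a with
  | .getTag I true, .tagArray t κ =>
      if s = coord then .reading I t κ I (fun _ => none) else .getTag I true
  | .reading I t κ unsent got, .value i v =>
      if s = i then .reading I t κ unsent (Function.update got i (some v))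
      else .reading I t κ unsent got
  | σ, _ => σ

/-- Steps of reader `r`. An invocation at a busy reader (which is not well-formed) is ignored. -/
inductive ReaderStep {ℓ m k : ℕ} {V : Fin k → Type u} (coord : Fin k) (r : Fin m) :
    ReaderState ℓ V → Act ℓ m V → ReaderState ℓ V → Prop
  | inv (I : Finset (Fin k)) (hI : I.Nonempty) :
      ReaderStep coord r .idle (.inv (.reader r) (.read I hI)) (.getTag I false)
  | invBusy (σ : ReaderState ℓ V) (I : Finset (Fin k)) (hI : I.Nonempty) :
      σ ≠ .idle → ReaderStep coord r σ (.inv (.reader r) (.read I hI)) σ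
  | sendGetTag (I : Finset (Fin k)) :
      ReaderStep coord r (.getTag I false)
        (.send (.client (.reader r)) (.server coord) (.getTagArray I)) (.getTag I true)
  | sendRead (I : Finset (Fin k)) (t : ℕ) (κ : Fin k → Key ℓ) (unsent : Finset (Fin k))
      (got : ∀ i, Option (V i)) (i : Fin k) : i ∈ unsent →
      ReaderStep coord r (.reading I t κ unsent got)
        (.send (.client (.reader r)) (.server i) (.readValue (κ i)))
        (.reading I t κ (unsent.erase i) got)
  | recv (σ : ReaderState ℓ V) (s : Fin k) (a : Msg ℓ V) :
      ReaderStep coord r σ (.recv (.server s) (.client (.reader r)) a) (readerRecv coord σ s a)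
  | resp (I : Finset (Fin k)) (t : ℕ) (κ : Fin k → Key ℓ) (got : ∀ i, Option (V i))
      (v : ∀ i : I, V i) : (∀ i : I, got i = some (v i)) →
      ReaderStep coord r (.reading I t κ ∅ got) (.resp (.reader r) (.values I v)) .idle

/-- The automaton of reader `r`. -/
def reader {ℓ m k : ℕ} (V : Fin k → Type u) (coord : Fin k) (r : Fin m) :
    IOAutomaton (Act ℓ m V) where
  State := ReaderState ℓ V
  start := {.idle}
  inp := {x | (∃ I hI, x = .inv (.reader r) (.read I hI)) ∨
    ∃ s a, x = .recv (.server s) (.client (.reader r)) a}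
  out := {x | (∃ I v, x = .resp (.reader r) (.values I v)) ∨
    ∃ s a, x = .send (.client (.reader r)) (.server s) a}
  int := ∅
  step := ReaderStep coord r
  Task := PUnit
  task _ := {x | (∃ I v, x = .resp (.reader r) (.values I v)) ∨
    ∃ s a, x = .send (.client (.reader r)) (.server s) a}
  start_nonempty := ⟨_, rfl⟩
  inp_out := by
    refine Set.disjoint_left.2 ?_
    rintro _ (⟨I, hI, rfl⟩ | ⟨s, a, rfl⟩) (⟨I', v', h⟩ | ⟨s', a', h⟩) <;> cases h
  inp_int := Set.disjoint_empty _
  out_int := Set.disjoint_empty _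
  step_sig := by
    rintro σ x τ h
    cases h with
    | inv I hI => exact Or.inl (Or.inl (Or.inl ⟨I, hI, rfl⟩))
    | invBusy _ I hI => exact Or.inl (Or.inl (Or.inl ⟨I, hI, rfl⟩))
    | sendGetTag => exact Or.inl (Or.inr (Or.inr ⟨_, _, rfl⟩))
    | sendRead => exact Or.inl (Or.inr (Or.inr ⟨_, _, rfl⟩))
    | recv => exact Or.inl (Or.inl (Or.inr ⟨_, _, rfl⟩))
    | resp => exact Or.inl (Or.inr (Or.inl ⟨_, _, rfl⟩))
  input_enabled := by
    rintro σ _ (⟨I, hI, rfl⟩ | ⟨s, a, rfl⟩)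
    · by_cases h : σ = .idle
      · subst h
        exact ⟨_, ReaderStep.inv I hI⟩
      · exact ⟨_, ReaderStep.invBusy σ I hI h⟩
    · exact ⟨_, ReaderStep.recv _ s a⟩
  task_cover := by
    intro x
    constructor
    · rintro ⟨-, h⟩
      exact Or.inl h
    · rintro (h | h)
      · exact ⟨⟨⟩, h⟩
      · exact h.elim
  task_disjoint := fun _ _ h => (h rfl).elim

/-! ## Algorithm B: servers -/

/-- State of the server of object `s`: the set `Vals` of key-value pairs, the list `List` of keys
with the indicator of the objects written, and the queue of answers not yet sent. -/
structure ServerState (ℓ m : ℕ) {k : ℕ} (V : Fin k → Type u) (s : Fin k) : Type u where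
  vals : Set (Key ℓ × V s)
  list : List (Key ℓ × (Fin k → Bool))
  outbox : List (Client ℓ m × Msg ℓ V)

/-- The key of the last entry of the list that marks object `i` as written. -/
def lastKey {ℓ k : ℕ} (L : List (Key ℓ × (Fin k → Bool))) (i : Fin k) : Key ℓ :=
  ((L.filter (fun p => p.2 i)).getLast?.map Prod.fst).getD (initKey ℓ)

open Classical in
/-- The tag of a `READ` of `I`: the last position (counted from `1`) of an entry of the list that
marks an object of `I` as written. -/
noncomputable def readTag {ℓ k : ℕ} (L : List (Key ℓ × (Fin k → Bool))) (I : Finset (Fin k)) : ℕ :=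
  ((Finset.range L.length).filter (fun j => ∃ p, L[j]? = some p ∧ ∃ i ∈ I, p.2 i = true)).sup
    (fun j => j + 1)

/-- Effect of the receipt of message `a` from client `c` at server `s`: the set of possible
successor states. The answer is put into the outbox at once. -/
def serverRecv {ℓ m k : ℕ} {V : Fin k → Type u} {s : Fin k} (σ : ServerState ℓ m V s)
    (c : Client ℓ m) (a : Msg ℓ V) : Set (ServerState ℓ m V s) :=
  match a with
  | .writeValue κ i v =>
      {σ' | (∃ h : i = s, σ' = ⟨insert (κ, h ▸ v) σ.vals, σ.list, σ.outbox ++ [(c, .ack)]⟩) ∨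
        (i ≠ s ∧ σ' = σ)}
  | .updateCoord κ b =>
      {⟨σ.vals, σ.list ++ [(κ, b)], σ.outbox ++ [(c, .ackTag (σ.list.length + 1))]⟩}
  | .getTagArray I =>
      {σ' | σ' = ⟨σ.vals, σ.list,
        σ.outbox ++ [(c, .tagArray (readTag σ.list I) (lastKey σ.list))]⟩}
  | .readValue κ =>
      {σ' | (∃ v, (κ, v) ∈ σ.vals ∧ σ' = ⟨σ.vals, σ.list, σ.outbox ++ [(c, .value s v)]⟩) ∨
        ((∀ v, (κ, v) ∉ σ.vals) ∧ σ' = σ)}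
  | _ => {σ}

/-- Steps of server `s`. -/
inductive ServerStep {ℓ m k : ℕ} {V : Fin k → Type u} (s : Fin k) :
    ServerState ℓ m V s → Act ℓ m V → ServerState ℓ m V s → Prop
  | recv (σ σ' : ServerState ℓ m V s) (c : Client ℓ m) (a : Msg ℓ V) : σ' ∈ serverRecv σ c a →
      ServerStep s σ (.recv (.client c) (.server s) a) σ'
  | send (vals : Set (Key ℓ × V s)) (list : List (Key ℓ × (Fin k → Bool)))
      (c : Client ℓ m) (a : Msg ℓ V) (rest : List (Client ℓ m × Msg ℓ V)) :
      ServerStep s ⟨vals, list, (c, a) :: rest⟩ (.send (.server s) (.client c) a)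
        ⟨vals, list, rest⟩

/-- The automaton of server `s` with initial value `v₀ s`. -/
def server {ℓ m k : ℕ} (V : Fin k → Type u) (v₀ : ∀ i, V i) (s : Fin k) :
    IOAutomaton (Act ℓ m V) where
  State := ServerState ℓ m V s
  start := {⟨{(initKey ℓ, v₀ s)}, [(initKey ℓ, fun _ => true)], []⟩}
  inp := {x | ∃ c a, x = .recv (.client c) (.server s) a}
  out := {x | ∃ c a, x = .send (.server s) (.client c) a}
  int := ∅
  step := ServerStep s
  Task := PUnit
  task _ := {x | ∃ c a, x = .send (.server s) (.client c) a}
  start_nonempty := ⟨_, rfl⟩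
  inp_out := by
    refine Set.disjoint_left.2 ?_
    rintro _ ⟨c, a, rfl⟩ ⟨c', a', h⟩
    cases h
  inp_int := Set.disjoint_empty _
  out_int := Set.disjoint_empty _
  step_sig := by
    rintro σ x τ h
    cases h with
    | recv => exact Or.inl (Or.inl ⟨_, _, rfl⟩)
    | send => exact Or.inl (Or.inr ⟨_, _, rfl⟩)
  input_enabled := by
    rintro σ _ ⟨c, a, rfl⟩
    have key : (serverRecv σ c a).Nonempty := by
      cases a with
      | writeValue κ i v =>
          by_cases h : i = s
          · exact ⟨_, Or.inl ⟨h, rfl⟩⟩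
          · exact ⟨_, Or.inr ⟨h, rfl⟩⟩
      | readValue κ =>
          by_cases h : ∃ v, (κ, v) ∈ σ.vals
          · obtain ⟨v, hv⟩ := h
            exact ⟨_, Or.inl ⟨v, hv, rfl⟩⟩
          · exact ⟨_, Or.inr ⟨fun v hv => h ⟨v, hv⟩, rfl⟩⟩
      | _ => exact ⟨_, rfl⟩
    obtain ⟨τ, hτ⟩ := key
    exact ⟨τ, ServerStep.recv σ τ c a hτ⟩
  task_cover := by
    intro x
    constructor
    · rintro ⟨-, h⟩
      exact Or.inl h
    · rintro (h | h)
      · exact ⟨⟨⟩, h⟩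
      · exact h.elim
  task_disjoint := fun _ _ h => (h rfl).elim

/-! ## Algorithm B: the system -/

/-- The components of the system: the processes, and a channel in each direction between every
client and every server. -/
inductive Comp (ℓ m k : ℕ) : Type
  | proc (p : Proc ℓ m k) : Comp ℓ m k
  | toServer (c : Client ℓ m) (s : Fin k) : Comp ℓ m k
  | toClient (s : Fin k) (c : Client ℓ m) : Comp ℓ m k

/-- The automaton of each component. -/
def component {ℓ m k : ℕ} (V : Fin k → Type u) (v₀ : ∀ i, V i) (coord : Fin k) :
    Comp ℓ m k → IOAutomaton (Act ℓ m V)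
  | .proc (.client (.writer w)) => writer V coord w
  | .proc (.client (.reader r)) => reader V coord r
  | .proc (.server s) => server V v₀ s
  | .toServer c s => channel V (.client c) (.server s)
  | .toClient s c => channel V (.server s) (.client c)

theorem component_compatible {ℓ m k : ℕ} (V : Fin k → Type u) (v₀ : ∀ i, V i) (coord : Fin k) :
    IOAutomaton.Compatible (component (ℓ := ℓ) (m := m) V v₀ coord) := by
  intro i j hij
  refine ⟨Set.disjoint_left.2 ?_, ?_⟩
  · intro x hx hy
    apply hij
    rcases i with ((w | r) | s) | ⟨c, s⟩ | ⟨s, c⟩ <;>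
      rcases j with ((w' | r') | s') | ⟨c', s'⟩ | ⟨s', c'⟩ <;>
      simp only [component, writer, reader, server, channel, Set.mem_ofPred_eq] at hx hy <;>
      grind
  · have h : (component (ℓ := ℓ) (m := m) V v₀ coord i).int = ∅ := by
      rcases i with ((w | r) | s) | ⟨c, s⟩ | ⟨s, c⟩ <;> rfl
    rw [h]
    exact Set.empty_disjoint _

/-- Algorithm B with `ℓ` writers, `m` readers, servers and objects `Fin k`, value domains `V`,
initial values `v₀` and coordinator `coord`. -/
def algorithmB (ℓ m : ℕ) {k : ℕ} (V : Fin k → Type u) (v₀ : ∀ i, V i) (coord : Fin k) :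
    IOAutomaton (Act ℓ m V) :=
  IOAutomaton.compose (component V v₀ coord) (component_compatible V v₀ coord)

/-! ## Transactions of an execution -/

section Transactions

variable {ℓ m k : ℕ} {V : Fin k → Type u} {M : IOAutomaton (Act ℓ m V)}

/-- The `n`-th action is the invocation of `x` at client `c`. A transaction is identified with the
position `n` of its invocation. -/
def InvAt (e : M.Fragment) (c : Client ℓ m) (x : Inv V) (n : ℕ) : Prop :=
  (n : ℕ∞) < e.len ∧ e.act n = .inv c x

/-- The `n`-th action is the response `y` at client `c`. -/
def RespAt (e : M.Fragment) (c : Client ℓ m) (y : Resp V) (n : ℕ) : Prop :=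
  (n : ℕ∞) < e.len ∧ e.act n = .resp c y

/-- The transaction invoked at client `c` at position `n` completes at position `n'` with
response `y`: this is the first response at `c` after `n`. -/
def Completes (e : M.Fragment) (c : Client ℓ m) (n : ℕ) (y : Resp V) (n' : ℕ) : Prop :=
  n < n' ∧ RespAt e c y n' ∧ ∀ j y', n < j → j < n' → ¬ RespAt e c y' j

/-- Well-formedness: a client invokes a transaction only after its previous ones have completed. -/
def WellFormed (e : M.Fragment) : Prop :=
  ∀ c x x' n n', InvAt e c x n → InvAt e c x' n' → n < n' →
    ∃ y j, n < j ∧ j < n' ∧ RespAt e c y j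

/-- Every response is the response of a transaction (so no client responds twice, or unasked). -/
def ResponsesMatched (e : M.Fragment) : Prop :=
  ∀ c y n', RespAt e c y n' → ∃ x n, InvAt e c x n ∧ Completes e c n y n'

/-- Every transaction completes. -/
def AllComplete (e : M.Fragment) : Prop :=
  ∀ c x n, InvAt e c x n → ∃ y n', Completes e c n y n'

/-! ## Property S -/

/-- A serialization of an execution. The `j`-th transaction (`j < len`) in the serial order is the
one invoked at position `txn j`; its serialization point lies between the actions number `pt j` and
`pt j + 1` of the execution, points in the same gap being ordered by `j`; and `ret j` is its
response. All complete transactions occur, with their actual response and with their point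
before it; the others that occur are the selected incomplete ones, with a selected response.
The serial sequence is a trace of the data type, with `val j` the values before the `j`-th one. -/
structure Serialization (v₀ : ∀ i, V i) (e : M.Fragment) where
  len : ℕ∞
  txn : ℕ → ℕ
  pt : ℕ → ℕ
  ret : ℕ → Resp V
  val : ℕ → ∀ i, V i
  txn_inv : ∀ j : ℕ, (j : ℕ∞) < len → ∃ c x, InvAt e c x (txn j)
  txn_inj : ∀ i j : ℕ, (i : ℕ∞) < len → (j : ℕ∞) < len → txn i = txn j → i = j
  complete : ∀ c x n y n', InvAt e c x n → Completes e c n y n' →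
    ∃ j : ℕ, (j : ℕ∞) < len ∧ txn j = n ∧ ret j = y ∧ pt j < n'
  inv_le_pt : ∀ j : ℕ, (j : ℕ∞) < len → txn j ≤ pt j ∧ (pt j : ℕ∞) < e.len
  pt_mono : ∀ i j : ℕ, i < j → (j : ℕ∞) < len → pt i ≤ pt j
  val_zero : val 0 = v₀
  val_succ : ∀ (j : ℕ) (c : Client ℓ m) (x : Inv V), (j : ℕ∞) < len → InvAt e c x (txn j) →
    apply x (val j) = (ret j, val (j + 1))

/-- Strict serializability. -/
def StrictlySerializable (v₀ : ∀ i, V i) (e : M.Fragment) : Prop :=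
  Nonempty (Serialization v₀ e)

/-! ## Property o -/

/-- The `READ` of `I` by reader `r`, invoked at `n` and completed at `n'` with values `v`, takes
exactly `b` rounds: in each round the reader sends at most one request to each server and gets
exactly one answer to it, and no request of a round is sent before the answers of earlier rounds
are in. Among the answers, exactly one carries a version of each object read; it comes from the
server of that object, carries no other version, and its version is the one returned. -/
structure ReadInRounds (b : ℕ) (e : M.Fragment) (r : Fin m) (I : Finset (Fin k))
    (v : ∀ i : I, V i) (n n' : ℕ) : Prop where
  rounds : ∀ j s a, n < j → j < n' → e.act j = .send (.client (.reader r)) (.server s) a →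
    1 ≤ a.round ∧ a.round ≤ b
  nonempty : ∀ ρ, 1 ≤ ρ → ρ ≤ b → ∃ j s a, n < j ∧ j < n' ∧
    e.act j = .send (.client (.reader r)) (.server s) a ∧ a.round = ρ
  one_request : ∀ j j' s a a', n < j → j < n' → n < j' → j' < n' →
    e.act j = .send (.client (.reader r)) (.server s) a →
    e.act j' = .send (.client (.reader r)) (.server s) a' → a.round = a'.round → j = j'
  one_answer : ∀ j s a, n < j → j < n' → e.act j = .send (.client (.reader r)) (.server s) a →
    ∃! j', n < j' ∧ j' < n' ∧ j < j' ∧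
      ∃ a', e.act j' = .recv (.server s) (.client (.reader r)) a' ∧ Answers s a a'
  asked : ∀ j' s a', n < j' → j' < n' → e.act j' = .recv (.server s) (.client (.reader r)) a' →
    ∃ j a, n < j ∧ j < j' ∧ e.act j = .send (.client (.reader r)) (.server s) a ∧ Answers s a a'
  sequential : ∀ j j' s s' a a', n < j → j < n' → n < j' → j' < n' →
    e.act j = .send (.client (.reader r)) (.server s) a →
    e.act j' = .recv (.server s') (.client (.reader r)) a' → a'.round < a.round → j' < j
  one_version : ∀ i : I, ∃ j a, n < j ∧ j < n' ∧
    e.act j = .recv (.server i) (.client (.reader r)) a ∧ a.versions = [⟨i, v i⟩] ∧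
    ∀ j' s a' x, n < j' → j' < n' → e.act j' = .recv (.server s) (.client (.reader r)) a' →
      (⟨i, x⟩ : Σ i, V i) ∈ a'.versions → j' = j

/-- Every complete `READ` takes `b` rounds with one version for each object read, and no server
ever sends more than one version in a message to a reader. -/
def OneVersionReads (b : ℕ) (e : M.Fragment) : Prop :=
  (∀ r I hI n v n', InvAt e (.reader r) (.read I hI) n →
    Completes e (.reader r) n (.values I v) n' → ReadInRounds b e r I v n n') ∧
  ∀ (j : ℕ) s r a, (j : ℕ∞) < e.len → e.act j = .send (.server s) (.client (.reader r)) a →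
    a.versions.length ≤ 1

end Transactions

/-! ## Properties of the whole system -/

/-- No message from a client to a client is an action of the system. -/
def NoClientToClient {ℓ m k : ℕ} {V : Fin k → Type u} (M : IOAutomaton (Act ℓ m V)) : Prop :=
  ∀ c c' a, Act.send (.client c) (.client c') a ∉ M.acts ∧
    Act.recv (.client c) (.client c') a ∉ M.acts

/-- Property N. Let a well-formed finite execution end with the receipt at server `s` of a request
of a `READ` from reader `r`. In every fair continuation of the server automaton alone, without any
further input, `s` sends an answer to `r`. -/
def NonBlocking {ℓ m k : ℕ} (V : Fin k → Type u) (v₀ : ∀ i, V i) (coord : Fin k) : Prop :=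
  ∀ (e : (algorithmB ℓ m V v₀ coord).Fragment) (N : ℕ) (r : Fin m) (s : Fin k) (q : Msg ℓ V),
    e.IsExecution → WellFormed e → e.len = (N + 1 : ℕ) →
    e.act N = .recv (.client (.reader r)) (.server s) q → q.IsReadRequest →
    ∀ f : (server (ℓ := ℓ) (m := m) V v₀ s).Fragment,
      f.state 0 = e.state (N + 1) (.proc (.server s)) → f.Fair →
      (∀ n : ℕ, (n : ℕ∞) < f.len → f.act n ∉ (server (ℓ := ℓ) (m := m) V v₀ s).inp) →
      ∃ (n : ℕ) (a : Msg ℓ V), (n : ℕ∞) < f.len ∧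
        f.act n = .send (.server s) (.client (.reader r)) a ∧ Answers s q a

/-- The possibility part of property W: whatever transactions of other clients are in progress, a
client without a transaction in progress can invoke any transaction. That is, each finite
well-formed execution followed by the invocation extends to a well-formed fair execution. -/
def InvocableAnytime {ℓ m k : ℕ} {V : Fin k → Type u} (M : IOAutomaton (Act ℓ m V)) : Prop :=
  ∀ (e : M.Fragment) (N : ℕ) (c : Client ℓ m) (x : Inv V),
    e.IsExecution → WellFormed e → e.len = N → Act.inv c x ∈ M.inp →
    (∀ x' n, InvAt e c x' n → ∃ y n', Completes e c n y n') →
    ∃ f : M.Fragment, f.IsExecution ∧ WellFormed f ∧ f.Fair ∧ (N : ℕ∞) < f.len ∧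
      (∀ n ≤ N, f.state n = e.state n) ∧ (∀ n < N, f.act n = e.act n) ∧ f.act N = .inv c x

/-- Property W: all transactions complete in every well-formed fair execution, whatever `WRITE`s
are concurrent with them, and concurrent transactions are possible at any time. -/
def ConcurrentWrites {ℓ m k : ℕ} {V : Fin k → Type u} (M : IOAutomaton (Act ℓ m V)) : Prop :=
  (∀ e : M.Fragment, e.IsExecution → WellFormed e → e.Fair → AllComplete e) ∧
    InvocableAnytime M

end SNoW

/-! The coordinator serializes everything: a transaction takes effect when the coordinator receives
its update-coord or get-tag-array request. This moment lies between invocation and response, and a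
completed transaction has exactly one (`exists_point`, `point_unique`). In the order of these
moments, the last key listed for an object always belongs to its current value in the serial run: an
update-coord appends the key of its WRITE for exactly the objects written, and a get-tag-array
changes nothing (`keyVal_lastKey`). A key determines a value, since the counter of a writer grows
with every WRITE (`KeyVal.unique`). So a READ, which freezes its keys at its point and afterwards
fetches the pairs with these keys, returns the values of the serial run however many WRITEs arrive
in between (`response_eq`).

A writer announces its key to the coordinator only after all its values have been acknowledged, and
stores never shrink. Hence a key that the coordinator gives out for an object is already stored at
the server of that object, and a read-value request can be answered at once with a single version.
This is part of the invariant `Good`, which holds throughout well-formed executions (`good`). Its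
other central clause, `LinkState`, says that the link between a client and a server carries exactly
one message while a request is outstanding and none otherwise. Thus reordering is harmless and no
stale answer reaches a client.

Completion rests on a potential `work` for each client, which is lowered by every action concerning
the client other than an invocation, and is not raised by actions of others. If a transaction never
completed, only finitely many actions would concern its client. By fairness its links would then be
empty, so nothing would be outstanding and the client itself could step forever (`Good.enabled`),
against fairness. Summed over all clients, the same potential shows that any finite execution can be
run to quiescence, which makes every invocation extendable (`exists_fair_extension`).

For the round count, the state of a reader records exactly which requests it has sent and which
answers it has received (`done_iff`), so everything can be read off the states of the reader up to
its response. -/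

namespace SNoW

/-! ### The composition as a transition system with six kinds of steps. -/

section System

variable {ℓ m k : ℕ} {V : Fin k → Type u} {v₀ : ∀ i, V i} {coord : Fin k}

/-! ## States of the components -/

/-- The state of writer `w`. -/
def wr (S : (algorithmB ℓ m V v₀ coord).State) (w : Fin ℓ) : WriterState V :=
  S (.proc (.client (.writer w)))

/-- The state of reader `r`. -/
def rd (S : (algorithmB ℓ m V v₀ coord).State) (r : Fin m) : ReaderState ℓ V :=
  S (.proc (.client (.reader r)))

/-- The state of server `s`. -/
def sv (S : (algorithmB ℓ m V v₀ coord).State) (s : Fin k) : ServerState ℓ m V s :=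
  S (.proc (.server s))

/-- The messages in transit from client `c` to server `s`. -/
def ts (S : (algorithmB ℓ m V v₀ coord).State) (c : Client ℓ m) (s : Fin k) :
    Multiset (Msg ℓ V) :=
  S (.toServer c s)

/-- The messages in transit from server `s` to client `c`. -/
def tc (S : (algorithmB ℓ m V v₀ coord).State) (c : Client ℓ m) (s : Fin k) :
    Multiset (Msg ℓ V) :=
  S (.toClient s c)

open Classical in
/-- The entries of an outbox that are addressed to client `c`. -/
noncomputable def outFor (l : List (Client ℓ m × Msg ℓ V)) (c : Client ℓ m) : List (Msg ℓ V) :=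
  l.filterMap fun p => if p.1 = c then some p.2 else none

/-- The answers for client `c` that server `s` has still to send. -/
noncomputable def ob (S : (algorithmB ℓ m V v₀ coord).State) (c : Client ℓ m) (s : Fin k) :
    List (Msg ℓ V) :=
  outFor (sv S s).outbox c

theorem outFor_append (l l' : List (Client ℓ m × Msg ℓ V)) (c : Client ℓ m) :
    outFor (l ++ l') c = outFor l c ++ outFor l' c := by
  simp [outFor]

theorem outFor_cons_self (c : Client ℓ m) (a : Msg ℓ V) (l : List (Client ℓ m × Msg ℓ V)) :
    outFor ((c, a) :: l) c = a :: outFor l c := by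
  simp [outFor]

theorem outFor_cons_of_ne {c c' : Client ℓ m} (h : c' ≠ c) (a : Msg ℓ V)
    (l : List (Client ℓ m × Msg ℓ V)) : outFor ((c', a) :: l) c = outFor l c := by
  simp [outFor, h]

theorem outFor_nil (c : Client ℓ m) : outFor ([] : List (Client ℓ m × Msg ℓ V)) c = [] := rfl

/-- The automaton of client `c` takes a step with action `a`. -/
def ClientStep (S : (algorithmB ℓ m V v₀ coord).State) (c : Client ℓ m) (a : Act ℓ m V)
    (S' : (algorithmB ℓ m V v₀ coord).State) : Prop :=
  match c with
  | .writer w => WriterStep coord w (wr S w) a (wr S' w)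
  | .reader r => ReaderStep coord r (rd S r) a (rd S' r)

/-- The six kinds of steps of the system. -/
inductive SysStep (S S' : (algorithmB ℓ m V v₀ coord).State) : Act ℓ m V → Prop
  | inv (c : Client ℓ m) (x : Inv V) : ClientStep S c (.inv c x) S' →
      (∀ i, i ≠ .proc (.client c) → S' i = S i) → SysStep S S' (.inv c x)
  | resp (c : Client ℓ m) (y : Resp V) : ClientStep S c (.resp c y) S' →
      (∀ i, i ≠ .proc (.client c) → S' i = S i) → SysStep S S' (.resp c y)
  | sendS (c : Client ℓ m) (s : Fin k) (a : Msg ℓ V) :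
      ClientStep S c (.send (.client c) (.server s) a) S' → ts S' c s = a ::ₘ ts S c s →
      (∀ i, i ≠ .proc (.client c) → i ≠ .toServer c s → S' i = S i) →
      SysStep S S' (.send (.client c) (.server s) a)
  | recvS (c : Client ℓ m) (s : Fin k) (a : Msg ℓ V) :
      sv S' s ∈ serverRecv (sv S s) c a → ts S c s = a ::ₘ ts S' c s →
      (∀ i, i ≠ .proc (.server s) → i ≠ .toServer c s → S' i = S i) →
      SysStep S S' (.recv (.client c) (.server s) a)
  | sendC (c : Client ℓ m) (s : Fin k) (a : Msg ℓ V) :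
      (sv S s).outbox = (c, a) :: (sv S' s).outbox → (sv S' s).vals = (sv S s).vals →
      (sv S' s).list = (sv S s).list → tc S' c s = a ::ₘ tc S c s →
      (∀ i, i ≠ .proc (.server s) → i ≠ .toClient s c → S' i = S i) →
      SysStep S S' (.send (.server s) (.client c) a)
  | recvC (c : Client ℓ m) (s : Fin k) (a : Msg ℓ V) :
      ClientStep S c (.recv (.server s) (.client c) a) S' → tc S c s = a ::ₘ tc S' c s →
      (∀ i, i ≠ .proc (.client c) → i ≠ .toClient s c → S' i = S i) →
      SysStep S S' (.recv (.server s) (.client c) a)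

/-- The components that may take part in an action. -/
def Part : Act ℓ m V → Comp ℓ m k → Prop
  | .inv c _, i => i = .proc (.client c)
  | .resp c _, i => i = .proc (.client c)
  | .send (.client c) (.server s) _, i => i = .proc (.client c) ∨ i = .toServer c s
  | .recv (.client c) (.server s) _, i => i = .proc (.server s) ∨ i = .toServer c s
  | .send (.server s) (.client c) _, i => i = .proc (.server s) ∨ i = .toClient s c
  | .recv (.server s) (.client c) _, i => i = .proc (.client c) ∨ i = .toClient s c
  | _, _ => False

theorem part_of_mem_acts {a : Act ℓ m V} {i : Comp ℓ m k}
    (h : a ∈ (component V v₀ coord i).acts) : Part a i := by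
  rcases i with ((w | r) | s) | ⟨c, s⟩ | ⟨s, c⟩ <;>
    simp only [component, writer, reader, server, channel, IOAutomaton.acts, Set.mem_union,
      Set.mem_ofPred_eq, Set.mem_empty_iff_false, or_false] at h
  · rcases h with (⟨I, hI, v, rfl⟩ | ⟨s, a, rfl⟩) | rfl | ⟨s, a, rfl⟩ <;> simp [Part]
  · rcases h with (⟨I, hI, rfl⟩ | ⟨s, a, rfl⟩) | ⟨I, v, rfl⟩ | ⟨s, a, rfl⟩ <;> simp [Part]
  · rcases h with ⟨c, a, rfl⟩ | ⟨c, a, rfl⟩ <;> simp [Part]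
  · rcases h with ⟨a, rfl⟩ | ⟨a, rfl⟩ <;> simp [Part]
  · rcases h with ⟨a, rfl⟩ | ⟨a, rfl⟩ <;> simp [Part]

/-- `INV` and `RESP` are excluded because their membership also depends on the transaction: a
writer, say, has no invocation of a READ in its signature. -/
theorem mem_acts_of_part {a : Act ℓ m V} {i : Comp ℓ m k} (h : Part a i)
    (ha : ∀ c, (∀ x, a ≠ .inv c x) ∧ (∀ x, a ≠ .resp c x)) :
    a ∈ (component V v₀ coord i).acts := by
  rcases a with ⟨c, x⟩ | ⟨c, y⟩ | ⟨c | s, c' | s', a⟩ | ⟨c | s, c' | s', a⟩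
  · exact absurd rfl ((ha c).1 x)
  · exact absurd rfl ((ha c).2 y)
  · exact h.elim
  · rcases h with rfl | rfl
    · rcases c with w | r
      · exact Or.inl (Or.inr (Or.inr ⟨_, _, rfl⟩))
      · exact Or.inl (Or.inr (Or.inr ⟨_, _, rfl⟩))
    · exact Or.inl (Or.inl ⟨_, rfl⟩)
  · rcases h with rfl | rfl
    · exact Or.inl (Or.inr ⟨_, _, rfl⟩)
    · exact Or.inl (Or.inl ⟨_, rfl⟩)
  · exact h.elim
  · exact h.elim
  · rcases h with rfl | rfl
    · exact Or.inl (Or.inl ⟨_, _, rfl⟩)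
    · exact Or.inl (Or.inr ⟨_, rfl⟩)
  · rcases h with rfl | rfl
    · rcases c' with w | r
      · exact Or.inl (Or.inl (Or.inr ⟨_, _, rfl⟩))
      · exact Or.inl (Or.inl (Or.inr ⟨_, _, rfl⟩))
    · exact Or.inl (Or.inr ⟨_, rfl⟩)
  · exact h.elim

theorem clientStep_of_step {S S' : (algorithmB ℓ m V v₀ coord).State} {c : Client ℓ m}
    {a : Act ℓ m V}
    (h : (component V v₀ coord (.proc (.client c))).step (S (.proc (.client c))) a
      (S' (.proc (.client c)))) : ClientStep S c a S' := by
  rcases c with w | r <;> exact h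

theorem ChannelStep.eq_of_send {p q : Proc ℓ m k} {M M' : Multiset (Msg ℓ V)} {a : Msg ℓ V}
    (h : ChannelStep p q M (.send p q a) M') : M' = a ::ₘ M := by
  cases h
  rfl

theorem ChannelStep.eq_of_recv {p q : Proc ℓ m k} {M M' : Multiset (Msg ℓ V)} {a : Msg ℓ V}
    (h : ChannelStep p q M (.recv p q a) M') : M = a ::ₘ M' := by
  cases h
  rfl

theorem ServerStep.mem_of_recv {s : Fin k} {σ σ' : ServerState ℓ m V s} {c : Client ℓ m}
    {a : Msg ℓ V} (h : ServerStep s σ (.recv (.client c) (.server s) a) σ') :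
    σ' ∈ serverRecv σ c a := by
  cases h
  assumption

/-- At most two components share an action, a process and a channel; all others keep their state.
Every later case analysis of a step goes through this one. -/
theorem sysStep_of_step {S S' : (algorithmB ℓ m V v₀ coord).State} {a : Act ℓ m V}
    (h : (algorithmB ℓ m V v₀ coord).step S a S') : SysStep S S' a := by
  obtain ⟨⟨i, hi⟩, h⟩ := h
  have frame : ∀ j, ¬ Part a j → S' j = S j := fun j hj =>
    (h j).elim (fun hh => (hj (part_of_mem_acts hh.1)).elim) (·.2)
  have moves : ∀ j, a ∈ (component V v₀ coord j).acts →
      (component V v₀ coord j).step (S j) a (S' j) := fun j hj =>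
    (h j).elim (·.2) (fun hh => (hh.1 hj).elim)
  have hp := part_of_mem_acts hi
  rcases a with ⟨c, x⟩ | ⟨c, y⟩ | ⟨c | s, c' | s', a⟩ | ⟨c | s, c' | s', a⟩
  -- Here the component that makes the action part of the signature can only be the client itself.
  · cases (show i = _ from hp)
    exact .inv c x (clientStep_of_step (moves _ hi)) fun j hj => frame j hj
  · cases (show i = _ from hp)
    exact .resp c y (clientStep_of_step (moves _ hi)) fun j hj => frame j hj
  · exact hp.elim
  · have h1 := moves (.proc (.client c)) (mem_acts_of_part (Or.inl rfl) (by simp))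
    have h2 := moves (.toServer c s') (mem_acts_of_part (Or.inr rfl) (by simp))
    refine .sendS c s' a (clientStep_of_step h1) ?_ fun j hj hj' => frame j (by simp [Part, hj, hj'])
    exact ChannelStep.eq_of_send h2
  · have h1 := moves (.proc (.server s)) (mem_acts_of_part (Or.inl rfl) (by simp))
    have h2 := moves (.toClient s c') (mem_acts_of_part (Or.inr rfl) (by simp))
    change ServerStep _ (sv S s) _ (sv S' s) at h1
    generalize hσ : sv S s = σ at h1
    generalize hσ' : sv S' s = σ' at h1
    refine .sendC c' s a ?_ ?_ ?_ ?_ fun j hj hj' => frame j (by simp [Part, hj, hj'])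
    · cases h1
      simp [hσ, hσ']
    · cases h1
      simp [hσ, hσ']
    · cases h1
      simp [hσ, hσ']
    · exact ChannelStep.eq_of_send h2
  · exact hp.elim
  · exact hp.elim
  · have h1 := moves (.proc (.server s')) (mem_acts_of_part (Or.inl rfl) (by simp))
    have h2 := moves (.toServer c s') (mem_acts_of_part (Or.inr rfl) (by simp))
    refine .recvS c s' a ?_ ?_ fun j hj hj' => frame j (by simp [Part, hj, hj'])
    · exact ServerStep.mem_of_recv h1
    · exact ChannelStep.eq_of_recv h2
  · have h1 := moves (.proc (.client c')) (mem_acts_of_part (Or.inl rfl) (by simp))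
    have h2 := moves (.toClient s c') (mem_acts_of_part (Or.inr rfl) (by simp))
    refine .recvC c' s a (clientStep_of_step h1) ?_ fun j hj hj' => frame j (by simp [Part, hj, hj'])
    exact ChannelStep.eq_of_recv h2
  · exact hp.elim

/-- A locally controlled action enabled in a component is enabled in the composition. -/
theorem IOAutomaton.compose_enabledIn {A : Type u} {ι : Type} {M : ι → IOAutomaton A}
    (h : IOAutomaton.Compatible M) (S : ∀ i, (M i).State) (i : ι) (t : (M i).Task)
    (he : (M i).EnabledIn (S i) ((M i).task t)) :
    (IOAutomaton.compose M h).EnabledIn S ((M i).task t) := by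
  classical
  obtain ⟨a, ha, σ, hσ⟩ := he
  refine ⟨a, ha, ?_⟩
  have hloc : a ∈ (M i).out ∪ (M i).int := ((M i).task_cover a).1 ⟨t, ha⟩
  have hi : a ∈ (M i).acts := (M i).step_sig _ _ _ hσ
  have key : ∀ j, ∃ τ, (a ∈ (M j).acts ∧ (M j).step (S j) a τ) ∨ (a ∉ (M j).acts ∧ τ = S j) := by
    intro j
    by_cases hj : a ∈ (M j).acts
    · by_cases hij : i = j
      · subst hij
        exact ⟨σ, Or.inl ⟨hj, hσ⟩⟩
      · have hin : a ∈ (M j).inp := by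
          rcases hloc with ho | hn
          · rcases hj with (hj | hj) | hj
            · exact hj
            · exact absurd hj (Set.disjoint_left.1 (h i j hij).1 ho)
            · exact absurd hi (Set.disjoint_left.1 (h j i (Ne.symm hij)).2 hj)
          · exact absurd hj (Set.disjoint_left.1 (h i j hij).2 hn)
        obtain ⟨τ, hτ⟩ := (M j).input_enabled (S j) a hin
        exact ⟨τ, Or.inl ⟨hj, hτ⟩⟩
    · exact ⟨S j, Or.inr ⟨hj, rfl⟩⟩
  choose τ hτ using key
  exact ⟨τ, ⟨i, hi⟩, hτ⟩

/-- Every channel has a client at one end and a server at the other, so no component takes part in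
such an action. -/
theorem noClientToClient : NoClientToClient (algorithmB ℓ m V v₀ coord) := by
  have key : ∀ a : Act ℓ m V, (∀ i, ¬ Part a i) → a ∉ (algorithmB ℓ m V v₀ coord).acts := by
    rintro a ha ((⟨⟨i, hi⟩, -⟩ | ⟨i, hi⟩) | ⟨i, hi⟩)
    · exact ha i (part_of_mem_acts (v₀ := v₀) (coord := coord) (Or.inl (Or.inl hi)))
    · exact ha i (part_of_mem_acts (v₀ := v₀) (coord := coord) (Or.inl (Or.inr hi)))
    · exact ha i (part_of_mem_acts (v₀ := v₀) (coord := coord) (Or.inr hi))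
  exact fun c c' a => ⟨key _ fun _ h => h, key _ fun _ h => h⟩

end System

/-! ### A potential for each client, lowered by its own actions. -/

section Measure

variable {ℓ m k : ℕ} {V : Fin k → Type u} {v₀ : ∀ i, V i} {coord : Fin k}

/-! ## A measure of the work left for a client -/

/-- The client with which an action is concerned. -/
def Concerns (c : Client ℓ m) : Act ℓ m V → Prop
  | .inv c' _ => c' = c
  | .resp c' _ => c' = c
  | .send (.client c') (.server _) _ => c' = c
  | .recv (.client c') (.server _) _ => c' = c
  | .send (.server _) (.client c') _ => c' = c
  | .recv (.server _) (.client c') _ => c' = c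
  | _ => False

/-- Bound on the work that a writer has to do in its present transaction. -/
def WriterPhase.work : WriterPhase V → ℕ
  | .idle => 0
  | .writing _ _ unsent _ => 7 + 4 * unsent.card
  | .updating _ false => 6
  | .updating _ true => 2
  | .finished _ => 1

/-- Bound on the work that a reader has to do in its present transaction. -/
def ReaderState.work : ReaderState ℓ V → ℕ
  | .idle => 0
  | .getTag _ false => 6 + 4 * k
  | .getTag _ true => 2 + 4 * k
  | .reading _ _ _ unsent _ => 1 + 4 * unsent.card

/-- Bound on the work that a client has to do in its present transaction. -/
def clientWork (S : (algorithmB ℓ m V v₀ coord).State) : Client ℓ m → ℕ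
  | .writer w => (wr S w).phase.work
  | .reader r => (rd S r).work

/-- Weight of the messages between client `c` and server `s`. -/
noncomputable def linkWork (S : (algorithmB ℓ m V v₀ coord).State) (c : Client ℓ m)
    (s : Fin k) : ℕ :=
  3 * (ts S c s).card + 2 * (ob S c s).length + (tc S c s).card

/-- The measure of the work left for client `c`. -/
noncomputable def work (S : (algorithmB ℓ m V v₀ coord).State) (c : Client ℓ m) : ℕ :=
  clientWork S c + ∑ s, linkWork S c s

theorem writerRecv_work (σ : WriterState V) (s : Fin k) (a : Msg ℓ V) :
    (writerRecv coord σ s a).phase.work ≤ σ.phase.work := by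
  obtain ⟨z, ph⟩ := σ
  rcases ph with _ | ⟨I, v, x, y⟩ | ⟨I, _ | _⟩ | t <;> cases a <;>
    simp only [writerRecv, le_refl] <;> split_ifs <;> simp [WriterPhase.work]
  omega

theorem readerRecv_work (σ : ReaderState ℓ V) (s : Fin k) (a : Msg ℓ V) :
    (readerRecv coord σ s a).work ≤ σ.work := by
  rcases σ with _ | ⟨I, _ | _⟩ | ⟨I, t, κ, x, y⟩ <;> cases a <;>
    simp only [readerRecv, le_refl] <;> split_ifs <;> simp only [ReaderState.work, le_refl]
  -- Entering phase read-value sets `unsent` to `I`; the term `4 * k` kept in reserve during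
  -- get-tag-array covers these requests.
  have := Finset.card_le_univ I
  rw [Fintype.card_fin] at this
  omega

theorem ClientStep.work_resp {S S' : (algorithmB ℓ m V v₀ coord).State} {c : Client ℓ m}
    {y : Resp V} (h : ClientStep S c (.resp c y) S') : clientWork S' c < clientWork S c := by
  rcases c with w | r
  · change WriterStep _ _ _ _ _ at h
    simp only [clientWork]
    generalize wr S w = σ at h
    generalize wr S' w = σ' at h
    cases h
    simp [WriterPhase.work]
  · change ReaderStep _ _ _ _ _ at h
    simp only [clientWork]
    generalize rd S r = σ at h
    generalize rd S' r = σ' at h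
    cases h
    simp [ReaderState.work]

/-- The drop by at least four pays for the weight three of the new message in transit and leaves a
strict decrease. -/
theorem ClientStep.work_send {S S' : (algorithmB ℓ m V v₀ coord).State} {c : Client ℓ m}
    {q : Proc ℓ m k} {a : Msg ℓ V} (h : ClientStep S c (.send (.client c) q a) S') :
    clientWork S' c + 3 < clientWork S c := by
  rcases c with w | r
  · change WriterStep _ _ _ _ _ at h
    simp only [clientWork]
    generalize wr S w = σ at h
    generalize wr S' w = σ' at h
    cases h with
    | sendValue _ _ _ un _ i hi hu =>
      have := Finset.card_erase_add_one hu
      simp only [WriterPhase.work]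
      omega
    | sendUpdate => simp [WriterPhase.work]
  · change ReaderStep _ _ _ _ _ at h
    simp only [clientWork]
    generalize rd S r = σ at h
    generalize rd S' r = σ' at h
    cases h with
    | sendGetTag =>
      simp only [ReaderState.work]
      omega
    | sendRead _ _ _ un _ i hu =>
      have := Finset.card_erase_add_one hu
      simp only [ReaderState.work]
      omega

theorem ClientStep.work_recv {S S' : (algorithmB ℓ m V v₀ coord).State} {c : Client ℓ m}
    {p : Proc ℓ m k} {a : Msg ℓ V} (h : ClientStep S c (.recv p (.client c) a) S') :
    clientWork S' c ≤ clientWork S c := by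
  rcases c with w | r
  · change WriterStep _ _ _ _ _ at h
    simp only [clientWork]
    generalize wr S w = σ at h
    generalize wr S' w = σ' at h
    cases h
    exact writerRecv_work _ _ _
  · change ReaderStep _ _ _ _ _ at h
    simp only [clientWork]
    generalize rd S r = σ at h
    generalize rd S' r = σ' at h
    cases h
    exact readerRecv_work _ _ _

/-- Needs no invariant: a request that cannot be served is dropped, and an answer goes to the sender
alone, so the links of other clients are untouched. -/
theorem outbox_of_mem_serverRecv {s : Fin k} {σ σ' : ServerState ℓ m V s} {c : Client ℓ m}
    {a : Msg ℓ V} (h : σ' ∈ serverRecv σ c a) :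
    σ'.outbox = σ.outbox ∨ ∃ b, σ'.outbox = σ.outbox ++ [(c, b)] := by
  cases a with
  | writeValue κ i v =>
    rcases h with ⟨rfl, rfl⟩ | ⟨-, rfl⟩
    · exact Or.inr ⟨_, rfl⟩
    · exact Or.inl rfl
  | updateCoord κ b =>
    cases h
    exact Or.inr ⟨_, rfl⟩
  | getTagArray I =>
    cases h
    exact Or.inr ⟨_, rfl⟩
  | readValue κ =>
    rcases h with ⟨v, -, rfl⟩ | ⟨-, rfl⟩
    · exact Or.inr ⟨_, rfl⟩
    · exact Or.inl rfl
  | _ =>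
    cases h
    exact Or.inl rfl

theorem clientWork_congr {S S' : (algorithmB ℓ m V v₀ coord).State} {c : Client ℓ m}
    (h : S' (.proc (.client c)) = S (.proc (.client c))) : clientWork S' c = clientWork S c := by
  rcases c with w | r
  · simp only [clientWork, wr, h]
  · simp only [clientWork, rd, h]

theorem linkWork_congr {S S' : (algorithmB ℓ m V v₀ coord).State} {c : Client ℓ m} {s : Fin k}
    (h₁ : ts S' c s = ts S c s) (h₂ : ob S' c s = ob S c s) (h₃ : tc S' c s = tc S c s) :
    linkWork S' c s = linkWork S c s := by
  simp only [linkWork, h₁, h₂, h₃]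

/-- A step changes only one link of a client; `x` and `y` are the guaranteed loss and the permitted
gain on that link. -/
theorem sum_add_le_of_eq_of_ne {f g : Fin k → ℕ} {s : Fin k} {x y : ℕ}
    (h : ∀ s', s' ≠ s → f s' = g s') (hs : f s + x ≤ g s + y) :
    ∑ s, f s + x ≤ ∑ s, g s + y := by
  have hf : f s + ∑ s' ∈ Finset.univ.erase s, f s' = ∑ s, f s :=
    Finset.add_sum_erase _ f (Finset.mem_univ s)
  have hg : g s + ∑ s' ∈ Finset.univ.erase s, g s' = ∑ s, g s :=
    Finset.add_sum_erase _ g (Finset.mem_univ s)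
  have he : ∑ s' ∈ Finset.univ.erase s, f s' = ∑ s' ∈ Finset.univ.erase s, g s' :=
    Finset.sum_congr rfl fun s' hs' => h s' (Finset.ne_of_mem_erase hs')
  omega

/-- The work left for a client does not increase, except by an invocation, and decreases with each
action that concerns the client. -/
theorem SysStep.work_le {S S' : (algorithmB ℓ m V v₀ coord).State} {a : Act ℓ m V}
    (h : SysStep S S' a) (c : Client ℓ m) (hc : ∀ x, a ≠ .inv c x) :
    work S' c ≤ work S c ∧ (Concerns c a → work S' c < work S c) := by
  cases h with
  | inv c' x hs hf =>
    have hne : c' ≠ c := fun h => hc x (h ▸ rfl)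
    have : work S' c = work S c := by
      simp only [work]
      rw [clientWork_congr (hf _ (by simpa using hne.symm))]
      congr 1
      refine Finset.sum_congr rfl fun s _ => linkWork_congr (hf _ (by simp)) ?_ (hf _ (by simp))
      simp only [ob, sv, hf (.proc (.server s)) (by simp)]
    exact ⟨this.le, fun h => (hne h).elim⟩
  | resp c' y hs hf =>
    have hl : ∀ s, linkWork S' c s = linkWork S c s := fun s => by
      refine linkWork_congr (hf _ (by simp)) ?_ (hf _ (by simp))
      simp only [ob, sv, hf (.proc (.server s)) (by simp)]
    simp only [work, Concerns, hl]
    by_cases hne : c' = c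
    · subst hne
      have := hs.work_resp
      omega
    · rw [clientWork_congr (hf _ (by simpa using Ne.symm hne))]
      exact ⟨le_rfl, fun h => (hne h).elim⟩
  | sendS c' s a hs ht hf =>
    simp only [work, Concerns]
    have ho : ∀ s, ob S' c s = ob S c s := fun s => by
      simp only [ob, sv, hf (.proc (.server s)) (by simp) (by simp)]
    have hd : ∀ s, tc S' c s = tc S c s := fun s => hf _ (by simp) (by simp)
    by_cases hne : c' = c
    · subst hne
      have h1 := hs.work_send
      have := sum_add_le_of_eq_of_ne (f := linkWork S' c') (g := linkWork S c') (s := s) (x := 0)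
        (y := 3) (fun s' hs' => linkWork_congr (hf _ (by simp) (by simpa using hs')) (ho _) (hd _))
        (by simp only [linkWork, ho, hd, ht, Multiset.card_cons]; omega)
      omega
    · rw [clientWork_congr (hf _ (by simpa using Ne.symm hne) (by simp))]
      rw [Finset.sum_congr rfl fun s' _ => linkWork_congr (hf _ (by simp)
        (by simp [Ne.symm hne])) (ho s') (hd s')]
      exact ⟨le_rfl, fun h => (hne h).elim⟩
  | recvS c' s a hs ht hf =>
    simp only [work, Concerns]
    rw [clientWork_congr (hf _ (by simp) (by simp))]
    have hd : ∀ s, tc S' c s = tc S c s := fun s => hf _ (by simp) (by simp)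
    have ho : ∀ s', s' ≠ s → ob S' c s' = ob S c s' := fun s' hs' => by
      simp only [ob, sv, hf (.proc (.server s')) (by simpa using hs') (by simp)]
    by_cases hne : c' = c
    · subst hne
      -- A request of weight three is exchanged for at most one queued answer of weight two.
      have h1 : (ob S' c' s).length ≤ (ob S c' s).length + 1 := by
        simp only [ob]
        rcases outbox_of_mem_serverRecv hs with h | ⟨b, h⟩
        · rw [h]
          omega
        · simp [h, outFor_append, outFor_cons_self, outFor_nil]
      have := sum_add_le_of_eq_of_ne (f := linkWork S' c') (g := linkWork S c') (s := s) (x := 1)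
        (y := 0) (fun s' hs' => linkWork_congr (hf _ (by simp) (by simpa using hs')) (ho _ hs') (hd _))
        (by simp only [linkWork, hd, ht, Multiset.card_cons]; omega)
      omega
    · have ho' : ∀ s', ob S' c s' = ob S c s' := fun s' => by
        by_cases hs' : s' = s
        · subst hs'
          simp only [ob]
          rcases outbox_of_mem_serverRecv hs with h | ⟨b, h⟩
          · rw [h]
          · simp [h, outFor_append, outFor_cons_of_ne hne, outFor_nil]
        · exact ho _ hs'
      rw [Finset.sum_congr rfl fun s' _ => linkWork_congr (hf _ (by simp)
        (by simp [Ne.symm hne])) (ho' s') (hd s')]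
      exact ⟨le_rfl, fun h => (hne h).elim⟩
  | sendC c' s a hs hv hl ht hf =>
    simp only [work, Concerns]
    rw [clientWork_congr (hf _ (by simp) (by simp))]
    have hd : ∀ s, ts S' c s = ts S c s := fun s => hf _ (by simp) (by simp)
    have ho : ∀ s', s' ≠ s → ob S' c s' = ob S c s' := fun s' hs' => by
      simp only [ob, sv, hf (.proc (.server s')) (by simpa using hs') (by simp)]
    by_cases hne : c' = c
    · subst hne
      have h1 : ob S c' s = a :: ob S' c' s := by
        simp [ob, hs, outFor_cons_self]
      have := sum_add_le_of_eq_of_ne (f := linkWork S' c') (g := linkWork S c') (s := s) (x := 1)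
        (y := 0) (fun s' hs' => linkWork_congr (hd _) (ho _ hs') (hf _ (by simp) (by simpa using hs')))
        (by simp only [linkWork, hd, ht, h1, Multiset.card_cons, List.length_cons]; omega)
      omega
    · have ho' : ∀ s', ob S' c s' = ob S c s' := fun s' => by
        by_cases hs' : s' = s
        · subst hs'
          simp [ob, hs, outFor_cons_of_ne hne]
        · exact ho _ hs'
      rw [Finset.sum_congr rfl fun s' _ => linkWork_congr (hd _) (ho' s') (hf _ (by simp)
        (by simp [Ne.symm hne]))]
      exact ⟨le_rfl, fun h => (hne h).elim⟩
  | recvC c' s a hs ht hf =>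
    simp only [work, Concerns]
    have ho : ∀ s, ob S' c s = ob S c s := fun s => by
      simp only [ob, sv, hf (.proc (.server s)) (by simp) (by simp)]
    have hd : ∀ s, ts S' c s = ts S c s := fun s => hf _ (by simp) (by simp)
    by_cases hne : c' = c
    · subst hne
      have h1 := hs.work_recv
      have := sum_add_le_of_eq_of_ne (f := linkWork S' c') (g := linkWork S c') (s := s) (x := 1)
        (y := 0) (fun s' hs' => linkWork_congr (hd _) (ho _) (hf _ (by simp) (by simpa using hs')))
        (by simp only [linkWork, ho, hd, ht, Multiset.card_cons]; omega)
      omega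
    · rw [clientWork_congr (hf _ (by simpa using Ne.symm hne) (by simp))]
      rw [Finset.sum_congr rfl fun s' _ => linkWork_congr (hd _) (ho s') (hf _ (by simp)
        (by simp [Ne.symm hne]))]
      exact ⟨le_rfl, fun h => (hne h).elim⟩

theorem SysStep.exists_concerns {S S' : (algorithmB ℓ m V v₀ coord).State} {a : Act ℓ m V}
    (h : SysStep S S' a) : ∃ c, Concerns c a := by
  cases h <;> exact ⟨_, rfl⟩

end Measure

/-! ### Running a finite execution to quiescence. -/

section Extension

/-! ## Extension of finite executions to fair ones -/

/-- A finite fragment followed by one more step. -/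
def IOAutomaton.Fragment.snoc {A : Type u} {M : IOAutomaton A} (e : M.Fragment) (N : ℕ)
    (hN : e.len = N) (a : A) (S' : M.State) (h : M.step (e.state N) a S') : M.Fragment where
  len := (N + 1 : ℕ)
  state n := if n ≤ N then e.state n else S'
  act n := if n < N then e.act n else a
  step n hn := by
    have hn' : n < N + 1 := by exact_mod_cast hn
    rcases Nat.lt_succ_iff_lt_or_eq.1 hn' with h1 | rfl
    · simp only [h1, h1.le, if_true, Nat.succ_le_of_lt h1]
      exact e.step n (by rw [hN]; exact_mod_cast h1)
    · simpa using h

variable {ℓ m k : ℕ} {V : Fin k → Type u} {v₀ : ∀ i, V i} {coord : Fin k}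

instance : Fintype (Client ℓ m) :=
  Fintype.ofEquiv (Fin ℓ ⊕ Fin m)
    { toFun := Sum.elim .writer .reader
      invFun := fun | .writer w => .inl w | .reader r => .inr r
      left_inv := by rintro (_ | _) <;> rfl
      right_inv := by rintro (_ | _) <;> rfl }

/-- Invocations are inputs of the system, so performing enabled tasks never starts a transaction. -/
theorem ne_inv_of_mem_task {t : (algorithmB ℓ m V v₀ coord).Task} {a : Act ℓ m V}
    (h : a ∈ (algorithmB ℓ m V v₀ coord).task t) (c : Client ℓ m) (x : Inv V) : a ≠ .inv c x := by
  rintro rfl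
  obtain ⟨((w | r) | s) | ⟨c, s⟩ | ⟨s, c⟩, t⟩ := t
  · rcases h with h | ⟨s, a, h⟩ <;> cases h
  · rcases h with ⟨I, v, h⟩ | ⟨s, a, h⟩ <;> cases h
  · rcases h with ⟨c, a, h⟩
    cases h
  · cases h
  · cases h

/-- Every action concerns some client: the potential of that client drops and no other one rises. -/
theorem SysStep.sum_work_lt {S S' : (algorithmB ℓ m V v₀ coord).State} {a : Act ℓ m V}
    (h : SysStep S S' a) (ha : ∀ c x, a ≠ .inv c x) : ∑ c, work S' c < ∑ c, work S c := by
  obtain ⟨c, hc⟩ := h.exists_concerns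
  exact Finset.sum_lt_sum (fun c' _ => (h.work_le c' (ha c')).1)
    ⟨c, Finset.mem_univ c, (h.work_le c (ha c)).2 hc⟩

/-- Every finite fragment can be extended to a fair one without further invocations. -/
theorem exists_fair_extension (e : (algorithmB ℓ m V v₀ coord).Fragment) (N : ℕ)
    (hN : e.len = N) : ∃ f : (algorithmB ℓ m V v₀ coord).Fragment, f.Fair ∧ (N : ℕ∞) ≤ f.len ∧
      (∀ n ≤ N, f.state n = e.state n) ∧ (∀ n < N, f.act n = e.act n) ∧
      ∀ n, N ≤ n → ∀ c x, ¬ InvAt f c x n := by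
  -- The total potential bounds the number of locally controlled steps still possible, so performing
  -- enabled tasks one by one must stop.
  induction hw : ∑ c, work (e.state N) c using Nat.strong_induction_on generalizing e N with
  | _ W ih =>
    by_cases hq : ∃ t, (algorithmB ℓ m V v₀ coord).EnabledIn (e.state N)
        ((algorithmB ℓ m V v₀ coord).task t)
    · obtain ⟨t, a, hat, S', hs⟩ := hq
      have ha := ne_inv_of_mem_task hat
      obtain ⟨f, hf, hl, hst, hact, hinv⟩ := ih (∑ c, work S' c)
        (hw ▸ (sysStep_of_step hs).sum_work_lt ha) (e.snoc N hN a S' hs) (N + 1) rfl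
        (by simp [IOAutomaton.Fragment.snoc])
      refine ⟨f, hf, le_trans (by exact_mod_cast Nat.le_succ N) hl, fun n hn => ?_, fun n hn => ?_,
        fun n hn c x hi => ?_⟩
      · rw [hst n (by omega)]
        simp [IOAutomaton.Fragment.snoc, hn]
      · rw [hact n (by omega)]
        simp [IOAutomaton.Fragment.snoc, hn]
      · rcases hn.eq_or_lt with rfl | hn
        · refine ha c x ?_
          rw [← hi.2, hact _ (by omega)]
          simp [IOAutomaton.Fragment.snoc]
        · exact hinv n hn c x hi
    -- With no task enabled at its end, the finite fragment is itself fair.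
    · refine ⟨e, fun t => ⟨fun N' hN' he => hq ⟨t, ?_⟩, fun h => ?_⟩, hN.ge, fun _ _ => rfl,
        fun _ _ => rfl, fun n hn c x hi => ?_⟩
      · rw [hN] at hN'
        rwa [Nat.cast_injective hN']
      · rw [hN] at h
        exact (ENat.natCast_ne_top _ h).elim
      · have := hi.1
        rw [hN] at this
        exact absurd (by exact_mod_cast this) (not_lt.2 hn)

/-- An input is always enabled, and the fair extension adds no further invocation, so
well-formedness only has to be checked up to the new one. -/
theorem invocableAnytime : InvocableAnytime (algorithmB ℓ m V v₀ coord) := by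
  intro e N c x he hwf hN hx hc
  obtain ⟨S', hs⟩ := (algorithmB ℓ m V v₀ coord).input_enabled (e.state N) _ hx
  obtain ⟨f, hf, hl, hst, hact, hinv⟩ :=
    exists_fair_extension (e.snoc N hN (.inv c x) S' hs) (N + 1) rfl
  have hst' : ∀ n ≤ N, f.state n = e.state n := fun n hn => by
    rw [hst n (by omega)]
    simp [IOAutomaton.Fragment.snoc, hn]
  have hact' : ∀ n < N, f.act n = e.act n := fun n hn => by
    rw [hact n (by omega)]
    simp [IOAutomaton.Fragment.snoc, hn]
  have hactN : f.act N = .inv c x := by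
    rw [hact N (by omega)]
    simp [IOAutomaton.Fragment.snoc]
  have hlt : (N : ℕ∞) < f.len := lt_of_lt_of_le (by exact_mod_cast Nat.lt_succ_self N) hl
  refine ⟨f, ?_, ?_, hf, hlt, hst', hact', hactN⟩
  · change f.state 0 ∈ _
    rw [hst' 0 (Nat.zero_le _)]
    exact he
  · have hlow : ∀ n < N, (n : ℕ∞) < e.len ∧ (n : ℕ∞) < f.len := fun n hn => by
      have h1 : (n : ℕ∞) < N := by exact_mod_cast hn
      exact ⟨hN ▸ h1, h1.trans hlt⟩
    intro c' x' x'' n n' h1 h2 hnn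
    have hn' : n' ≤ N := by
      by_contra h
      exact hinv n' (by omega) _ _ h2
    have h1e : InvAt e c' x' n := ⟨(hlow n (by omega)).1, by rw [← hact' n (by omega)]; exact h1.2⟩
    -- The later invocation is either the new one, before which all transactions of its client have
    -- completed by assumption, or one inside the old execution.
    rcases hn'.eq_or_lt with rfl | hlt'
    · have hcc : c' = c := by
        have := h2.2
        rw [hactN] at this
        cases this
        rfl
      subst hcc
      obtain ⟨y, j, hj, hr, -⟩ := hc x' n h1e
      have hjN : j < n' := by
        have := hr.1
        rw [hN] at this
        exact_mod_cast this
      exact ⟨y, j, hj, hjN, (hlow j hjN).2, by rw [hact' j hjN]; exact hr.2⟩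
    · obtain ⟨y, j, hj, hj', hr⟩ := hwf c' x' x'' n n' h1e
        ⟨(hlow n' hlt').1, by rw [← hact' n' hlt']; exact h2.2⟩ hnn
      exact ⟨y, j, hj, hj', (hlow j (by omega)).2, by rw [hact' j (by omega)]; exact hr.2⟩

end Extension

/-! ### Outstanding requests and the contents of the links. -/

section Pending

variable {ℓ m k : ℕ} {V : Fin k → Type u} {v₀ : ∀ i, V i} {coord : Fin k}

/-! ## Outstanding requests -/

/-- The request of writer `w` to server `s` whose acknowledgement it awaits. -/
def writerPend (coord : Fin k) (w : Fin ℓ) (σ : WriterState V) (s : Fin k) : Option (Msg ℓ V) :=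
  match σ.phase with
  | .writing I v unsent unacked =>
      if h : s ∈ I ∧ s ∈ unacked ∧ s ∉ unsent then
        some (.writeValue (σ.z, some w) s (v ⟨s, h.1⟩)) else none
  | .updating I true =>
      if s = coord then some (.updateCoord (σ.z, some w) (fun i => decide (i ∈ I))) else none
  | _ => none

/-- The request of a reader to server `s` whose answer it awaits. -/
def readerPend (coord : Fin k) (σ : ReaderState ℓ V) (s : Fin k) : Option (Msg ℓ V) :=
  match σ with
  | .getTag I true => if s = coord then some (.getTagArray I) else none
  | .reading I _ κ unsent got =>
      if s ∈ I ∧ s ∉ unsent ∧ got s = none then some (.readValue (κ s)) else none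
  | _ => none

/-- The request of client `c` to server `s` whose answer it awaits. -/
def pend (S : (algorithmB ℓ m V v₀ coord).State) (c : Client ℓ m) (s : Fin k) :
    Option (Msg ℓ V) :=
  match c with
  | .writer w => writerPend coord w (wr S w) s
  | .reader r => readerPend coord (rd S r) s

/-- Consistency of the sets in the state of a writer. -/
def WriterPhase.Shape : WriterPhase V → Prop
  | .writing I _ unsent unacked => unsent ⊆ unacked ∧ unacked ⊆ I ∧ unacked.Nonempty
  | _ => True

/-- Consistency of the sets in the state of a reader. -/
def ReaderState.Shape : ReaderState ℓ V → Prop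
  | .reading I _ _ unsent got => unsent ⊆ I ∧ ∀ i ∈ unsent, got i = none
  | _ => True

/-- Consistency of the sets in the state of a client. -/
def Shape (S : (algorithmB ℓ m V v₀ coord).State) : Client ℓ m → Prop
  | .writer w => (wr S w).phase.Shape
  | .reader r => (rd S r).Shape

/-- Client `c` has no transaction in progress. -/
def Idle (S : (algorithmB ℓ m V v₀ coord).State) : Client ℓ m → Prop
  | .writer w => (wr S w).phase = .idle
  | .reader r => rd S r = .idle

/-- `a` is of the kind of message with which server `s` answers the request `q`. -/
def Fits (s : Fin k) : Msg ℓ V → Msg ℓ V → Prop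
  | .writeValue _ _ _, .ack => True
  | .updateCoord _ _, .ackTag _ => True
  | .getTagArray _, .tagArray _ _ => True
  | .readValue _, .value i _ => i = s
  | _, _ => False

theorem pend_congr {S S' : (algorithmB ℓ m V v₀ coord).State} {c : Client ℓ m}
    (h : S' (.proc (.client c)) = S (.proc (.client c))) (s : Fin k) : pend S' c s = pend S c s := by
  rcases c with w | r
  · simp only [pend, wr, h]
  · simp only [pend, rd, h]

theorem shape_congr {S S' : (algorithmB ℓ m V v₀ coord).State} {c : Client ℓ m}
    (h : S' (.proc (.client c)) = S (.proc (.client c))) : Shape S' c ↔ Shape S c := by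
  rcases c with w | r
  · simp only [Shape, wr, h]
  · simp only [Shape, rd, h]

theorem pend_of_idle {S : (algorithmB ℓ m V v₀ coord).State} {c : Client ℓ m} (h : Idle S c)
    (s : Fin k) : pend S c s = none := by
  rcases c with w | r <;> simp only [Idle] at h
  · simp [pend, writerPend, h]
  · simp [pend, readerPend, h]

theorem ClientStep.of_inv {S S' : (algorithmB ℓ m V v₀ coord).State} {c : Client ℓ m} {x : Inv V}
    (h : ClientStep S c (.inv c x) S') (hi : Idle S c) : (∀ s, pend S' c s = none) ∧ Shape S' c := by
  rcases c with w | r <;> simp only [pend, Shape, Idle, ClientStep] at *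
  · generalize wr S w = σ at *
    generalize wr S' w = σ' at *
    cases h with
    | inv z I hI v => simp [writerPend, WriterPhase.Shape, hI]
    | invBusy _ _ _ _ h => exact (h hi).elim
  · generalize rd S r = σ at *
    generalize rd S' r = σ' at *
    cases h with
    | inv z I => simp [readerPend, ReaderState.Shape]
    | invBusy _ _ _ h => exact (h hi).elim

theorem ClientStep.of_resp {S S' : (algorithmB ℓ m V v₀ coord).State} {c : Client ℓ m} {y : Resp V}
    (h : ClientStep S c (.resp c y) S') : (∀ s, pend S c s = none) ∧ Idle S' c := by
  rcases c with w | r <;> simp only [pend, Idle, ClientStep] at *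
  · generalize wr S w = σ at *
    generalize wr S' w = σ' at *
    cases h
    simp [writerPend]
  · generalize rd S r = σ at *
    generalize rd S' r = σ' at *
    cases h with
    | resp I t κ got v hv =>
      refine ⟨fun s => ?_, rfl⟩
      simp only [readerPend, ite_eq_right_iff]
      rintro ⟨hs, -, h⟩
      rw [hv ⟨s, hs⟩] at h
      cases h

theorem Idle.shape {S : (algorithmB ℓ m V v₀ coord).State} {c : Client ℓ m} (h : Idle S c) :
    Shape S c := by
  rcases c with w | r <;> simp only [Idle] at h <;>
    simp [Shape, h, WriterPhase.Shape, ReaderState.Shape]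

/-- `Shape` makes the new request count as outstanding: a server in `unsent` has not yet
acknowledged or answered. -/
theorem ClientStep.of_send {S S' : (algorithmB ℓ m V v₀ coord).State} {c : Client ℓ m} {s : Fin k}
    {a : Msg ℓ V} (h : ClientStep S c (.send (.client c) (.server s) a) S') (hc : Shape S c) :
    pend S c s = none ∧ pend S' c s = some a ∧ (∀ s', s' ≠ s → pend S' c s' = pend S c s') ∧
      Shape S' c := by
  rcases c with w | r <;> simp only [pend, Shape, ClientStep] at *
  · generalize wr S w = σ at *
    generalize wr S' w = σ' at *
    cases h with
    | sendValue z I v un una _ hi hu =>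
      refine ⟨by simp [writerPend, hu], ?_, fun s' hs' => ?_, ?_⟩
      · simp [writerPend, hi, hc.1 hu]
      · simp [writerPend, hs']
      · exact ⟨(Finset.erase_subset _ _).trans hc.1, hc.2⟩
    | sendUpdate =>
      refine ⟨by simp [writerPend], ?_, fun s' hs' => ?_, ?_⟩ <;>
        simp +contextual [writerPend, WriterPhase.Shape, *]
  · generalize rd S r = σ at *
    generalize rd S' r = σ' at *
    cases h with
    | sendGetTag =>
      refine ⟨by simp [readerPend], ?_, fun s' hs' => ?_, ?_⟩ <;>
        simp +contextual [readerPend, ReaderState.Shape, *]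
    | sendRead I t κ un got _ hu =>
      refine ⟨by simp [readerPend, hu], ?_, fun s' hs' => ?_, ?_⟩
      · simp [readerPend, hc.1 hu, hc.2 _ hu]
      · simp [readerPend, hs']
      · exact ⟨(Finset.erase_subset _ _).trans hc.1,
          fun i hi => hc.2 i (Finset.mem_of_mem_erase hi)⟩

/-- A fitting answer to an outstanding request is never ignored, and it settles that request alone:
a change of phase happens only when no other request is outstanding, and the new phase starts with
none. -/
theorem ClientStep.of_recv {S S' : (algorithmB ℓ m V v₀ coord).State} {c : Client ℓ m} {s : Fin k}
    {a q : Msg ℓ V} (h : ClientStep S c (.recv (.server s) (.client c) a) S') (hc : Shape S c)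
    (hq : pend S c s = some q) (hf : Fits s q a) :
    pend S' c s = none ∧ (∀ s', s' ≠ s → pend S' c s' = pend S c s') ∧ Shape S' c := by
  rcases c with w | r <;> simp only [pend, Shape, ClientStep] at *
  · generalize wr S w = σ at *
    generalize wr S' w = σ' at *
    cases h
    obtain ⟨z, ph⟩ := σ
    rcases ph with _ | ⟨I, v, un, una⟩ | ⟨I, _ | _⟩ | t <;> simp only [writerPend] at hq
    · cases hq
    · split_ifs at hq with hs
      cases hq
      cases a <;> simp only [Fits] at hf
      simp only [writerRecv]
      split_ifs with he
      · refine ⟨rfl, fun s' hs' => ?_, trivial⟩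
        -- The last acknowledgement ends the phase, so no other server may still owe one.
        have : s' ∉ una := fun h => by
          have : s' ∈ una.erase s := Finset.mem_erase.2 ⟨hs', h⟩
          simp [he] at this
        simp [writerPend, this]
      · refine ⟨by simp [writerPend], fun s' hs' => by simp [writerPend, hs'], ?_, ?_, ?_⟩
        · intro i hi
          exact Finset.mem_erase.2 ⟨fun h => hs.2.2 (by rwa [← h]), hc.1 hi⟩
        · exact (Finset.erase_subset _ _).trans hc.2.1
        · exact Finset.nonempty_iff_ne_empty.2 he
    · cases hq
    · split_ifs at hq with hs
      cases hq
      cases a <;> simp only [Fits] at hf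
      simp +contextual [writerRecv, hs, writerPend, WriterPhase.Shape]
    · cases hq
  · generalize rd S r = σ at *
    generalize rd S' r = σ' at *
    cases h
    rcases σ with _ | ⟨I, _ | _⟩ | ⟨I, t, κ, un, got⟩ <;> simp only [readerPend] at hq
    · cases hq
    · cases hq
    · split_ifs at hq with hs
      cases hq
      cases a <;> simp only [Fits] at hf
      simp +contextual [readerRecv, hs, readerPend, ReaderState.Shape]
    · split_ifs at hq with hs
      cases hq
      cases a <;> simp only [Fits] at hf
      subst hf
      simp only [readerRecv, if_true]
      refine ⟨by simp [readerPend], fun s' hs' => by simp [readerPend, hs'], hc.1, fun i hi => ?_⟩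
      rw [Function.update_of_ne]
      · exact hc.2 i hi
      · rintro rfl
        exact hs.2.1 hi

/-! ## The state of a link -/

/-- Contents of the link of a client with a server (messages to the server, answers not yet sent,
messages to the client): exactly one message if a request is outstanding, and none otherwise. -/
inductive LinkState (P : Msg ℓ V → Msg ℓ V → Prop) :
    Option (Msg ℓ V) → Multiset (Msg ℓ V) → List (Msg ℓ V) → Multiset (Msg ℓ V) → Prop
  | empty : LinkState P none 0 [] 0
  | request (q : Msg ℓ V) : LinkState P (some q) {q} [] 0
  | answer (q a : Msg ℓ V) : P q a → LinkState P (some q) 0 [a] 0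
  | back (q a : Msg ℓ V) : P q a → LinkState P (some q) 0 [] {a}

namespace LinkState

variable {P P' : Msg ℓ V → Msg ℓ V → Prop} {q : Option (Msg ℓ V)} {t b : Multiset (Msg ℓ V)}
  {o : List (Msg ℓ V)} {a : Msg ℓ V}

/-- The predicate has to be transported only along the outstanding request; if there is none, any
predicate will do. -/
theorem mono (h : LinkState P q t o b) (hP : ∀ q' a, q = some q' → P q' a → P' q' a) :
    LinkState P' q t o b := by
  cases h with
  | empty => exact .empty
  | request => exact .request _
  | answer _ _ h => exact .answer _ _ (hP _ _ rfl h)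
  | back _ _ h => exact .back _ _ (hP _ _ rfl h)

theorem eq_of_none (h : LinkState P none t o b) : t = 0 ∧ o = [] ∧ b = 0 := by
  cases h
  exact ⟨rfl, rfl, rfl⟩

theorem send (h : LinkState P none t o b) (a : Msg ℓ V) : LinkState P (some a) (a ::ₘ t) o b := by
  obtain ⟨rfl, rfl, rfl⟩ := h.eq_of_none
  exact .request a

/-- One message in transit to the server determines the whole link. This traces a received message
back to the outstanding request. -/
theorem eq_of_cons_request (h : LinkState P q (a ::ₘ t) o b) :
    q = some a ∧ t = 0 ∧ o = [] ∧ b = 0 := by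
  generalize ht : a ::ₘ t = t' at h
  cases h with
  | empty => simp at ht
  | request q =>
    rw [← Multiset.cons_zero, Multiset.cons_eq_cons] at ht
    rcases ht with ⟨rfl, rfl⟩ | ⟨-, c, -, h⟩
    · exact ⟨rfl, rfl, rfl, rfl⟩
    · simp at h
  | answer => simp at ht
  | back => simp at ht

theorem sendAnswer (h : LinkState P q t (a :: o) b) : LinkState P q t o (a ::ₘ b) := by
  generalize ho : a :: o = o' at h
  cases h with
  | empty => simp at ho
  | request => simp at ho
  | answer q a' h =>
    cases ho
    exact .back _ _ h
  | back => simp at ho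

theorem eq_of_cons_answer (h : LinkState P q t o (a ::ₘ b)) :
    ∃ q', q = some q' ∧ P q' a ∧ t = 0 ∧ o = [] ∧ b = 0 := by
  generalize hb : a ::ₘ b = b' at h
  cases h with
  | empty => simp at hb
  | request => simp at hb
  | answer => simp at hb
  | back q a' h =>
    rw [← Multiset.cons_zero, Multiset.cons_eq_cons] at hb
    rcases hb with ⟨rfl, rfl⟩ | ⟨-, c, -, h⟩
    · exact ⟨_, rfl, h, rfl, rfl, rfl⟩
    · simp at h

end LinkState

/-- One marked entry suffices for the default value in `lastKey` to play no role. -/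
theorem lastKey_mem {L : List (Key ℓ × (Fin k → Bool))} {p : Key ℓ × (Fin k → Bool)} (i : Fin k)
    (hp : p ∈ L) (hi : p.2 i = true) : ∃ b, (lastKey L i, b) ∈ L ∧ b i = true := by
  have hne : L.filter (fun p => p.2 i) ≠ [] := List.ne_nil_of_mem (List.mem_filter.2 ⟨hp, hi⟩)
  have hm := List.mem_filter.1 (List.getLast_mem hne)
  refine ⟨((L.filter (fun p => p.2 i)).getLast hne).2, ?_, hm.2⟩
  rw [lastKey, List.getLast?_eq_some_getLast hne]
  exact hm.1

/-- This mirrors, at the level of keys, the effect of a WRITE on the values. -/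
theorem lastKey_append (L : List (Key ℓ × (Fin k → Bool))) (κ : Key ℓ) (b : Fin k → Bool)
    (i : Fin k) : lastKey (L ++ [(κ, b)]) i = if b i = true then κ else lastKey L i := by
  by_cases h : b i = true <;> simp [lastKey, h, List.filter_append]

end Pending

/-! ### The invariant `Good` and its preservation by every step. -/

section Invariant

variable {ℓ m k : ℕ} {V : Fin k → Type u} {v₀ : ∀ i, V i} {coord : Fin k}

/-! ## The invariant of well-formed executions -/

/-- The transaction `x` that `c` invoked at position `p` is in progress after `n` actions. -/
def Pending (e : (algorithmB ℓ m V v₀ coord).Fragment) (c : Client ℓ m) (n p : ℕ) (x : Inv V) :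
    Prop :=
  p < n ∧ InvAt e c x p ∧
    ∀ j, p < j → j < n → (∀ x', e.act j ≠ .inv c x') ∧ ∀ y, e.act j ≠ .resp c y

/-- `v` is the value that belongs to the key `κ` at server `s`: the initial value, or the value
written by that `WRITE` of the writer of `κ` which set its counter to the number of `κ`. -/
def KeyVal (e : (algorithmB ℓ m V v₀ coord).Fragment) (κ : Key ℓ) (s : Fin k) (v : V s) : Prop :=
  (κ.2 = none ∧ v = v₀ s) ∨ ∃ w p I hI f, ∃ h : s ∈ I, κ.2 = some w ∧
    InvAt e (.writer w) (.write I hI f) p ∧ (wr (e.state (p + 1)) w).z = κ.1 ∧ v = f ⟨s, h⟩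

/-- Server `s` has a value with key `κ`. -/
def HasKey (S : (algorithmB ℓ m V v₀ coord).State) (s : Fin k) (κ : Key ℓ) : Prop :=
  ∃ v, (κ, v) ∈ (sv S s).vals

/-- The coordinator received the get-tag-array request of the present transaction of reader `r` at
position `q`, and the keys `κ` are those that it had then. -/
def TagAt (e : (algorithmB ℓ m V v₀ coord).Fragment) (c : Client ℓ m) (n : ℕ)
    (I : Finset (Fin k)) (κ : Fin k → Key ℓ) (q : ℕ) : Prop :=
  q < n ∧ e.act q = .recv (.client c) (.server coord) (.getTagArray I) ∧
    κ = lastKey (sv (e.state q) coord).list ∧ ∀ j, q ≤ j → j < n → ∀ x, e.act j ≠ .inv c x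

/-- `a` is a correct answer of server `s` to the request `q` of client `c`. -/
def AnsOK (e : (algorithmB ℓ m V v₀ coord).Fragment) (n : ℕ) (c : Client ℓ m) (s : Fin k) :
    Msg ℓ V → Msg ℓ V → Prop
  | .writeValue κ _ _, .ack => HasKey (e.state n) s κ
  | .updateCoord _ _, .ackTag _ => True
  | .getTagArray I, .tagArray _ κ =>
      (∃ q, TagAt e c n I κ q) ∧ ∀ i, HasKey (e.state n) i (κ i)
  | .readValue κ, .value i v => i = s ∧ (κ, v) ∈ (sv (e.state n) i).vals
  | _, _ => False

/-- The part of the invariant that concerns the program counter of a writer. -/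
def WriterOK (e : (algorithmB ℓ m V v₀ coord).Fragment) (n : ℕ) (w : Fin ℓ)
    (σ : WriterState V) : Prop :=
  match σ.phase with
  | .idle => True
  | .writing I v _ unacked =>
      (∃ p hI, Pending e (.writer w) n p (.write I hI v) ∧ (wr (e.state (p + 1)) w).z = σ.z) ∧
        ∀ i ∈ I, i ∉ unacked → HasKey (e.state n) i (σ.z, some w)
  | .updating I _ =>
      (∃ p hI v, Pending e (.writer w) n p (.write I hI v) ∧
        (wr (e.state (p + 1)) w).z = σ.z) ∧
        ∀ i ∈ I, HasKey (e.state n) i (σ.z, some w)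
  | .finished _ => ∃ p I hI v, Pending e (.writer w) n p (.write I hI v)

/-- The part of the invariant that concerns the program counter of a reader. -/
def ReaderOK (e : (algorithmB ℓ m V v₀ coord).Fragment) (n : ℕ) (r : Fin m)
    (σ : ReaderState ℓ V) : Prop :=
  match σ with
  | .idle => True
  | .getTag I _ => ∃ p hI, Pending e (.reader r) n p (.read I hI)
  | .reading I _ κ _ got =>
      (∃ p hI, Pending e (.reader r) n p (.read I hI)) ∧ (∃ q, TagAt e (.reader r) n I κ q) ∧
        (∀ i, HasKey (e.state n) i (κ i)) ∧
        ∀ i v, got i = some v → (κ i, v) ∈ (sv (e.state n) i).vals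

/-- The part of the invariant that concerns the program counter of a client. -/
def ClientOK (e : (algorithmB ℓ m V v₀ coord).Fragment) (n : ℕ) : Client ℓ m → Prop
  | .writer w => WriterOK e n w (wr (e.state n) w)
  | .reader r => ReaderOK e n r (rd (e.state n) r)

/-- The invariant. -/
structure Good (e : (algorithmB ℓ m V v₀ coord).Fragment) (n : ℕ) : Prop where
  shape : ∀ c, Shape (e.state n) c
  client : ∀ c, ClientOK e n c
  link : ∀ c s, LinkState (AnsOK e n c s) (pend (e.state n) c s) (ts (e.state n) c s)
    (ob (e.state n) c s) (tc (e.state n) c s)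
  vals : ∀ s κ v, (κ, v) ∈ (sv (e.state n) s).vals → KeyVal e κ s v
  keys : ∀ κ b i, (κ, b) ∈ (sv (e.state n) coord).list → b i = true → HasKey (e.state n) i κ
  init : (initKey ℓ, fun _ => true) ∈ (sv (e.state n) coord).list

variable {e : (algorithmB ℓ m V v₀ coord).Fragment} {n : ℕ}

theorem good_zero (he : e.IsExecution) : Good e 0 := by
  have h1 : ∀ c, Idle (e.state 0) c := by
    rintro (w | r)
    · exact congrArg WriterState.phase (he (.proc (.client (.writer w))))
    · exact he (.proc (.client (.reader r)))
  have h2 : ∀ s, sv (e.state 0) s = ⟨{(initKey ℓ, v₀ s)}, [(initKey ℓ, fun _ => true)], []⟩ :=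
    fun s => he (.proc (.server s))
  have h3 : ∀ c s, ts (e.state 0) c s = 0 := fun c s => he (.toServer c s)
  have h4 : ∀ c s, tc (e.state 0) c s = 0 := fun c s => he (.toClient s c)
  refine ⟨fun c => (h1 c).shape, fun c => ?_, fun c s => ?_, fun s κ v h => ?_,
    fun κ b i h _ => ?_, ?_⟩
  · have := h1 c
    rcases c with w | r <;> simp only [Idle] at this
    · simp [ClientOK, WriterOK, this]
    · simp [ClientOK, ReaderOK, this]
  · rw [pend_of_idle (h1 c), h3, h4, ob, h2]
    exact .empty
  · simp only [h2, Set.mem_singleton_iff, Prod.mk.injEq] at h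
    exact Or.inl ⟨by rw [h.1]; rfl, h.2⟩
  · simp only [h2, List.mem_singleton, Prod.mk.injEq] at h
    exact ⟨v₀ i, by simp [h2, h.1]⟩
  · simp [h2]

theorem vals_subset_of_mem_serverRecv {s : Fin k} {σ σ' : ServerState ℓ m V s} {c : Client ℓ m}
    {a : Msg ℓ V} (h : σ' ∈ serverRecv σ c a) : σ.vals ⊆ σ'.vals := by
  cases a with
  | writeValue κ i v =>
    rcases h with ⟨rfl, rfl⟩ | ⟨-, rfl⟩
    · exact Set.subset_insert _ _
    · exact subset_rfl
  | readValue κ => rcases h with ⟨v, -, rfl⟩ | ⟨-, rfl⟩ <;> exact subset_rfl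
  | _ =>
    cases h
    exact subset_rfl

/-- Servers only insert pairs. This makes every clause of the invariant about stored keys stable. -/
theorem SysStep.vals_subset {S S' : (algorithmB ℓ m V v₀ coord).State} {a : Act ℓ m V}
    (h : SysStep S S' a) (s : Fin k) : (sv S s).vals ⊆ (sv S' s).vals := by
  cases h with
  | inv c x _ hf => rw [sv, sv, hf _ (by simp)]
  | resp c x _ hf => rw [sv, sv, hf _ (by simp)]
  | sendS c s' a _ _ hf => rw [sv, sv, hf _ (by simp) (by simp)]
  | recvC c s' a _ _ hf => rw [sv, sv, hf _ (by simp) (by simp)]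
  | recvS c s' a hs _ hf =>
    by_cases h : s = s'
    · subst h
      exact vals_subset_of_mem_serverRecv hs
    · rw [sv, sv, hf _ (by simpa using h) (by simp)]
  | sendC c s' a _ hv _ _ hf =>
    by_cases h : s = s'
    · subst h
      rw [hv]
    · rw [sv, sv, hf _ (by simpa using h) (by simp)]

theorem HasKey.mono {S S' : (algorithmB ℓ m V v₀ coord).State} {a : Act ℓ m V}
    (h : SysStep S S' a) {s : Fin k} {κ : Key ℓ} (hk : HasKey S s κ) : HasKey S' s κ :=
  hk.imp fun _ hv => h.vals_subset s hv

theorem Pending.succ {c : Client ℓ m} {p : ℕ} {x : Inv V} (h : Pending e c n p x)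
    (h1 : ∀ x, e.act n ≠ .inv c x) (h2 : ∀ y, e.act n ≠ .resp c y) : Pending e c (n + 1) p x := by
  refine ⟨h.1.trans (Nat.lt_succ_self n), h.2.1, fun j hj hj' => ?_⟩
  rcases Nat.lt_succ_iff_lt_or_eq.1 hj' with h' | rfl
  · exact h.2.2 j hj h'
  · exact ⟨h1, h2⟩

theorem TagAt.succ {c : Client ℓ m} {I : Finset (Fin k)} {κ : Fin k → Key ℓ} {q : ℕ}
    (h : TagAt e c n I κ q) (h1 : ∀ x, e.act n ≠ .inv c x) : TagAt e c (n + 1) I κ q := by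
  refine ⟨h.1.trans (Nat.lt_succ_self n), h.2.1, h.2.2.1, fun j hj hj' => ?_⟩
  rcases Nat.lt_succ_iff_lt_or_eq.1 hj' with h' | rfl
  · exact h.2.2.2 j hj h'
  · exact h1

theorem sysStep (hn : (n : ℕ∞) < e.len) : SysStep (e.state n) (e.state (n + 1)) (e.act n) :=
  sysStep_of_step (e.step n hn)

/-- Stored pairs stay stored, and the clause on tag arrays refers to the present READ as long as the
client invokes nothing new. -/
theorem AnsOK.succ (hn : (n : ℕ∞) < e.len) {c : Client ℓ m} {s : Fin k} {q a : Msg ℓ V}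
    (h1 : ∀ x, e.act n ≠ .inv c x) (h : AnsOK e n c s q a) : AnsOK e (n + 1) c s q a := by
  have hs := sysStep hn
  cases q <;> cases a <;> simp only [AnsOK] at h ⊢
  · exact h.mono hs
  · exact ⟨h.1.imp fun _ hq => hq.succ h1, fun i => (h.2 i).mono hs⟩
  · exact ⟨h.1, hs.vals_subset _ h.2⟩

theorem AnsOK.fits {c : Client ℓ m} {s : Fin k} {q a : Msg ℓ V} (h : AnsOK e n c s q a) :
    Fits s q a := by
  cases q <;> cases a <;> simp only [AnsOK, Fits] at h ⊢
  exact h.1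

theorem WriterOK.succ (hn : (n : ℕ∞) < e.len) {w : Fin ℓ} {σ : WriterState V}
    (h1 : ∀ x, e.act n ≠ .inv (.writer w) x) (h2 : ∀ y, e.act n ≠ .resp (.writer w) y)
    (h : WriterOK e n w σ) : WriterOK e (n + 1) w σ := by
  have hs := sysStep hn
  obtain ⟨z, ph⟩ := σ
  rcases ph with _ | ⟨I, v, un, una⟩ | ⟨I, b⟩ | t <;> simp only [WriterOK] at h ⊢
  · obtain ⟨⟨p, hI, hp, hz⟩, h⟩ := h
    exact ⟨⟨p, hI, hp.succ h1 h2, hz⟩, fun i hi hu => (h i hi hu).mono hs⟩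
  · obtain ⟨⟨p, hI, v, hp, hz⟩, h⟩ := h
    exact ⟨⟨p, hI, v, hp.succ h1 h2, hz⟩, fun i hi => (h i hi).mono hs⟩
  · obtain ⟨p, I, hI, v, hp⟩ := h
    exact ⟨p, I, hI, v, hp.succ h1 h2⟩

theorem ReaderOK.succ (hn : (n : ℕ∞) < e.len) {r : Fin m} {σ : ReaderState ℓ V}
    (h1 : ∀ x, e.act n ≠ .inv (.reader r) x) (h2 : ∀ y, e.act n ≠ .resp (.reader r) y)
    (h : ReaderOK e n r σ) : ReaderOK e (n + 1) r σ := by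
  have hs := sysStep hn
  rcases σ with _ | ⟨I, b⟩ | ⟨I, t, κ, un, got⟩ <;> simp only [ReaderOK] at h ⊢
  · obtain ⟨p, hI, hp⟩ := h
    exact ⟨p, hI, hp.succ h1 h2⟩
  · obtain ⟨⟨p, hI, hp⟩, ⟨q, hq⟩, hk, hg⟩ := h
    exact ⟨⟨p, hI, hp.succ h1 h2⟩, ⟨q, hq.succ h1⟩, fun i => (hk i).mono hs,
      fun i v hv => hs.vals_subset i (hg i v hv)⟩

/-- A busy client has a transaction in progress. -/
theorem Good.exists_pending (hg : Good e n) {c : Client ℓ m} (h : ¬ Idle (e.state n) c) :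
    ∃ p x, Pending e c n p x := by
  have := hg.client c
  rcases c with w | r <;> simp only [Idle, ClientOK] at this h
  · generalize wr (e.state n) w = σ at *
    obtain ⟨z, ph⟩ := σ
    rcases ph with _ | ⟨I, v, un, una⟩ | ⟨I, b⟩ | t <;> simp only [WriterOK] at this
    · exact (h rfl).elim
    · obtain ⟨⟨p, hI, hp, hz⟩, -⟩ := this
      exact ⟨_, _, hp⟩
    · obtain ⟨⟨p, hI, v, hp, hz⟩, -⟩ := this
      exact ⟨_, _, hp⟩
    · obtain ⟨p, I, hI, v, hp⟩ := this
      exact ⟨_, _, hp⟩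
  · generalize rd (e.state n) r = σ at *
    rcases σ with _ | ⟨I, b⟩ | ⟨I, t, κ, un, got⟩ <;> simp only [ReaderOK] at this
    · exact (h rfl).elim
    · obtain ⟨p, hI, hp⟩ := this
      exact ⟨_, _, hp⟩
    · obtain ⟨⟨p, hI, hp⟩, -⟩ := this
      exact ⟨_, _, hp⟩

/-- This is where well-formedness enters the invariant: a busy client has a transaction in progress
without a response, so it may not invoke another one. -/
theorem Good.idle_of_inv (hg : Good e n) (hwf : WellFormed e) {c : Client ℓ m} {x : Inv V}
    (h : InvAt e c x n) : Idle (e.state n) c := by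
  by_contra hi
  obtain ⟨p, x', hp⟩ := hg.exists_pending hi
  obtain ⟨y, j, hj, hj', hr⟩ := hwf c x' x p n hp.2.1 h hp.1
  exact (hp.2.2 j hj hj').2 y hr.2

/-- The message that a client receives is a correct answer to an outstanding request. -/
theorem Good.of_recvC (hg : Good e n) (hn : (n : ℕ∞) < e.len) {c : Client ℓ m} {s : Fin k}
    {a : Msg ℓ V} (ha : e.act n = .recv (.server s) (.client c) a) :
    ∃ q, pend (e.state n) c s = some q ∧ AnsOK e n c s q a := by
  have hs := sysStep hn
  rw [ha] at hs
  cases hs with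
  | recvC c s a _ ht _ =>
    have := hg.link c s
    rw [ht] at this
    obtain ⟨q, h1, h2, -⟩ := this.eq_of_cons_answer
    exact ⟨q, h1, h2⟩

/-- The message that a server receives is an outstanding request. -/
theorem Good.of_recvS (hg : Good e n) (hn : (n : ℕ∞) < e.len) {c : Client ℓ m} {s : Fin k}
    {a : Msg ℓ V} (ha : e.act n = .recv (.client c) (.server s) a) :
    pend (e.state n) c s = some a ∧ ts (e.state n) c s = {a} ∧ ob (e.state n) c s = [] ∧
      tc (e.state n) c s = 0 := by
  have hs := sysStep hn
  rw [ha] at hs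
  cases hs with
  | recvS c s a _ ht _ =>
    have := hg.link c s
    rw [ht] at this
    obtain ⟨h1, h2, h3, h4⟩ := this.eq_of_cons_request
    refine ⟨h1, ?_, h3, h4⟩
    rw [ht, h2]
    rfl

/-- Only steps of the client's own automaton need an argument. The crucial ones are receipts: by the
link clause the message is a correct answer, and its correctness is the fact that the next program
counter asserts. -/
theorem Good.clientOK_succ (hg : Good e n) (hwf : WellFormed e) (hn : (n : ℕ∞) < e.len)
    (c : Client ℓ m) : ClientOK e (n + 1) c := by
  have hc := hg.client c
  have hs := sysStep hn
  have same : e.state (n + 1) (.proc (.client c)) = e.state n (.proc (.client c)) →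
      (∀ x, e.act n ≠ .inv c x) → (∀ y, e.act n ≠ .resp c y) → ClientOK e (n + 1) c := by
    intro h h1 h2
    rcases c with w | r
    · simp only [ClientOK, wr, h] at hc ⊢
      exact WriterOK.succ hn h1 h2 hc
    · simp only [ClientOK, rd, h] at hc ⊢
      exact ReaderOK.succ hn h1 h2 hc
  generalize ha : e.act n = a at hs
  cases hs with
  | inv c' x hst hf =>
    by_cases hcc : c' = c
    · subst hcc
      have hi := hg.idle_of_inv hwf ⟨hn, ha⟩
      have hp : Pending e c' (n + 1) n x := ⟨Nat.lt_succ_self n, ⟨hn, ha⟩, fun j h h' => by omega⟩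
      rcases c' with w | r <;> simp only [ClientOK, ClientStep, Idle] at *
      · generalize wr (e.state n) w = σ at *
        generalize hσ : wr (e.state (n + 1)) w = σ' at *
        cases hst with
        -- Initially all of `I` is unacknowledged, so the claim about acknowledged servers is
        -- vacuous.
        | inv z I hI v => exact ⟨⟨n, hI, hp, by rw [hσ]⟩, fun i hi hi' => (hi' hi).elim⟩
        | invBusy _ _ _ _ h => exact (h hi).elim
      · generalize rd (e.state n) r = σ at *
        generalize rd (e.state (n + 1)) r = σ' at *
        cases hst with
        | inv I hI => exact ⟨n, hI, hp⟩
        | invBusy _ _ _ h => exact (h hi).elim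
    · exact same (hf _ (by simpa using Ne.symm hcc)) (by simp [ha, hcc]) (by simp [ha])
  | resp c' y hst hf =>
    by_cases hcc : c' = c
    · subst hcc
      have hi := hst.of_resp.2
      rcases c' with w | r <;> simp only [ClientOK, Idle] at *
      · simp only [WriterOK, hi]
      · simp only [ReaderOK, hi]
    · exact same (hf _ (by simpa using Ne.symm hcc)) (by simp [ha]) (by simp [ha, hcc])
  | sendS c' s a hst ht hf =>
    by_cases hcc : c' = c
    · subst hcc
      rcases c' with w | r <;> simp only [ClientOK, ClientStep] at *
      · have hc' := hc.succ hn (by simp [ha]) (by simp [ha])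
        generalize wr (e.state n) w = σ at *
        generalize wr (e.state (n + 1)) w = σ' at *
        cases hst <;> exact hc'
      · have hc' := hc.succ hn (by simp [ha]) (by simp [ha])
        generalize rd (e.state n) r = σ at *
        generalize rd (e.state (n + 1)) r = σ' at *
        cases hst <;> exact hc'
    · exact same (hf _ (by simpa using Ne.symm hcc) (by simp)) (by simp [ha]) (by simp [ha])
  | recvS c' s a _ _ hf => exact same (hf _ (by simp) (by simp)) (by simp [ha]) (by simp [ha])
  | sendC c' s a _ _ _ _ hf => exact same (hf _ (by simp) (by simp)) (by simp [ha]) (by simp [ha])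
  | recvC c' s a hst ht hf =>
    by_cases hcc : c' = c
    · subst hcc
      obtain ⟨q, hq, hans⟩ := hg.of_recvC hn ha
      have hans := hans.succ hn (by simp [ha])
      rcases c' with w | r <;> simp only [ClientOK, ClientStep, pend] at *
      · have hc' := hc.succ hn (by simp [ha]) (by simp [ha])
        generalize wr (e.state n) w = σ at *
        generalize wr (e.state (n + 1)) w = σ' at *
        cases hst
        obtain ⟨z, ph⟩ := σ
        rcases ph with _ | ⟨I, v, un, una⟩ | ⟨I, _ | _⟩ | t <;> simp only [writerPend] at hq
        · cases hq
        · split_ifs at hq with hs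
          cases hq
          cases a <;> simp only [AnsOK] at hans
          simp only [WriterOK] at hc'
          obtain ⟨⟨p, hI, hp, hz⟩, hk⟩ := hc'
          -- The acknowledgement of `s` certifies that the pair is stored there. Once nothing is
          -- unacknowledged, this gives the claim of phase update-coord for all of `I`.
          have hk' : ∀ i ∈ I, i ∉ una.erase s → HasKey (e.state (n + 1)) i (z, some w) := by
            intro i hi hu
            by_cases h : i = s
            · subst h
              exact hans
            · exact hk i hi fun h' => hu (Finset.mem_erase.2 ⟨h, h'⟩)
          simp only [writerRecv]
          split_ifs with he
          · exact ⟨⟨p, hI, v, hp, hz⟩, fun i hi => hk' i hi (by simp [he])⟩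
          · exact ⟨⟨p, hI, hp, hz⟩, hk'⟩
        · cases hq
        · split_ifs at hq with hs
          cases hq
          cases a <;> simp only [AnsOK] at hans
          simp only [WriterOK] at hc'
          obtain ⟨⟨p, hI, v, hp, hz⟩, hk⟩ := hc'
          simp only [writerRecv, hs, if_true]
          exact ⟨p, I, hI, v, hp⟩
        · cases hq
      · have hc' := hc.succ hn (by simp [ha]) (by simp [ha])
        generalize rd (e.state n) r = σ at *
        generalize rd (e.state (n + 1)) r = σ' at *
        cases hst
        rcases σ with _ | ⟨I, _ | _⟩ | ⟨I, t, κ, un, got⟩ <;> simp only [readerPend] at hq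
        · cases hq
        · cases hq
        · split_ifs at hq with hs
          cases hq
          cases a <;> simp only [AnsOK] at hans
          simp only [readerRecv, hs, if_true]
          -- No value has been received yet, so the last clause is vacuous.
          exact ⟨hc', hans.1, hans.2, by simp⟩
        · split_ifs at hq with hs
          cases hq
          cases a with
          | value i v =>
            simp only [AnsOK] at hans
            obtain ⟨rfl, hv⟩ := hans
            simp only [ReaderOK] at hc'
            simp only [readerRecv, if_true]
            refine ⟨hc'.1, hc'.2.1, hc'.2.2.1, fun j v' hj => ?_⟩
            by_cases h : j = i
            · subst h
              rw [Function.update_self] at hj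
              cases hj
              exact hv
            · rw [Function.update_of_ne h] at hj
              exact hc'.2.2.2 j v' hj
          | _ => simp only [AnsOK] at hans
    · exact same (hf _ (by simpa using Ne.symm hcc) (by simp)) (by simp [ha]) (by simp [ha])

theorem Good.shape_succ (hg : Good e n) (hwf : WellFormed e) (hn : (n : ℕ∞) < e.len)
    (c : Client ℓ m) : Shape (e.state (n + 1)) c := by
  have hc := hg.shape c
  have hs := sysStep hn
  generalize ha : e.act n = a at hs
  cases hs with
  | inv c' x hst hf =>
    by_cases hcc : c' = c
    · subst hcc
      exact (hst.of_inv (hg.idle_of_inv hwf ⟨hn, ha⟩)).2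
    · exact (shape_congr (hf _ (by simpa using Ne.symm hcc))).2 hc
  | resp c' y hst hf =>
    by_cases hcc : c' = c
    · subst hcc
      exact hst.of_resp.2.shape
    · exact (shape_congr (hf _ (by simpa using Ne.symm hcc))).2 hc
  | sendS c' s a hst ht hf =>
    by_cases hcc : c' = c
    · subst hcc
      exact (hst.of_send hc).2.2.2
    · exact (shape_congr (hf _ (by simpa using Ne.symm hcc) (by simp))).2 hc
  | recvS c' s a _ _ hf => exact (shape_congr (hf _ (by simp) (by simp))).2 hc
  | sendC c' s a _ _ _ _ hf => exact (shape_congr (hf _ (by simp) (by simp))).2 hc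
  | recvC c' s a hst ht hf =>
    by_cases hcc : c' = c
    · subst hcc
      obtain ⟨q, hq, hans⟩ := hg.of_recvC hn ha
      exact (hst.of_recv hc hq hans.fits).2.2
    · exact (shape_congr (hf _ (by simpa using Ne.symm hcc) (by simp))).2 hc

/-- A server that receives an outstanding request queues one correct answer. -/
theorem Good.answer (hg : Good e n) (hn : (n : ℕ∞) < e.len) {c : Client ℓ m} {s : Fin k}
    {a : Msg ℓ V} (ha : e.act n = .recv (.client c) (.server s) a) :
    ∃ b, (sv (e.state (n + 1)) s).outbox = (sv (e.state n) s).outbox ++ [(c, b)] ∧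
      AnsOK e (n + 1) c s a b := by
  have hs := sysStep hn
  have hq := (hg.of_recvS hn ha).1
  have hc := hg.client c
  rw [ha] at hs
  cases hs with
  | recvS c s a hst ht hf =>
    generalize hσ : sv (e.state (n + 1)) s = σ' at hst
    have key : ∀ i κ, HasKey (e.state n) i κ → HasKey (e.state (n + 1)) i κ :=
      fun i κ h => h.mono (sysStep hn)
    rcases c with w | r
    · simp only [pend] at hq
      generalize wr (e.state n) w = τ at *
      obtain ⟨z, ph⟩ := τ
      rcases ph with _ | ⟨I, v, un, una⟩ | ⟨I, _ | _⟩ | t <;> simp only [writerPend] at hq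
      · cases hq
      · split_ifs at hq with hs
        cases hq
        rcases hst with ⟨h, rfl⟩ | ⟨h, -⟩
        · refine ⟨_, rfl, v ⟨s, hs.1⟩, ?_⟩
          simp [hσ]
        · exact (h rfl).elim
      · cases hq
      · split_ifs at hq with hs
        cases hq
        cases hst
        exact ⟨_, rfl, trivial⟩
      · cases hq
    · simp only [pend, ClientOK] at hq hc
      generalize rd (e.state n) r = τ at *
      rcases τ with _ | ⟨I, _ | _⟩ | ⟨I, t, κ, un, got⟩ <;> simp only [readerPend] at hq
      · cases hq
      · cases hq
      · split_ifs at hq with hs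
        subst hs
        cases hq
        cases hst
        -- The receipt now taking place is the position that `TagAt` asks for.
        refine ⟨_, rfl, ⟨n, Nat.lt_succ_self n, ha, rfl, fun j hj hj' x => ?_⟩, fun i => ?_⟩
        · have : j = n := by omega
          subst this
          simp [ha]
        -- The initial entry marks every object, so each key in the answer is a listed one and its
        -- value is stored.
        · obtain ⟨b, hb, hbi⟩ := lastKey_mem i hg.init rfl
          exact key _ _ (hg.keys _ b i hb hbi)
      · split_ifs at hq with hs
        cases hq
        simp only [ReaderOK] at hc
        rcases hst with ⟨v, hv, rfl⟩ | ⟨h, -⟩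
        · refine ⟨_, rfl, rfl, ?_⟩
          rw [hσ]
          exact hv
        -- The server cannot lack the key: the keys held by the reader were stored before the
        -- coordinator gave them out.
        · obtain ⟨v, hv⟩ := hc.2.2.1 s
          exact (h v hv).elim

theorem ob_congr {S S' : (algorithmB ℓ m V v₀ coord).State} {s : Fin k}
    (h : S' (.proc (.server s)) = S (.proc (.server s))) (c : Client ℓ m) : ob S' c s = ob S c s := by
  simp only [ob, sv, h]

/-- The link runs through the cycle empty, request, answer queued, answer in transit, empty. An
action of the client or server on this link advances the cycle; other actions leave its contents
alone. -/
theorem Good.link_succ (hg : Good e n) (hwf : WellFormed e) (hn : (n : ℕ∞) < e.len)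
    (c : Client ℓ m) (s : Fin k) :
    LinkState (AnsOK e (n + 1) c s) (pend (e.state (n + 1)) c s) (ts (e.state (n + 1)) c s)
      (ob (e.state (n + 1)) c s) (tc (e.state (n + 1)) c s) := by
  have hl := hg.link c s
  have hc := hg.shape c
  have hs := sysStep hn
  -- Old contents of the link remain correct at the new time; what is left is to compare the
  -- contents before and after the step.
  have mono : (∀ x, e.act n ≠ .inv c x) → LinkState (AnsOK e (n + 1) c s) (pend (e.state n) c s)
      (ts (e.state n) c s) (ob (e.state n) c s) (tc (e.state n) c s) :=
    fun h => hl.mono fun _ _ _ => AnsOK.succ hn h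
  generalize ha : e.act n = a at hs mono
  cases hs with
  | inv c' x hst hf =>
    have e1 : ts (e.state (n + 1)) c s = ts (e.state n) c s := hf _ (by simp)
    have e2 : tc (e.state (n + 1)) c s = tc (e.state n) c s := hf _ (by simp)
    rw [e1, e2, ob_congr (hf _ (by simp))]
    by_cases hcc : c' = c
    · subst hcc
      have hi := hg.idle_of_inv hwf ⟨hn, ha⟩
      rw [pend_of_idle hi] at hl
      rw [(hst.of_inv hi).1]
      exact hl.mono (by simp)
    · rw [pend_congr (hf _ (by simpa using Ne.symm hcc))]
      exact mono (by simp [hcc])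
  | resp c' y hst hf =>
    have e1 : ts (e.state (n + 1)) c s = ts (e.state n) c s := hf _ (by simp)
    have e2 : tc (e.state (n + 1)) c s = tc (e.state n) c s := hf _ (by simp)
    rw [e1, e2, ob_congr (hf _ (by simp))]
    replace mono := mono (by simp)
    by_cases hcc : c' = c
    · subst hcc
      -- Nothing is outstanding either before or after a response.
      rw [pend_of_idle hst.of_resp.2, ← hst.of_resp.1 s]
      exact mono
    · rw [pend_congr (hf _ (by simpa using Ne.symm hcc))]
      exact mono
  | sendS c' s' a hst ht hf =>
    replace mono := mono (by simp)
    have e2 : tc (e.state (n + 1)) c s = tc (e.state n) c s := hf _ (by simp) (by simp)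
    rw [e2, ob_congr (hf _ (by simp) (by simp))]
    by_cases hcc : c' = c
    · subst hcc
      obtain ⟨h1, h2, h3, -⟩ := hst.of_send hc
      by_cases hss : s = s'
      · subst hss
        rw [h1] at mono
        rw [h2, ht]
        exact mono.send a
      · have e1 : ts (e.state (n + 1)) c' s = ts (e.state n) c' s :=
          hf _ (by simp) (by simpa using hss)
        rw [e1, h3 s hss]
        exact mono
    · have e1 : ts (e.state (n + 1)) c s = ts (e.state n) c s :=
        hf _ (by simp) (by simp [Ne.symm hcc])
      rw [e1, pend_congr (hf _ (by simpa using Ne.symm hcc) (by simp))]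
      exact mono
  | recvS c' s' a hst ht hf =>
    replace mono := mono (by simp)
    have e2 : tc (e.state (n + 1)) c s = tc (e.state n) c s := hf _ (by simp) (by simp)
    rw [e2, pend_congr (hf _ (by simp) (by simp))]
    by_cases hss : s = s'
    · subst hss
      by_cases hcc : c' = c
      · subst hcc
        obtain ⟨h1, h2, h3, h4⟩ := hg.of_recvS hn ha
        obtain ⟨b, hb, hans⟩ := hg.answer hn ha
        rw [h2, ← Multiset.cons_zero] at ht
        rw [h1, h4, ← (Multiset.cons_inj_right a).1 ht]
        have : ob (e.state (n + 1)) c' s = [b] := by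
          simp only [ob] at h3 ⊢
          rw [hb, outFor_append, h3, outFor_cons_self, outFor_nil]
          rfl
        rw [this]
        exact .answer _ _ hans
      · have e1 : ts (e.state (n + 1)) c s = ts (e.state n) c s :=
          hf _ (by simp) (by simp [Ne.symm hcc])
        have e3 : ob (e.state (n + 1)) c s = ob (e.state n) c s := by
          simp only [ob]
          rcases outbox_of_mem_serverRecv hst with h | ⟨b, h⟩
          · rw [h]
          · simp [h, outFor_append, outFor_cons_of_ne hcc, outFor_nil]
        rw [e1, e3]
        exact mono
    · have e1 : ts (e.state (n + 1)) c s = ts (e.state n) c s :=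
        hf _ (by simp) (by simp [hss])
      rw [e1, ob_congr (hf _ (by simpa using hss) (by simp))]
      exact mono
  | sendC c' s' a hso hv hli ht hf =>
    replace mono := mono (by simp)
    have e1 : ts (e.state (n + 1)) c s = ts (e.state n) c s := hf _ (by simp) (by simp)
    rw [e1, pend_congr (hf _ (by simp) (by simp))]
    by_cases hss : s = s'
    · subst hss
      by_cases hcc : c' = c
      · subst hcc
        have e3 : ob (e.state n) c' s = a :: ob (e.state (n + 1)) c' s := by
          simp [ob, hso, outFor_cons_self]
        rw [e3] at mono
        rw [ht]
        exact mono.sendAnswer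
      · have e2 : tc (e.state (n + 1)) c s = tc (e.state n) c s :=
          hf _ (by simp) (by simp [Ne.symm hcc])
        have e3 : ob (e.state (n + 1)) c s = ob (e.state n) c s := by
          simp [ob, hso, outFor_cons_of_ne hcc]
        rw [e2, e3]
        exact mono
    · have e2 : tc (e.state (n + 1)) c s = tc (e.state n) c s :=
        hf _ (by simp) (by simp [hss])
      rw [e2, ob_congr (hf _ (by simpa using hss) (by simp))]
      exact mono
  | recvC c' s' a hst ht hf =>
    replace mono := mono (by simp)
    have e1 : ts (e.state (n + 1)) c s = ts (e.state n) c s := hf _ (by simp) (by simp)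
    rw [e1, ob_congr (hf _ (by simp) (by simp))]
    by_cases hcc : c' = c
    · subst hcc
      obtain ⟨q, hq, hans⟩ := hg.of_recvC hn ha
      obtain ⟨h1, h2, -⟩ := hst.of_recv hc hq hans.fits
      by_cases hss : s = s'
      · subst hss
        rw [ht] at hl
        obtain ⟨q', -, -, h3, h4, h5⟩ := hl.eq_of_cons_answer
        rw [h1, h3, h4, h5]
        exact .empty
      · have e2 : tc (e.state (n + 1)) c' s = tc (e.state n) c' s :=
          hf _ (by simp) (by simp [hss])
        rw [e2, h2 s hss]
        exact mono
    · have e2 : tc (e.state (n + 1)) c s = tc (e.state n) c s :=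
        hf _ (by simp) (by simp [Ne.symm hcc])
      rw [e2, pend_congr (hf _ (by simpa using Ne.symm hcc) (by simp))]
      exact mono

/-- The outstanding write-value request carries the value of the present `WRITE`. -/
theorem Good.keyVal_of_pend (hg : Good e n) {c : Client ℓ m} {s i : Fin k} {κ : Key ℓ} {v : V i}
    (h : pend (e.state n) c s = some (.writeValue κ i v)) : i = s ∧ KeyVal e κ i v := by
  have hc := hg.client c
  rcases c with w | r <;> simp only [pend, ClientOK] at h hc
  · generalize wr (e.state n) w = τ at *
    obtain ⟨z, ph⟩ := τ
    rcases ph with _ | ⟨I, v, un, una⟩ | ⟨I, _ | _⟩ | t <;> simp only [writerPend] at h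
    · cases h
    · split_ifs at h with hs
      cases h
      simp only [WriterOK] at hc
      obtain ⟨⟨p, hI, hp, hz⟩, -⟩ := hc
      exact ⟨rfl, Or.inr ⟨w, p, I, hI, v, hs.1, rfl, hp.2.1, hz, rfl⟩⟩
    · cases h
    · split_ifs at h
      cases h
    · cases h
  · generalize rd (e.state n) r = τ at *
    rcases τ with _ | ⟨I, _ | _⟩ | ⟨I, t, κ, un, got⟩ <;> simp only [readerPend] at h
    · cases h
    · cases h
    · split_ifs at h
      cases h
    · split_ifs at h
      cases h

/-- The outstanding update-coord request carries the key of the present `WRITE`, whose values have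
been stored. -/
theorem Good.of_pend_update (hg : Good e n) {c : Client ℓ m} {s : Fin k} {κ : Key ℓ}
    {b : Fin k → Bool} (h : pend (e.state n) c s = some (.updateCoord κ b)) :
    ∃ w p I hI v, c = .writer w ∧ Pending e c n p (.write I hI v) ∧
      (wr (e.state (p + 1)) w).z = κ.1 ∧ κ.2 = some w ∧ (b = fun i => decide (i ∈ I)) ∧
      (∀ i ∈ I, HasKey (e.state n) i κ) := by
  have hc := hg.client c
  rcases c with w | r <;> simp only [pend, ClientOK] at h hc
  · generalize wr (e.state n) w = τ at *
    obtain ⟨z, ph⟩ := τ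
    rcases ph with _ | ⟨I, v, un, una⟩ | ⟨I, _ | _⟩ | t <;> simp only [writerPend] at h
    · cases h
    · split_ifs at h with hs
      cases h
    · cases h
    · split_ifs at h
      cases h
      simp only [WriterOK] at hc
      obtain ⟨⟨p, hI, v, hp, hz⟩, hk⟩ := hc
      exact ⟨w, p, I, hI, v, rfl, hp, hz, rfl, rfl, hk⟩
    · cases h
  · generalize rd (e.state n) r = τ at *
    rcases τ with _ | ⟨I, _ | _⟩ | ⟨I, t, κ, un, got⟩ <;> simp only [readerPend] at h
    · cases h
    · cases h
    · split_ifs at h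
      cases h
    · split_ifs at h
      cases h

/-- The list of the coordinator changes only by the receipt of update-coord requests. -/
theorem SysStep.list_eq {S S' : (algorithmB ℓ m V v₀ coord).State} {a : Act ℓ m V}
    (h : SysStep S S' a) (s : Fin k) :
    (sv S' s).list = (sv S s).list ∧ (∀ c κ b, a ≠ .recv (.client c) (.server s) (.updateCoord κ b))
      ∨ ∃ c κ b, a = .recv (.client c) (.server s) (.updateCoord κ b) ∧
        (sv S' s).list = (sv S s).list ++ [(κ, b)] := by
  cases h with
  | inv c x _ hf => exact Or.inl ⟨by rw [sv, sv, hf _ (by simp)], by simp⟩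
  | resp c x _ hf => exact Or.inl ⟨by rw [sv, sv, hf _ (by simp)], by simp⟩
  | sendS c s' a _ _ hf => exact Or.inl ⟨by rw [sv, sv, hf _ (by simp) (by simp)], by simp⟩
  | recvC c s' a _ _ hf => exact Or.inl ⟨by rw [sv, sv, hf _ (by simp) (by simp)], by simp⟩
  | sendC c s' a _ _ hl _ hf =>
    refine Or.inl ⟨?_, by simp⟩
    by_cases h : s = s'
    · subst h
      exact hl
    · rw [sv, sv, hf _ (by simpa using h) (by simp)]
  | recvS c s' a hs _ hf =>
    by_cases h : s = s'
    · subst h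
      generalize sv S' s = σ' at *
      cases a with
      | updateCoord κ b =>
        cases hs
        exact Or.inr ⟨c, κ, b, rfl, rfl⟩
      | writeValue κ i v => rcases hs with ⟨h, rfl⟩ | ⟨-, rfl⟩ <;> exact Or.inl ⟨rfl, by simp⟩
      | readValue κ => rcases hs with ⟨v, -, rfl⟩ | ⟨-, rfl⟩ <;> exact Or.inl ⟨rfl, by simp⟩
      | _ =>
        cases hs
        exact Or.inl ⟨rfl, by simp⟩
    · exact Or.inl ⟨by rw [sv, sv, hf _ (by simpa using h) (by simp)], by simp [Ne.symm h]⟩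

/-- The store of a server changes only by the receipt of write-value requests. -/
theorem SysStep.mem_vals {S S' : (algorithmB ℓ m V v₀ coord).State} {a : Act ℓ m V}
    (h : SysStep S S' a) {s : Fin k} {κ : Key ℓ} {v : V s} (hv : (κ, v) ∈ (sv S' s).vals) :
    (κ, v) ∈ (sv S s).vals ∨ ∃ c, a = .recv (.client c) (.server s) (.writeValue κ s v) := by
  cases h with
  | inv c x _ hf => exact Or.inl (by rwa [sv, hf _ (by simp)] at hv)
  | resp c x _ hf => exact Or.inl (by rwa [sv, hf _ (by simp)] at hv)
  | sendS c s' a _ _ hf => exact Or.inl (by rwa [sv, hf _ (by simp) (by simp)] at hv)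
  | recvC c s' a _ _ hf => exact Or.inl (by rwa [sv, hf _ (by simp) (by simp)] at hv)
  | sendC c s' a _ h' _ _ hf =>
    refine Or.inl ?_
    by_cases h : s = s'
    · subst h
      rwa [h'] at hv
    · rwa [sv, hf _ (by simpa using h) (by simp)] at hv
  | recvS c s' a hs _ hf =>
    by_cases h : s = s'
    · subst h
      generalize sv S' s = σ' at *
      cases a with
      | writeValue κ' i v' =>
        rcases hs with ⟨rfl, rfl⟩ | ⟨-, rfl⟩
        · rcases hv with hv | hv
          · cases hv
            exact Or.inr ⟨c, rfl⟩
          · exact Or.inl hv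
        · exact Or.inl hv
      | readValue κ => rcases hs with ⟨v, -, rfl⟩ | ⟨-, rfl⟩ <;> exact Or.inl hv
      | _ =>
        cases hs
        exact Or.inl hv
    · exact Or.inl (by rwa [sv, hf _ (by simpa using h) (by simp)] at hv)

theorem Good.succ (hg : Good e n) (hwf : WellFormed e) (hn : (n : ℕ∞) < e.len) :
    Good e (n + 1) where
  shape := hg.shape_succ hwf hn
  client := hg.clientOK_succ hwf hn
  link := hg.link_succ hwf hn
  vals s κ v hv := by
    rcases (sysStep hn).mem_vals hv with h | ⟨c, h⟩
    · exact hg.vals s κ v h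
    · exact (hg.keyVal_of_pend (hg.of_recvS hn h).1).2
  keys κ b i h hb := by
    refine HasKey.mono (sysStep hn) ?_
    rcases (sysStep hn).list_eq coord with ⟨hl, -⟩ | ⟨c, κ', b', ha, hl⟩ <;> rw [hl] at h
    · exact hg.keys κ b i h hb
    · rcases List.mem_append.1 h with h | h
      · exact hg.keys κ b i h hb
      · rw [List.mem_singleton] at h
        cases h
        obtain ⟨w, p, I, hI, v, -, -, -, -, rfl, hk⟩ := hg.of_pend_update (hg.of_recvS hn ha).1
        exact hk i (by simpa using hb)
  init := by
    rcases (sysStep hn).list_eq coord with ⟨hl, -⟩ | ⟨c, κ', b', -, hl⟩ <;> rw [hl]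
    · exact hg.init
    · exact List.mem_append_left _ hg.init

theorem good (he : e.IsExecution) (hwf : WellFormed e) (hn : (n : ℕ∞) ≤ e.len) : Good e n := by
  induction n with
  | zero => exact good_zero he
  | succ n ih =>
    have hlt : (n : ℕ∞) < e.len := lt_of_lt_of_le (by exact_mod_cast Nat.lt_succ_self n) hn
    exact (ih hlt.le).succ hwf hlt

end Invariant

/-! ### Responses, serialization points, and the value belonging to a key. -/

section Points

variable {ℓ m k : ℕ} {V : Fin k → Type u} {v₀ : ∀ i, V i} {coord : Fin k}
  {e : (algorithmB ℓ m V v₀ coord).Fragment} {n : ℕ}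

/-! ## Responses -/

theorem ClientStep.not_idle_of_resp {S S' : (algorithmB ℓ m V v₀ coord).State} {c : Client ℓ m}
    {y : Resp V} (h : ClientStep S c (.resp c y) S') : ¬ Idle S c := by
  rcases c with w | r <;> simp only [Idle, ClientStep] at *
  · generalize wr S w = σ at *
    generalize wr S' w = σ' at *
    cases h
    simp
  · generalize rd S r = σ at *
    generalize rd S' r = σ' at *
    cases h
    simp

theorem clientStep_of_resp (hn : (n : ℕ∞) < e.len) {c : Client ℓ m} {y : Resp V}
    (h : e.act n = .resp c y) : ClientStep (e.state n) c (.resp c y) (e.state (n + 1)) := by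
  have hs := sysStep hn
  rw [h] at hs
  cases hs
  assumption

theorem clientStep_of_inv (hn : (n : ℕ∞) < e.len) {c : Client ℓ m} {x : Inv V}
    (h : e.act n = .inv c x) : ClientStep (e.state n) c (.inv c x) (e.state (n + 1)) := by
  have hs := sysStep hn
  rw [h] at hs
  cases hs
  assumption

/-- A responding client is busy, and a busy client has a transaction in progress with no response
since its invocation. -/
theorem responsesMatched (he : e.IsExecution) (hwf : WellFormed e) : ResponsesMatched e := by
  intro c y n' h
  obtain ⟨p, x, hp⟩ := (good he hwf h.1.le).exists_pending (clientStep_of_resp h.1 h.2).not_idle_of_resp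
  exact ⟨x, p, hp.2.1, hp.1, h, fun j y' hj hj' hr => (hp.2.2 j hj hj').2 y' hr.2⟩

theorem Pending.unique {c : Client ℓ m} {p p' : ℕ} {x x' : Inv V} (h : Pending e c n p x)
    (h' : Pending e c n p' x') : p = p' ∧ x = x' := by
  have hp : p = p' := by
    rcases lt_trichotomy p p' with hlt | heq | hlt
    · exact ((h.2.2 p' hlt h'.1).1 x' h'.2.1.2).elim
    · exact heq
    · exact ((h'.2.2 p hlt h.1).1 x h.2.1.2).elim
  subst hp
  have := h.2.1.2.symm.trans h'.2.1.2
  cases this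
  exact ⟨rfl, rfl⟩

theorem Pending.of_le {c : Client ℓ m} {p n' : ℕ} {x : Inv V} (h : Pending e c n p x) (h1 : p < n')
    (h2 : n' ≤ n) : Pending e c n' p x :=
  ⟨h1, h.2.1, fun j hj hj' => h.2.2 j hj (hj'.trans_le h2)⟩

/-- `Completes` only excludes earlier responses; an invocation in between would, by well-formedness,
be preceded by such a response. -/
theorem pending_of_completes (hwf : WellFormed e) {c : Client ℓ m} {x : Inv V} {y : Resp V} {n' : ℕ}
    (h : InvAt e c x n) (hc : Completes e c n y n') : Pending e c n' n x := by
  have hlt : ∀ j, j < n' → (j : ℕ∞) < e.len := fun j hj => lt_trans (by exact_mod_cast hj) hc.2.1.1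
  refine ⟨hc.1, h, fun j hj hj' => ⟨fun x' hx => ?_, fun y' hy => hc.2.2 j y' hj hj' ⟨hlt j hj', hy⟩⟩⟩
  obtain ⟨y', i, hi, hi', hr⟩ := hwf c x x' n j h ⟨hlt j hj', hx⟩ hj
  exact hc.2.2 i y' hi (hi'.trans hj') hr

/-! ## Serialization points -/

/-- The requests whose receipt by the coordinator is the serialization point of a transaction. -/
def Msg.IsPoint : Msg ℓ V → Prop
  | .updateCoord _ _ => True
  | .getTagArray _ => True
  | _ => False

/-- Action `n` is the serialization point of a transaction of `c`. -/
def PointOf (e : (algorithmB ℓ m V v₀ coord).Fragment) (c : Client ℓ m) (n : ℕ) : Prop :=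
  ∃ a, e.act n = .recv (.client c) (.server coord) a ∧ a.IsPoint

/-- The last transaction of client `c` has passed its serialization point. -/
def Past (S : (algorithmB ℓ m V v₀ coord).State) : Client ℓ m → Prop
  | .writer w => match (wr S w).phase with
    | .idle => True
    | .writing _ _ _ _ => False
    -- The request has been sent and is no longer in transit, so the coordinator has received it.
    | .updating _ b => b = true ∧ ts S (.writer w) coord = 0
    | .finished _ => True
  | .reader r => match rd S r with
    | .idle => True
    | .getTag _ b => b = true ∧ ts S (.reader r) coord = 0
    | .reading _ _ _ _ _ => True

theorem past_congr {S S' : (algorithmB ℓ m V v₀ coord).State} {c : Client ℓ m}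
    (h : S' (.proc (.client c)) = S (.proc (.client c))) (ht : ts S' c coord = ts S c coord) :
    Past S' c ↔ Past S c := by
  rcases c with w | r
  · simp only [Past, wr, h, ht]
  · simp only [Past, rd, h, ht]

theorem Idle.past {S : (algorithmB ℓ m V v₀ coord).State} {c : Client ℓ m} (h : Idle S c) :
    Past S c := by
  rcases c with w | r <;> simp only [Idle] at h <;> simp [Past, h]

theorem ClientStep.past_of_resp {S S' : (algorithmB ℓ m V v₀ coord).State} {c : Client ℓ m}
    {y : Resp V} (h : ClientStep S c (.resp c y) S') : Past S c := by
  rcases c with w | r <;> simp only [Past, ClientStep] at *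
  · generalize wr S w = σ at *
    generalize wr S' w = σ' at *
    cases h
    trivial
  · generalize rd S r = σ at *
    generalize rd S' r = σ' at *
    cases h
    trivial

theorem ClientStep.not_past_of_inv {S S' : (algorithmB ℓ m V v₀ coord).State} {c : Client ℓ m}
    {x : Inv V} (h : ClientStep S c (.inv c x) S') (hi : Idle S c) : ¬ Past S' c := by
  rcases c with w | r <;> simp only [Past, Idle, ClientStep] at *
  · generalize wr S w = σ at *
    generalize wr S' w = σ' at *
    cases h with
    | inv => simp
    | invBusy _ _ _ _ h => exact (h hi).elim
  · generalize rd S r = σ at *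
    generalize rd S' r = σ' at *
    cases h with
    | inv => simp
    | invBusy _ _ _ h => exact (h hi).elim

/-- `Past` is a switch that only an invocation turns off and only a serialization point turns on.
Both existence and uniqueness of the point follow by watching it along the execution. -/
theorem Good.past_succ_iff (hg : Good e n) (hn : (n : ℕ∞) < e.len) {c : Client ℓ m}
    (hi : ∀ x, e.act n ≠ .inv c x) (hp : ¬ PointOf e c n) :
    Past (e.state (n + 1)) c ↔ Past (e.state n) c := by
  have hs := sysStep hn
  generalize ha : e.act n = a at hs
  cases hs with
  | inv c' x hst hf =>
    by_cases hcc : c' = c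
    · subst hcc
      exact (hi x ha).elim
    · exact past_congr (hf _ (by simpa using Ne.symm hcc)) (hf _ (by simp))
  | resp c' y hst hf =>
    by_cases hcc : c' = c
    · subst hcc
      exact iff_of_true hst.of_resp.2.past hst.past_of_resp
    · exact past_congr (hf _ (by simpa using Ne.symm hcc)) (hf _ (by simp))
  | sendS c' s a hst ht hf =>
    by_cases hcc : c' = c
    · subst hcc
      rcases c' with w | r <;> simp only [Past, ClientStep] at *
      · generalize wr (e.state n) w = σ at *
        generalize wr (e.state (n + 1)) w = σ' at *
        cases hst <;> simp [ht]
      · generalize rd (e.state n) r = σ at *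
        generalize rd (e.state (n + 1)) r = σ' at *
        cases hst <;> simp [ht]
    · exact past_congr (hf _ (by simpa using Ne.symm hcc) (by simp))
        (hf _ (by simp) (by simp [Ne.symm hcc]))
  | recvS c' s a hst ht hf =>
    by_cases hcs : c' = c ∧ s = coord
    · obtain ⟨rfl, rfl⟩ := hcs
      have hq := (hg.of_recvS hn ha).1
      -- Receipts at the coordinator that are not points are write-value and read-value requests,
      -- sent in phases where `Past` does not depend on the channel.
      have hna : ¬ a.IsPoint := fun h => hp ⟨a, ha, h⟩
      have hsame := hf (.proc (.client c')) (by simp) (by simp)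
      rcases c' with w | r <;> simp only [pend, Past, wr, rd, hsame] at hq ⊢
      · generalize (e.state n (.proc (.client (.writer w))) : WriterState V) = σ at *
        obtain ⟨z, ph⟩ := σ
        rcases ph with _ | ⟨I, v, un, una⟩ | ⟨I, _ | _⟩ | t <;> simp only [writerPend] at hq ⊢
        · simp
        · simp only [if_true] at hq
          cases hq
          exact (hna trivial).elim
      · generalize (e.state n (.proc (.client (.reader r))) : ReaderState ℓ V) = σ at *
        rcases σ with _ | ⟨I, _ | _⟩ | ⟨I, t, κ, un, got⟩ <;> simp only [readerPend] at hq ⊢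
        · simp
        · simp only [if_true] at hq
          cases hq
          exact (hna trivial).elim
    · refine past_congr (hf _ (by simp) (by simp)) (hf _ (by simp) ?_)
      intro h
      cases h
      exact hcs ⟨rfl, rfl⟩
  | sendC c' s a _ _ _ _ hf =>
    exact past_congr (hf _ (by simp) (by simp)) (hf _ (by simp) (by simp))
  | recvC c' s a hst htc hf =>
    have ht : ts (e.state (n + 1)) c coord = ts (e.state n) c coord := hf _ (by simp) (by simp)
    by_cases hcc : c' = c
    · subst hcc
      obtain ⟨q, hq, hans⟩ := hg.of_recvC hn ha
      have hl := hg.link c' s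
      rw [htc] at hl
      -- An answer on its way back excludes a request on its way out, so on receipt of the
      -- coordinator's answer `Past` already held.
      obtain ⟨q', -, -, h0, -⟩ := hl.eq_of_cons_answer
      rcases c' with w | r <;> simp only [Past, ClientStep, ht, pend] at *
      · generalize wr (e.state n) w = σ at *
        generalize wr (e.state (n + 1)) w = σ' at *
        cases hst
        obtain ⟨z, ph⟩ := σ
        rcases ph with _ | ⟨I, v, un, una⟩ | ⟨I, _ | _⟩ | t <;> simp only [writerPend] at hq
        · cases hq
        · cases a <;> simp only [writerRecv]
          split_ifs <;> simp
        · cases hq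
        · split_ifs at hq with hs
          subst hs
          cases a <;> simp only [writerRecv]
          simp [h0]
        · cases hq
      · generalize rd (e.state n) r = σ at *
        generalize rd (e.state (n + 1)) r = σ' at *
        cases hst
        rcases σ with _ | ⟨I, _ | _⟩ | ⟨I, t, κ, un, got⟩ <;> simp only [readerPend] at hq
        · cases hq
        · cases hq
        · split_ifs at hq with hs
          subst hs
          cases a <;> simp only [readerRecv]
          simp [h0]
        · cases a <;> simp only [readerRecv]
          split_ifs <;> simp
    · exact past_congr (hf _ (by simpa using Ne.symm hcc) (by simp)) ht

/-- The request was the only message in transit to the coordinator from this client; its removal is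
what makes `Past` true. -/
theorem Good.past_of_point (hg : Good e n) (hn : (n : ℕ∞) < e.len) {c : Client ℓ m}
    (hp : PointOf e c n) : ¬ Past (e.state n) c ∧ Past (e.state (n + 1)) c := by
  obtain ⟨a, ha, hpt⟩ := hp
  obtain ⟨hq, ht, -⟩ := hg.of_recvS hn ha
  have hs := sysStep hn
  rw [ha] at hs
  cases hs with
  | recvS c s a hst ht' hf =>
    have hsame := hf (.proc (.client c)) (by simp) (by simp)
    have h0 : ts (e.state (n + 1)) c coord = 0 := by
      rw [ht, ← Multiset.cons_zero] at ht'
      exact ((Multiset.cons_inj_right a).1 ht').symm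
    rcases c with w | r <;> simp only [pend, Past, wr, rd, hsame, h0, ht] at hq ⊢
    · generalize (e.state n (.proc (.client (.writer w))) : WriterState V) = σ at *
      obtain ⟨z, ph⟩ := σ
      rcases ph with _ | ⟨I, v, un, una⟩ | ⟨I, _ | _⟩ | t <;> simp only [writerPend] at hq ⊢
      · cases hq
      · split_ifs at hq
        cases hq
        exact hpt.elim
      · cases hq
      · simp
      · cases hq
    · generalize (e.state n (.proc (.client (.reader r))) : ReaderState ℓ V) = σ at *
      rcases σ with _ | ⟨I, _ | _⟩ | ⟨I, t, κ, un, got⟩ <;> simp only [readerPend] at hq ⊢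
      · cases hq
      · cases hq
      · simp
      · split_ifs at hq
        cases hq
        exact hpt.elim

theorem Good.exists_pending_of_point (hg : Good e n) (hn : (n : ℕ∞) < e.len) {c : Client ℓ m}
    (hp : PointOf e c n) : ∃ p x, Pending e c n p x :=
  hg.exists_pending fun h => (hg.past_of_point hn hp).1 h.past

/-- A transaction has at most one serialization point. -/
theorem point_unique (he : e.IsExecution) (hwf : WellFormed e) {c : Client ℓ m} {p q q' : ℕ}
    {x x' : Inv V} (hq : (q : ℕ∞) < e.len) (hq' : (q' : ℕ∞) < e.len) (h : PointOf e c q)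
    (h' : PointOf e c q') (hp : Pending e c q p x) (hp' : Pending e c q' p x') : q = q' := by
  -- After the first point `Past` holds and, with no invocation in between, persists; but a second
  -- point would need it to be false.
  have key : ∀ q q' : ℕ, ∀ x', (q' : ℕ∞) < e.len → PointOf e c q → PointOf e c q' → p < q →
      Pending e c q' p x' → ¬ q < q' := by
    intro q q' x' hq' h h' hpq hp' hlt
    have hlen : ∀ j, j ≤ q' → (j : ℕ∞) < e.len := fun j hj =>
      lt_of_le_of_lt (by exact_mod_cast hj) hq'
    have : ∀ j, q < j → j ≤ q' → Past (e.state j) c := by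
      intro j hj
      induction j, hj using Nat.le_induction with
      | base => exact fun _ => ((good he hwf (hlen q hlt.le).le).past_of_point (hlen q hlt.le) h).2
      | succ j hj ih =>
        intro hj'
        have hjl := hlen j (by omega)
        have hg := good he hwf hjl.le
        by_cases hpt : PointOf e c j
        · exact (hg.past_of_point hjl hpt).2
        · exact (hg.past_succ_iff hjl (hp'.2.2 j (by omega) (by omega)).1 hpt).2 (ih (by omega))
    exact ((good he hwf hq'.le).past_of_point hq' h').1 (this q' hlt le_rfl)
  exact le_antisymm (not_lt.1 (key q' q x hq h' h hp'.1 hp)) (not_lt.1 (key q q' x' hq' h h' hp.1 hp'))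

/-- A transaction that has passed its serialization point has one. -/
theorem exists_point (he : e.IsExecution) (hwf : WellFormed e) {c : Client ℓ m} {p : ℕ}
    {x : Inv V} (hn : (n : ℕ∞) ≤ e.len) (hp : Pending e c n p x) (hpast : Past (e.state n) c) :
    ∃ q, p < q ∧ q < n ∧ PointOf e c q := by
  by_contra! hcon
  have hlen : ∀ j, j < n → (j : ℕ∞) < e.len := fun j hj =>
    lt_of_lt_of_le (by exact_mod_cast hj) hn
  -- The invocation turns `Past` off, and without a point it would stay off.
  have : ∀ j, p < j → j ≤ n → ¬ Past (e.state j) c := by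
    intro j hj
    induction j, hj using Nat.le_induction with
    | base =>
      intro _
      have hg := good he hwf (hlen p hp.1).le
      exact (clientStep_of_inv hp.2.1.1 hp.2.1.2).not_past_of_inv (hg.idle_of_inv hwf hp.2.1)
    | succ j hj ih =>
      intro hj'
      have hjl := hlen j (by omega)
      have hg := good he hwf hjl.le
      rw [hg.past_succ_iff hjl (hp.2.2 j (by omega) (by omega)).1 (hcon j (by omega) (by omega))]
      exact ih (by omega)
  exact this n hp.1 le_rfl hpast

/-! ## Values of keys -/

theorem SysStep.z_le {S S' : (algorithmB ℓ m V v₀ coord).State} {a : Act ℓ m V}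
    (h : SysStep S S' a) (w : Fin ℓ) : (wr S w).z ≤ (wr S' w).z := by
  have key : ∀ a, WriterStep (m := m) coord w (wr S w) a (wr S' w) → (wr S w).z ≤ (wr S' w).z := by
    intro a h
    generalize wr S w = σ at *
    generalize wr S' w = σ' at *
    cases h with
    | inv => exact Nat.le_succ _
    | recv =>
      simp only [writerRecv]
      split
      · split_ifs <;> exact le_rfl
      · split_ifs <;> exact le_rfl
      · exact le_rfl
    | _ => exact le_rfl
  cases h with
  | inv c x hs hf =>
    by_cases h : c = .writer w
    · subst h
      exact key _ hs
    · exact (congrArg WriterState.z (hf (.proc (.client (.writer w))) (by simpa using Ne.symm h))).ge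
  | resp c x hs hf =>
    by_cases h : c = .writer w
    · subst h
      exact key _ hs
    · exact (congrArg WriterState.z (hf (.proc (.client (.writer w))) (by simpa using Ne.symm h))).ge
  | sendS c s a hs _ hf =>
    by_cases h : c = .writer w
    · subst h
      exact key _ hs
    · exact (congrArg WriterState.z
        (hf (.proc (.client (.writer w))) (by simpa using Ne.symm h) (by simp))).ge
  | recvC c s a hs _ hf =>
    by_cases h : c = .writer w
    · subst h
      exact key _ hs
    · exact (congrArg WriterState.z
        (hf (.proc (.client (.writer w))) (by simpa using Ne.symm h) (by simp))).ge
  | recvS c s a _ _ hf =>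
    exact (congrArg WriterState.z (hf (.proc (.client (.writer w))) (by simp) (by simp))).ge
  | sendC c s a _ _ _ _ hf =>
    exact (congrArg WriterState.z (hf (.proc (.client (.writer w))) (by simp) (by simp))).ge

/-- Counters never decrease, and an invocation at an idle writer raises the counter; thus different
WRITEs of a writer have different numbers. -/
theorem z_lt_of_inv (he : e.IsExecution) (hwf : WellFormed e) {w : Fin ℓ} {x : Inv V}
    {p p' : ℕ} (h : InvAt e (.writer w) x p') (hlt : p < p') :
    (wr (e.state (p + 1)) w).z < (wr (e.state (p' + 1)) w).z := by
  have hle : ∀ j, p + 1 ≤ j → j ≤ p' → (wr (e.state (p + 1)) w).z ≤ (wr (e.state j) w).z := by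
    intro j hj
    induction j, hj using Nat.le_induction with
    | base => exact fun _ => le_rfl
    | succ j hj ih =>
      intro hj'
      have hjl : (j : ℕ∞) < e.len := lt_of_le_of_lt (by exact_mod_cast (by omega)) h.1
      exact (ih (by omega)).trans ((sysStep hjl).z_le w)
  refine (hle p' hlt le_rfl).trans_lt ?_
  have hi := (good he hwf h.1.le).idle_of_inv hwf h
  have hs := clientStep_of_inv h.1 h.2
  simp only [Idle, ClientStep] at hs hi
  generalize wr (e.state p') w = σ at *
  generalize wr (e.state (p' + 1)) w = σ' at *
  cases hs with
  | inv => exact Nat.lt_succ_self _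
  | invBusy _ _ _ _ hb => exact (hb hi).elim

/-- The placeholder separates the initial key from all others; otherwise writer and number fix the
invocation, and the invocation fixes the value. -/
theorem KeyVal.unique (he : e.IsExecution) (hwf : WellFormed e) {κ : Key ℓ} {s : Fin k}
    {v v' : V s} (h : KeyVal e κ s v) (h' : KeyVal e κ s v') : v = v' := by
  rcases h with ⟨hκ, rfl⟩ | ⟨w, p, I, hI, f, hs, hκ, hp, hz, rfl⟩ <;>
    rcases h' with ⟨hκ', rfl⟩ | ⟨w', p', I', hI', f', hs', hκ', hp', hz', rfl⟩
  · rfl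
  · rw [hκ] at hκ'
    cases hκ'
  · rw [hκ] at hκ'
    cases hκ'
  · rw [hκ] at hκ'
    cases hκ'
    have hpp : p = p' := by
      rcases lt_trichotomy p p' with hlt | heq | hlt
      · have := z_lt_of_inv he hwf hp' hlt
        omega
      · exact heq
      · have := z_lt_of_inv he hwf hp hlt
        omega
    subst hpp
    have := hp.2.symm.trans hp'.2
    cases this
    rfl

end Points

/-! ### The serial order given by the coordinator. -/

section Serial

variable {ℓ m k : ℕ} {V : Fin k → Type u} {v₀ : ∀ i, V i} {coord : Fin k}
  {e : (algorithmB ℓ m V v₀ coord).Fragment} {n : ℕ}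

/-! ## Strict serializability -/

theorem PointOf.client_unique {c c' : Client ℓ m} (h : PointOf e c n) (h' : PointOf e c' n) :
    c = c' := by
  obtain ⟨a, ha, -⟩ := h
  obtain ⟨a', ha', -⟩ := h'
  have := ha.symm.trans ha'
  cases this
  rfl

/-- Action `n` is the serialization point of a transaction. -/
def Point (e : (algorithmB ℓ m V v₀ coord).Fragment) (n : ℕ) : Prop :=
  (n : ℕ∞) < e.len ∧ ∃ c, PointOf e c n

/-- The function `T` gives the transaction that is serialized at each serialization point. -/
def Labels (e : (algorithmB ℓ m V v₀ coord).Fragment) (T : ℕ → ℕ × Inv V) : Prop :=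
  ∀ n, Point e n → ∃ c, PointOf e c n ∧ Pending e c n (T n).1 (T n).2

theorem exists_labels (he : e.IsExecution) (hwf : WellFormed e) : ∃ T, Labels e T := by
  have : ∀ n, ∃ t : ℕ × Inv V, Point e n → ∃ c, PointOf e c n ∧ Pending e c n t.1 t.2 := by
    intro n
    by_cases h : Point e n
    · obtain ⟨c, hc⟩ := h.2
      obtain ⟨p, x, hp⟩ := (good he hwf h.1.le).exists_pending_of_point h.1 hc
      exact ⟨(p, x), fun _ => ⟨c, hc, hp⟩⟩
    -- A dummy label for positions that are not serialization points.
    · exact ⟨(0, .read {coord} ⟨coord, Finset.mem_singleton_self coord⟩), fun h' => (h h').elim⟩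
  choose T hT using this
  exact ⟨T, hT⟩

theorem Labels.eq {T : ℕ → ℕ × Inv V} (hT : Labels e T) (hn : (n : ℕ∞) < e.len) {c : Client ℓ m}
    {p : ℕ} {x : Inv V} (hpt : PointOf e c n) (hp : Pending e c n p x) : T n = (p, x) := by
  obtain ⟨c', hc', hp'⟩ := hT n ⟨hn, c, hpt⟩
  cases hc'.client_unique hpt
  obtain ⟨h1, h2⟩ := hp'.unique hp
  exact Prod.ext h1 h2

/-- The values of the objects before the `j`-th serialization point. -/
noncomputable def serialVal (e : (algorithmB ℓ m V v₀ coord).Fragment) (T : ℕ → ℕ × Inv V) :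
    ℕ → ∀ i, V i
  | 0 => v₀
  | j + 1 => (apply (T (Nat.nth (Point e) j)).2 (serialVal e T j)).2

open Classical in
/-- The keys of the coordinator belong to the present values. -/
theorem keyVal_lastKey (he : e.IsExecution) (hwf : WellFormed e) {T : ℕ → ℕ × Inv V}
    (hT : Labels e T) (hn : (n : ℕ∞) ≤ e.len) (i : Fin k) :
    KeyVal e (lastKey (sv (e.state n) coord).list i) i
      (serialVal e T (Nat.count (Point e) n) i) := by
  induction n with
  | zero =>
    have : sv (e.state 0) coord = ⟨{(initKey ℓ, v₀ coord)}, [(initKey ℓ, fun _ => true)], []⟩ :=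
      he (.proc (.server coord))
    rw [this]
    exact Or.inl ⟨rfl, rfl⟩
  | succ n ih =>
    have hlt : (n : ℕ∞) < e.len := lt_of_lt_of_le (by exact_mod_cast Nat.lt_succ_self n) hn
    have ih := ih hlt.le
    have hg := good he hwf hlt.le
    rw [Nat.count_succ]
    by_cases hp : Point e n
    · rw [if_pos hp]
      simp only [serialVal, Nat.nth_count hp]
      obtain ⟨c, a, ha, hpt⟩ := hp.2
      obtain ⟨hq, -⟩ := hg.of_recvS hlt ha
      rcases (sysStep hlt).list_eq coord with ⟨hl, hne⟩ | ⟨c', κ, b, ha', hl⟩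
      · rw [hl]
        obtain ⟨p, x, hpx⟩ := hg.exists_pending_of_point hlt ⟨a, ha, hpt⟩
        rw [hT.eq hlt ⟨a, ha, hpt⟩ hpx]
        -- A point that leaves the list unchanged is not an update-coord, so it belongs to a READ,
        -- which leaves the values unchanged as well.
        have hread : ∃ I hI, x = .read I hI := by
          have hc := hg.client c
          rcases c with w | r <;> simp only [pend, ClientOK] at hq hc
          · generalize wr (e.state n) w = τ at *
            obtain ⟨z, ph⟩ := τ
            rcases ph with _ | ⟨I, v, un, una⟩ | ⟨I, _ | _⟩ | t <;> simp only [writerPend] at hq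
            · cases hq
            · split_ifs at hq
              cases hq
              exact hpt.elim
            · cases hq
            · simp only [if_true] at hq
              cases hq
              exact (hne _ _ _ ha).elim
            · cases hq
          · generalize rd (e.state n) r = τ at *
            rcases τ with _ | ⟨I, _ | _⟩ | ⟨I, t, κ, un, got⟩ <;> simp only [readerPend] at hq
            · cases hq
            · cases hq
            · obtain ⟨p', hI, hp'⟩ := hc
              exact ⟨I, hI, (hpx.unique hp').2⟩
            · split_ifs at hq
              cases hq
              exact hpt.elim
        obtain ⟨I, hI, rfl⟩ := hread
        exact ih
      · have := ha.symm.trans ha'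
        cases this
        obtain ⟨w, p, I, hI, f, rfl, hpx, hz, hκ, rfl, -⟩ := hg.of_pend_update hq
        -- The new entry changes the last key exactly for the objects whose values the WRITE
        -- changes.
        rw [hT.eq hlt ⟨_, ha, hpt⟩ hpx, hl, lastKey_append]
        by_cases hi : i ∈ I
        · simp only [hi, decide_true, if_true, apply, dif_pos]
          exact Or.inr ⟨w, p, I, hI, f, hi, hκ, hpx.2.1, hz, rfl⟩
        · simpa [hi, apply] using ih
    · rw [if_neg hp, add_zero]
      rcases (sysStep hlt).list_eq coord with ⟨hl, -⟩ | ⟨c, κ, b, ha, -⟩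
      · rwa [hl]
      -- An entry is appended only at a serialization point.
      · exact (hp ⟨hlt, c, _, ha, trivial⟩).elim

/-- The response of a complete transaction is the one that its place in the serial order gives. -/
theorem response_eq (he : e.IsExecution) (hwf : WellFormed e) {T : ℕ → ℕ × Inv V}
    {c : Client ℓ m} {x : Inv V} {y : Resp V} {p q : ℕ}
    (hr : RespAt e c y n) (hp : Pending e c n p x) (hpq : p < q) (hqn : q < n)
    (hpt : PointOf e c q) {j : ℕ} (hj : ∀ i, KeyVal e (lastKey (sv (e.state q) coord).list i) i
      (serialVal e T j i)) : (apply x (serialVal e T j)).1 = y := by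
  have hg := good he hwf hr.1.le
  have hs := clientStep_of_resp hr.1 hr.2
  have hc := hg.client c
  have hql : (q : ℕ∞) < e.len := lt_trans (by exact_mod_cast hqn) hr.1
  rcases c with w | r <;> simp only [ClientOK, ClientStep] at hs hc
  · generalize wr (e.state n) w = σ at *
    generalize wr (e.state (n + 1)) w = σ' at *
    cases hs
    obtain ⟨p', I, hI, v, hp'⟩ := hc
    obtain ⟨-, rfl⟩ := hp.unique hp'
    rfl
  · generalize rd (e.state n) r = σ at *
    generalize rd (e.state (n + 1)) r = σ' at *
    cases hs with
    | resp I t κ got v hv =>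
      obtain ⟨⟨p', hI, hp'⟩, ⟨q', hq'⟩, -, hgot⟩ := hc
      obtain ⟨rfl, rfl⟩ := hp.unique hp'
      -- No invocation follows `q'` before the response, so `q'` lies after the invocation of this
      -- very READ.
      have hpq' : p < q' := by
        by_contra h
        exact hq'.2.2.2 p (not_lt.1 h) hp.1 _ hp.2.1.2
      have hql' : (q' : ℕ∞) < e.len := lt_trans (by exact_mod_cast hq'.1) hr.1
      -- The receipt at which the reader's keys were fixed is itself a point of the READ, hence the
      -- given one.
      have : q = q' := point_unique he hwf hql hql' hpt ⟨_, hq'.2.1, trivial⟩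
        (hp.of_le hpq hqn.le) (hp.of_le hpq' hq'.1.le)
      subst this
      simp only [apply]
      congr 1
      funext i
      -- The serial value and the value received belong to the same key.
      refine (hj i).unique he hwf ?_
      rw [← hq'.2.2.1]
      exact hg.vals _ _ _ (hgot i _ (hv i))

/-- The right-hand side is the form in which results on `Nat.nth` express that there is a `j`-th
element, for finite and infinite sets alike. -/
theorem natCast_lt_encard_iff {s : Set ℕ} {j : ℕ} :
    (j : ℕ∞) < s.encard ↔ ∀ hf : s.Finite, j < hf.toFinset.card := by
  constructor
  · intro h hf
    rw [hf.encard_eq_coe_toFinset_card] at h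
    exact_mod_cast h
  · intro h
    by_cases hf : s.Finite
    · rw [hf.encard_eq_coe_toFinset_card]
      exact_mod_cast h hf
    · rw [Set.encard_eq_top_iff.2 hf]
      exact ENat.natCast_lt_top j

open Classical in
-- The `j`-th transaction is the one whose point is the `j`-th point of the execution. The selected
-- incomplete transactions are those that have passed their point; they get the response that the
-- data type prescribes.
theorem strictlySerializable (he : e.IsExecution) (hwf : WellFormed e) :
    StrictlySerializable v₀ e := by
  obtain ⟨T, hT⟩ := exists_labels he hwf
  have hmem : ∀ j : ℕ, (j : ℕ∞) < {n | Point e n}.encard → Point e (Nat.nth (Point e) j) :=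
    fun j hj => Nat.nth_mem j (natCast_lt_encard_iff.1 hj)
  refine ⟨{
    len := {n | Point e n}.encard
    txn := fun j => (T (Nat.nth (Point e) j)).1
    pt := Nat.nth (Point e)
    ret := fun j => (apply (T (Nat.nth (Point e) j)).2 (serialVal e T j)).1
    val := serialVal e T
    txn_inv := fun j hj => ?_
    txn_inj := fun i j hi hj hij => ?_
    complete := fun c x n y n' hx hc => ?_
    inv_le_pt := fun j hj => ?_
    pt_mono := fun i j hij hj => ?_
    val_zero := rfl
    val_succ := fun j c x hj hx => ?_ }⟩
  · obtain ⟨c, -, hp⟩ := hT _ (hmem j hj)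
    exact ⟨c, _, hp.2.1⟩
  · obtain ⟨c, hc, hp⟩ := hT _ (hmem i hi)
    obtain ⟨c', hc', hp'⟩ := hT _ (hmem j hj)
    -- The same invocation means the same client, and one transaction has only one point.
    have hij' : (T (Nat.nth (Point e) i)).1 = (T (Nat.nth (Point e) j)).1 := hij
    rw [hij'] at hp
    have hcc := hp.2.1.2.symm.trans hp'.2.1.2
    injection hcc with hcc
    subst hcc
    have := point_unique he hwf (hmem i hi).1 (hmem j hj).1 hc hc' hp hp'
    rw [← Nat.count_nth (natCast_lt_encard_iff.1 hi), this,
      Nat.count_nth (natCast_lt_encard_iff.1 hj)]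
  · have hp := pending_of_completes hwf hx hc
    obtain ⟨q, hq, hq', hpt⟩ := exists_point he hwf hc.2.1.1.le hp
      (clientStep_of_resp hc.2.1.1 hc.2.1.2).past_of_resp
    have hql : (q : ℕ∞) < e.len := lt_trans (by exact_mod_cast hq') hc.2.1.1
    have hTq := hT.eq hql hpt (hp.of_le hq hq'.le)
    have hP : Point e q := ⟨hql, c, hpt⟩
    -- The place of a transaction in the serial order is the number of points before its own.
    refine ⟨Nat.count (Point e) q, natCast_lt_encard_iff.2 fun hf => Nat.count_lt_card hf hP, ?_, ?_, ?_⟩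
    · simp only [Nat.nth_count hP, hTq]
    · simp only [Nat.nth_count hP, hTq]
      exact response_eq he hwf hc.2.1 hp hq hq' hpt (keyVal_lastKey he hwf hT hql.le)
    · rwa [Nat.nth_count hP]
  · obtain ⟨c, -, hp⟩ := hT _ (hmem j hj)
    exact ⟨hp.1.le, (hmem j hj).1⟩
  · exact (Nat.nth_lt_nth' hij (natCast_lt_encard_iff.1 hj)).le
  · obtain ⟨c', -, hp⟩ := hT _ (hmem j hj)
    have := hx.2.symm.trans hp.2.1.2
    cases this
    rfl

end Serial

/-! ### Progress: servers answer, and transactions complete. -/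

section Liveness

variable {ℓ m k : ℕ} {V : Fin k → Type u} {v₀ : ∀ i, V i} {coord : Fin k}
  {e : (algorithmB ℓ m V v₀ coord).Fragment} {n : ℕ}

/-! ## Property N -/

theorem AnsOK.answers {c : Client ℓ m} {s : Fin k} {q a : Msg ℓ V} (h : AnsOK e n c s q a)
    (hq : q.IsReadRequest) : Answers s q a := by
  cases q <;> cases a <;> simp only [AnsOK, Msg.IsReadRequest, Answers] at h hq ⊢
  exact h.1

/-- A server that gets no further input sends all messages in its outbox. -/
theorem server_sends {s : Fin k} (f : (server (ℓ := ℓ) (m := m) V v₀ s).Fragment) (hf : f.Fair)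
    (hin : ∀ n : ℕ, (n : ℕ∞) < f.len → f.act n ∉ (server (ℓ := ℓ) (m := m) V v₀ s).inp)
    {c : Client ℓ m} {a : Msg ℓ V} {l : List (Client ℓ m × Msg ℓ V)}
    (h0 : (show ServerState ℓ m V s from f.state 0).outbox = l) (hl : (c, a) ∈ l) :
    ∃ n : ℕ, (n : ℕ∞) < f.len ∧ f.act n = .send (.server s) (.client c) a := by
  have hstep : ∀ n : ℕ, (n : ℕ∞) < f.len → ∃ c' a', f.act n = .send (.server s) (.client c') a' ∧
      (show ServerState ℓ m V s from f.state n).outbox =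
        (c', a') :: (show ServerState ℓ m V s from f.state (n + 1)).outbox := by
    intro n hn
    have h1 : ServerStep s _ _ _ := f.step n hn
    have h2 := hin n hn
    dsimp only
    generalize f.act n = b at *
    generalize f.state n = σ at *
    generalize f.state (n + 1) = σ' at *
    cases h1 with
    | recv _ _ c a => exact (h2 ⟨c, a, rfl⟩).elim
    | send _ _ c a => exact ⟨c, a, rfl, rfl⟩
  by_contra! hcon
  -- Without input every step removes the head of the outbox, so the run is finite; as long as the
  -- message is unsent it stays queued and the server's task is enabled.
  have key : ∀ n : ℕ, (n : ℕ∞) ≤ f.len →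
      (c, a) ∈ (show ServerState ℓ m V s from f.state n).outbox ∧
        (show ServerState ℓ m V s from f.state n).outbox.length + n = l.length := by
    intro n
    induction n with
    | zero =>
      intro _
      rw [h0]
      exact ⟨hl, rfl⟩
    | succ n ih =>
      intro hn
      have hlt : (n : ℕ∞) < f.len := lt_of_lt_of_le (by exact_mod_cast Nat.lt_succ_self n) hn
      obtain ⟨h1, h2⟩ := ih hlt.le
      obtain ⟨c', a', hact, ho⟩ := hstep n hlt
      rw [ho] at h1 h2
      rw [List.length_cons] at h2
      refine ⟨(List.mem_cons.1 h1).resolve_left fun h => ?_, by omega⟩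
      cases h
      exact hcon n hlt hact
  obtain hlen | ⟨N, hN⟩ : f.len = ⊤ ∨ ∃ N : ℕ, f.len = N := by
    cases h : f.len with
    | top => exact Or.inl rfl
    | coe N => exact Or.inr ⟨N, rfl⟩
  · have := (key (l.length + 1) (hlen ▸ le_top)).2
    omega
  · refine (hf PUnit.unit).1 N hN ?_
    have := (key N hN.ge).1
    change ∃ b ∈ _, ∃ σ', ServerStep s (f.state N) b σ'
    dsimp only at this
    generalize f.state N = σ at *
    obtain ⟨vals, list, o⟩ := σ
    rcases o with _ | ⟨⟨c', a'⟩, o⟩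
    · simp at this
    · exact ⟨_, ⟨c', a', rfl⟩, _, .send vals list c' a' o⟩

/-- By the invariant a correct answer is in the outbox right after the receipt, so only the sending
remains. -/
theorem nonBlocking : NonBlocking (ℓ := ℓ) (m := m) V v₀ coord := by
  intro e N r s q he hwf hlen hact hq f hf0 hfair hin
  have hN : (N : ℕ∞) < e.len := by
    rw [hlen]
    exact_mod_cast Nat.lt_succ_self N
  obtain ⟨b, hb, hans⟩ := (good he hwf hN.le).answer hN hact
  obtain ⟨n, hn, h⟩ := server_sends (c := .reader r) (a := b) f hfair hin rfl (by
    dsimp only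
    rw [hf0]
    change _ ∈ (sv (e.state (N + 1)) s).outbox
    rw [hb]
    exact List.mem_append_right _ (List.mem_singleton_self _))
  exact ⟨n, b, hn, h, hans.answers hq⟩

/-! ## Completion of transactions -/

theorem ClientStep.idle_or_resp {S S' : (algorithmB ℓ m V v₀ coord).State} {c : Client ℓ m}
    {a : Act ℓ m V} (h : ClientStep S c a S') (hi : Idle S' c) : Idle S c ∨ ∃ y, a = .resp c y := by
  rcases c with w | r <;> simp only [Idle, ClientStep] at *
  · generalize wr S w = σ at *
    generalize wr S' w = σ' at *
    cases h with
    | resp => exact Or.inr ⟨_, rfl⟩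
    | recv =>
      obtain ⟨z, ph⟩ := σ
      simp only [writerRecv] at hi
      split at hi
      · split_ifs at hi
      · split_ifs at hi
      · exact Or.inl hi
    | invBusy => exact Or.inl hi
    | _ => cases hi
  · generalize rd S r = σ at *
    generalize rd S' r = σ' at *
    cases h with
    | resp => exact Or.inr ⟨_, rfl⟩
    | recv =>
      simp only [readerRecv] at hi
      split at hi
      · split_ifs at hi
      · split_ifs at hi
      · exact Or.inl hi
    | invBusy => exact Or.inl hi
    | _ => cases hi

/-- A client is not affected by actions that do not concern it. -/
theorem SysStep.eq_of_not_concerns {S S' : (algorithmB ℓ m V v₀ coord).State} {a : Act ℓ m V}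
    (h : SysStep S S' a) {c : Client ℓ m} (hc : ¬ Concerns c a) :
    S' (.proc (.client c)) = S (.proc (.client c)) ∧
      ∀ s, ts S' c s = ts S c s ∧ ob S' c s = ob S c s ∧ tc S' c s = tc S c s := by
  cases h with
  | inv c' x hs hf =>
    have hne : c ≠ c' := Ne.symm hc
    exact ⟨hf _ (by simpa), fun s => ⟨hf _ (by simp), ob_congr (hf _ (by simp)) c, hf _ (by simp)⟩⟩
  | resp c' y hs hf =>
    have hne : c ≠ c' := Ne.symm hc
    exact ⟨hf _ (by simpa), fun s => ⟨hf _ (by simp), ob_congr (hf _ (by simp)) c, hf _ (by simp)⟩⟩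
  | sendS c' s' a hs ht hf =>
    have hne : c ≠ c' := Ne.symm hc
    exact ⟨hf _ (by simpa) (by simp), fun s => ⟨hf _ (by simp) (by simp [hne]),
      ob_congr (hf _ (by simp) (by simp)) c, hf _ (by simp) (by simp)⟩⟩
  | recvC c' s' a hs ht hf =>
    have hne : c ≠ c' := Ne.symm hc
    exact ⟨hf _ (by simpa) (by simp), fun s => ⟨hf _ (by simp) (by simp),
      ob_congr (hf _ (by simp) (by simp)) c, hf _ (by simp) (by simp [hne])⟩⟩
  | recvS c' s' a hs ht hf =>
    have hne : c ≠ c' := Ne.symm hc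
    refine ⟨hf _ (by simp) (by simp), fun s => ⟨hf _ (by simp) (by simp [hne]), ?_,
      hf _ (by simp) (by simp)⟩⟩
    by_cases h : s = s'
    · subst h
      simp only [ob]
      rcases outbox_of_mem_serverRecv hs with h | ⟨b, h⟩
      · rw [h]
      · simp [h, outFor_append, outFor_cons_of_ne hne.symm, outFor_nil]
    · exact ob_congr (hf _ (by simpa using h) (by simp)) c
  | sendC c' s' a hs hv hl ht hf =>
    have hne : c ≠ c' := Ne.symm hc
    refine ⟨hf _ (by simp) (by simp), fun s => ⟨hf _ (by simp) (by simp), ?_,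
      hf _ (by simp) (by simp [hne])⟩⟩
    by_cases h : s = s'
    · subst h
      simp [ob, hs, outFor_cons_of_ne hne.symm]
    · exact ob_congr (hf _ (by simpa using h) (by simp)) c

/-- An outbox changes only at its tail, except by the sending of its first message. -/
theorem SysStep.outbox_eq {S S' : (algorithmB ℓ m V v₀ coord).State} {a : Act ℓ m V}
    (h : SysStep S S' a) (s : Fin k) : (∃ l, (sv S' s).outbox = (sv S s).outbox ++ l) ∨
      ∃ c b, a = .send (.server s) (.client c) b ∧ (sv S s).outbox = (c, b) :: (sv S' s).outbox := by
  have same : S' (.proc (.server s)) = S (.proc (.server s)) →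
      ∃ l, (sv S' s).outbox = (sv S s).outbox ++ l := fun h => ⟨[], by rw [sv, sv, h]; simp⟩
  cases h with
  | inv c' x hs hf => exact Or.inl (same (hf _ (by simp)))
  | resp c' y hs hf => exact Or.inl (same (hf _ (by simp)))
  | sendS c' s' a hs ht hf => exact Or.inl (same (hf _ (by simp) (by simp)))
  | recvC c' s' a hs ht hf => exact Or.inl (same (hf _ (by simp) (by simp)))
  | recvS c' s' a hs ht hf =>
    refine Or.inl ?_
    by_cases h : s = s'
    · subst h
      rcases outbox_of_mem_serverRecv hs with h | ⟨b, h⟩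
      · exact ⟨[], by rw [h]; simp⟩
      · exact ⟨_, h⟩
    · exact same (hf _ (by simpa using h) (by simp))
  | sendC c' s' a hs hv hl ht hf =>
    by_cases h : s = s'
    · subst h
      exact Or.inr ⟨c', a, rfl, hs⟩
    · exact Or.inl (same (hf _ (by simpa using h) (by simp)))

/-- An outstanding request is always represented by a message somewhere on its link. -/
theorem LinkState.eq_none {P : Msg ℓ V → Msg ℓ V → Prop} {q : Option (Msg ℓ V)}
    {t b : Multiset (Msg ℓ V)} {o : List (Msg ℓ V)} (h : LinkState P q t o b) (ht : t = 0)
    (ho : o = []) (hb : b = 0) : q = none := by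
  cases h <;> simp_all

/-- The task of client `c`. -/
def clientTask (c : Client ℓ m) : (algorithmB ℓ m V v₀ coord).Task :=
  ⟨.proc (.client c), match c with | .writer _ => PUnit.unit | .reader _ => PUnit.unit⟩

theorem concerns_of_mem_clientTask {c : Client ℓ m} {a : Act ℓ m V}
    (h : a ∈ (algorithmB ℓ m V v₀ coord).task (clientTask c)) : Concerns c a := by
  rcases c with w | r
  · rcases h with rfl | ⟨s, b, rfl⟩ <;> rfl
  · rcases h with ⟨I, v, rfl⟩ | ⟨s, b, rfl⟩ <;> rfl

/-- A busy client that awaits no answer can take a step. -/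
theorem Good.enabled (hg : Good e n) {c : Client ℓ m} (hi : ¬ Idle (e.state n) c)
    (hp : ∀ s, pend (e.state n) c s = none) :
    (algorithmB ℓ m V v₀ coord).EnabledIn (e.state n)
      ((algorithmB ℓ m V v₀ coord).task (clientTask c)) := by
  have hs := hg.shape c
  refine IOAutomaton.compose_enabledIn (component_compatible V v₀ coord) (e.state n) _
    (clientTask (v₀ := v₀) (coord := coord) c).2 ?_
  rcases c with w | r <;> simp only [pend, Idle, Shape] at hs hi hp
  · change ∃ a ∈ _, ∃ σ', WriterStep (m := m) coord w (wr (e.state n) w) a σ'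
    generalize wr (e.state n) w = τ at *
    obtain ⟨z, ph⟩ := τ
    rcases ph with _ | ⟨I, v, un, una⟩ | ⟨I, _ | _⟩ | t <;> simp only [writerPend] at hp
    · exact (hi rfl).elim
    · by_cases hu : un.Nonempty
      · obtain ⟨i, hi⟩ := hu
        exact ⟨_, Or.inr ⟨_, _, rfl⟩, _, .sendValue z I v un una i (hs.2.1 (hs.1 hi)) hi⟩
      -- With nothing left to send, an unacknowledged server, which `Shape` provides, would be one
      -- with an outstanding request.
      · obtain ⟨i, hi⟩ := hs.2.2
        have := hp i
        rw [Finset.not_nonempty_iff_eq_empty] at hu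
        simp [hu, hs.2.1 hi, hi] at this
    · exact ⟨_, Or.inr ⟨_, _, rfl⟩, _, .sendUpdate z I⟩
    · have := hp coord
      simp at this
    · exact ⟨_, Or.inl rfl, _, .resp z t⟩
  · change ∃ a ∈ _, ∃ σ', ReaderStep (m := m) coord r (rd (e.state n) r) a σ'
    generalize rd (e.state n) r = τ at *
    rcases τ with _ | ⟨I, _ | _⟩ | ⟨I, t, κ, un, got⟩ <;> simp only [readerPend] at hp
    · exact (hi rfl).elim
    · exact ⟨_, Or.inr ⟨_, _, rfl⟩, _, .sendGetTag I⟩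
    · have := hp coord
      simp at this
    · by_cases hu : un.Nonempty
      · obtain ⟨i, hi⟩ := hu
        exact ⟨_, Or.inr ⟨_, _, rfl⟩, _, .sendRead I t κ un got i hi⟩
      · rw [Finset.not_nonempty_iff_eq_empty] at hu
        subst hu
        -- All requests are sent and none is outstanding, so all values have arrived and the reader
        -- can respond.
        have hgot : ∀ i : I, ∃ v, got i = some v := by
          intro i
          have := hp i
          rw [ite_eq_right_iff] at this
          by_contra! hcon
          have h := this ⟨i.2, by simp, Option.eq_none_iff_forall_ne_some.2 hcon⟩
          cases h
        choose v hv using hgot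
        exact ⟨_, Or.inl ⟨_, _, rfl⟩, _, .resp I t κ got v hv⟩

theorem enabled_toServer {S : (algorithmB ℓ m V v₀ coord).State} {c : Client ℓ m} {s : Fin k}
    {a : Msg ℓ V} (h : a ∈ ts S c s) : (algorithmB ℓ m V v₀ coord).EnabledIn S
      ((algorithmB ℓ m V v₀ coord).task ⟨.toServer c s, a⟩) := by
  refine IOAutomaton.compose_enabledIn (component_compatible V v₀ coord) S (.toServer c s) a ?_
  obtain ⟨M, hM⟩ := Multiset.exists_cons_of_mem h
  refine ⟨_, rfl, M, ?_⟩
  change ChannelStep _ _ (ts S c s) _ _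
  rw [hM]
  exact .recv M a

theorem enabled_toClient {S : (algorithmB ℓ m V v₀ coord).State} {c : Client ℓ m} {s : Fin k}
    {a : Msg ℓ V} (h : a ∈ tc S c s) : (algorithmB ℓ m V v₀ coord).EnabledIn S
      ((algorithmB ℓ m V v₀ coord).task ⟨.toClient s c, a⟩) := by
  refine IOAutomaton.compose_enabledIn (component_compatible V v₀ coord) S (.toClient s c) a ?_
  obtain ⟨M, hM⟩ := Multiset.exists_cons_of_mem h
  refine ⟨_, rfl, M, ?_⟩
  change ChannelStep _ _ (tc S c s) _ _
  rw [hM]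
  exact .recv M a

theorem enabled_server {S : (algorithmB ℓ m V v₀ coord).State} {s : Fin k}
    (h : (sv S s).outbox ≠ []) : (algorithmB ℓ m V v₀ coord).EnabledIn S
      ((algorithmB ℓ m V v₀ coord).task ⟨.proc (.server s), PUnit.unit⟩) := by
  refine IOAutomaton.compose_enabledIn (component_compatible V v₀ coord) S (.proc (.server s))
    PUnit.unit ?_
  change ∃ b ∈ _, ∃ σ', ServerStep s (sv S s) b σ'
  generalize sv S s = σ at *
  obtain ⟨vals, list, o⟩ := σ
  rcases o with _ | ⟨⟨c', a'⟩, o⟩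
  · exact (h rfl).elim
  · exact ⟨_, ⟨c', a', rfl⟩, _, .send vals list c' a' o⟩

theorem exists_mem_of_outFor_ne_nil {l : List (Client ℓ m × Msg ℓ V)} {c : Client ℓ m}
    (h : outFor l c ≠ []) : ∃ a, (c, a) ∈ l := by
  obtain ⟨a, ha⟩ := List.exists_mem_of_ne_nil _ h
  simp only [outFor, List.mem_filterMap] at ha
  obtain ⟨⟨c', a'⟩, hm, ha⟩ := ha
  split_ifs at ha with hc
  cases hc
  exact ⟨a', hm⟩

/-- In an infinite fair execution each message in an outbox is eventually sent. -/
theorem exists_concerns_of_mem_outbox (hf : e.Fair) (hlen : e.len = ⊤) {c : Client ℓ m}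
    {s : Fin k} {a : Msg ℓ V} (pre post : List (Client ℓ m × Msg ℓ V))
    (h : (sv (e.state n) s).outbox = pre ++ (c, a) :: post) : ∃ j ≥ n, Concerns c (e.act j) := by
  have hlt : ∀ j : ℕ, (j : ℕ∞) < e.len := fun j => hlen ▸ ENat.natCast_lt_top j
  -- Induction on the queue in front of the message. At the head it remains until it is sent, and
  -- fairness forces the server, enabled all along, to act.
  induction pre generalizing n post with
  | nil =>
    by_contra! hcon
    have key : ∀ j ≥ n, ∃ post, (sv (e.state j) s).outbox = (c, a) :: post := by
      intro j hj
      induction j, hj using Nat.le_induction with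
      | base => exact ⟨post, h⟩
      | succ j hj ih =>
        obtain ⟨post, ih⟩ := ih
        rcases (sysStep (hlt j)).outbox_eq s with ⟨l, hl⟩ | ⟨c', b, hact, hb⟩
        · exact ⟨post ++ l, by rw [hl, ih]; rfl⟩
        · rw [ih] at hb
          cases hb
          refine (hcon j hj ?_).elim
          rw [hact]
          rfl
    obtain ⟨j, hj, h' | h'⟩ := (hf ⟨.proc (.server s), PUnit.unit⟩).2 hlen n
    · obtain ⟨c', b, hb⟩ := h'
      obtain ⟨post, hp⟩ := key j hj
      rcases (sysStep (hlt j)).outbox_eq s with ⟨l, hl⟩ | ⟨c', b, hact, hb⟩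
      -- A send shortens the outbox, so it cannot at the same time extend it.
      · have hs := sysStep (hlt j)
        rw [hb] at hs
        cases hs with
        | sendC _ _ _ ho =>
          have := congrArg List.length ho
          rw [hl] at this
          simp at this
          omega
      · rw [hp] at hb
        cases hb
        refine (hcon j hj ?_).elim
        rw [hact]
        rfl
    · obtain ⟨post, hp⟩ := key j hj
      exact h' (enabled_server (by simp [hp]))
  | cons p pre ih =>
    have hex : ∃ j, n ≤ j ∧ ∃ c' b, e.act j = .send (.server s) (.client c') b := by
      by_contra! hcon
      have key : ∀ j ≥ n, (sv (e.state j) s).outbox ≠ [] := by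
        intro j hj
        induction j, hj using Nat.le_induction with
        | base => simp [h]
        | succ j hj ih =>
          rcases (sysStep (hlt j)).outbox_eq s with ⟨l, hl⟩ | ⟨c', b, hact, hb⟩
          · simp [hl, ih]
          · exact (hcon j hj c' b hact).elim
      obtain ⟨j, hj, ⟨c', b, h'⟩ | h'⟩ := (hf ⟨.proc (.server s), PUnit.unit⟩).2 hlen n
      · exact hcon j hj c' b h'
      · exact h' (enabled_server (key j hj))
    classical
    obtain ⟨hj, c', b, hact⟩ := Nat.find_spec hex
    -- Before the first send of this server its queue only grows at the tail, so that send removes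
    -- `p` and shortens the prefix.
    have hmin := fun i => @Nat.find_min _ _ hex i
    generalize Nat.find hex = j at *
    have key : ∀ i ≥ n, i ≤ j → ∃ post, (sv (e.state i) s).outbox = p :: (pre ++ (c, a) :: post) := by
      intro i hi
      induction i, hi using Nat.le_induction with
      | base => exact fun _ => ⟨post, h⟩
      | succ i hi ih =>
        intro hij
        obtain ⟨post, ih⟩ := ih (by omega)
        rcases (sysStep (hlt i)).outbox_eq s with ⟨l, hl⟩ | ⟨c', b, hact, hb⟩
        · exact ⟨post ++ l, by rw [hl, ih]; simp⟩
        · exact (hmin i (by omega) ⟨hi, c', b, hact⟩).elim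
    obtain ⟨post, hp⟩ := key j hj le_rfl
    have hs := sysStep (hlt j)
    rw [hact] at hs
    cases hs with
    | sendC _ _ _ ho =>
      rw [hp] at ho
      injection ho with _ ho
      obtain ⟨i, hi, hc⟩ := ih post ho.symm
      exact ⟨i, by omega, hc⟩

/-- If no action concerns a client from some time on, its links are empty and it cannot take a step
then. -/
theorem quiescent_of_not_concerns (hf : e.Fair) (hlen : e.len = ⊤) {c : Client ℓ m}
    (hc : ∀ j ≥ n, ¬ Concerns c (e.act j)) :
    (∀ s, ts (e.state n) c s = 0 ∧ ob (e.state n) c s = [] ∧ tc (e.state n) c s = 0) ∧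
      ∃ j ≥ n, ¬ (algorithmB ℓ m V v₀ coord).EnabledIn (e.state j)
          ((algorithmB ℓ m V v₀ coord).task (clientTask c)) := by
  have hlt : ∀ j : ℕ, (j : ℕ∞) < e.len := fun j => hlen ▸ ENat.natCast_lt_top j
  -- The channels of the client are frozen, so a message in one of them would keep its delivery
  -- enabled forever, and the delivery would concern the client.
  have const : ∀ j ≥ n, ∀ s, ts (e.state j) c s = ts (e.state n) c s ∧ tc (e.state j) c s = tc (e.state n) c s := by
    intro j hj
    induction j, hj using Nat.le_induction with
    | base => exact fun s => ⟨rfl, rfl⟩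
    | succ j hj ih =>
      have h := ((sysStep (hlt j)).eq_of_not_concerns (hc j hj)).2
      exact fun s => ⟨(h s).1.trans (ih s).1, (h s).2.2.trans (ih s).2⟩
  refine ⟨fun s => ⟨?_, ?_, ?_⟩, ?_⟩
  · refine Multiset.eq_zero_of_forall_notMem fun a ha => ?_
    obtain ⟨j, hj, h | h⟩ := (hf ⟨.toServer c s, a⟩).2 hlen n
    · refine hc j hj ?_
      rw [show e.act j = .recv (.client c) (.server s) a from h]
      rfl
    · refine h (enabled_toServer ?_)
      rwa [(const j hj s).1]
  · by_contra hne
    obtain ⟨a, ha⟩ := exists_mem_of_outFor_ne_nil hne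
    obtain ⟨pre, post, hp⟩ := List.append_of_mem ha
    obtain ⟨j, hj, h⟩ := exists_concerns_of_mem_outbox hf hlen pre post hp
    exact hc j hj h
  · refine Multiset.eq_zero_of_forall_notMem fun a ha => ?_
    obtain ⟨j, hj, h | h⟩ := (hf ⟨.toClient s c, a⟩).2 hlen n
    · refine hc j hj ?_
      rw [show e.act j = .recv (.server s) (.client c) a from h]
      rfl
    · refine h (enabled_toClient ?_)
      rwa [(const j hj s).2]
  · obtain ⟨j, hj, h | h⟩ := (hf (clientTask c)).2 hlen n
    · exact (hc j hj (concerns_of_mem_clientTask h)).elim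
    · exact ⟨j, hj, h⟩

/-- A client stuck in a transaction uses up its potential, after which fairness empties its links.
With nothing outstanding a busy client is enabled, which fairness forbids. -/
theorem allComplete (he : e.IsExecution) (hwf : WellFormed e) (hf : e.Fair) : AllComplete e := by
  intro c x p hinv
  by_contra! hcon
  -- The first response after `p` would complete the transaction, so there is none at all; by
  -- well-formedness there is then no later invocation either.
  have hresp : ∀ j y, p < j → ¬ RespAt e c y j := by
    intro j
    induction j using Nat.strong_induction_on with
    | _ j ih => exact fun y hj hr => hcon y j ⟨hj, hr, fun i y' hi hi' => ih i hi' y' hi⟩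
  have hninv : ∀ j x', p < j → ¬ InvAt e c x' j := fun j x' hj hx => by
    obtain ⟨y, i, hi, -, hr⟩ := hwf c x x' p j hinv hx hj
    exact hresp i y hi hr
  have hbusy : ∀ j, p < j → (j : ℕ∞) ≤ e.len → ¬ Idle (e.state j) c := by
    intro j hj
    induction j, hj using Nat.le_induction with
    | base =>
      exact fun _ hi => (clientStep_of_inv hinv.1 hinv.2).not_past_of_inv
        ((good he hwf hinv.1.le).idle_of_inv hwf hinv) hi.past
    | succ j hj ih =>
      intro hjl hi
      have hlt : (j : ℕ∞) < e.len := lt_of_lt_of_le (by exact_mod_cast Nat.lt_succ_self j) hjl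
      have hs := sysStep hlt
      have hb := ih hlt.le
      have same : e.state (j + 1) (.proc (.client c)) = e.state j (.proc (.client c)) → False := by
        intro h
        rcases c with w | r <;> simp only [Idle, wr, rd, h] at hi hb <;> exact hb hi
      have hstep : ClientStep (e.state j) c (e.act j) (e.state (j + 1)) → False := fun h => by
        rcases h.idle_or_resp hi with h | ⟨y, h⟩
        · exact hb h
        · exact hresp j y hj ⟨hlt, h⟩
      by_cases hc : Concerns c (e.act j)
      · generalize e.act j = a at *
        cases hs with
        | inv c' x h hf =>
          cases (show c' = c from hc)
          exact hstep h
        | resp c' x h hf =>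
          cases (show c' = c from hc)
          exact hstep h
        | sendS c' s a h _ hf =>
          cases (show c' = c from hc)
          exact hstep h
        | recvC c' s a h _ hf =>
          cases (show c' = c from hc)
          exact hstep h
        | recvS c' s a h _ hf => exact same (hf _ (by simp) (by simp))
        | sendC c' s a _ _ _ _ hf => exact same (hf _ (by simp) (by simp))
      · exact same (hs.eq_of_not_concerns hc).1
  have key : ∀ N : ℕ, p < N → (N : ℕ∞) ≤ e.len →
      (∀ s, ts (e.state N) c s = 0 ∧ ob (e.state N) c s = [] ∧ tc (e.state N) c s = 0) →
      ∀ s, pend (e.state N) c s = none := by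
    intro N hN hNl h0 s
    exact ((good he hwf hNl).link c s).eq_none (h0 s).1 (h0 s).2.1 (h0 s).2.2
  obtain hlen | ⟨N, hN⟩ : e.len = ⊤ ∨ ∃ N : ℕ, e.len = N := by
    cases h : e.len with
    | top => exact Or.inl rfl
    | coe N => exact Or.inr ⟨N, rfl⟩
  · have hlt : ∀ j : ℕ, (j : ℕ∞) < e.len := fun j => hlen ▸ ENat.natCast_lt_top j
    -- Otherwise the potential, which no invocation raises any more, would drop infinitely often.
    obtain ⟨N, hN, hmin⟩ : ∃ N, p < N ∧ ∀ j ≥ N, ¬ Concerns c (e.act j) := by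
      by_contra! hall
      have : ∀ w N, p < N → work (e.state N) c = w → False := by
        intro w
        induction w using Nat.strong_induction_on with
        | _ w ih =>
          intro N hN hw
          obtain ⟨j, hj, hc⟩ := hall N hN
          have hmono : ∀ i ≥ N, work (e.state i) c ≤ w := by
            intro i hi
            induction i, hi using Nat.le_induction with
            | base => exact hw.le
            | succ i hi ih' =>
              exact ((sysStep (hlt i)).work_le c fun x h =>
                hninv i x (hN.trans_le hi) ⟨hlt i, h⟩).1.trans ih'
          exact ih _ ((((sysStep (hlt j)).work_le c fun x h =>
            hninv j x (hN.trans_le hj) ⟨hlt j, h⟩).2 hc).trans_le (hmono j hj)) (j + 1)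
            (by omega) rfl
      exact this _ (p + 1) (Nat.lt_succ_self p) rfl
    obtain ⟨j, hj, hne⟩ := (quiescent_of_not_concerns hf hlen hmin).2
    refine hne ((good he hwf (hlt j).le).enabled (hbusy j (by omega) (hlt j).le)
      (key j (by omega) (hlt j).le ?_))
    -- Applied a second time, from `j` on, since empty links are needed at the very time when the
    -- client is disabled.
    exact (quiescent_of_not_concerns hf hlen fun i hi => hmin i (hj.le.trans hi)).1
  · have hpN : p < N := by
      have := hinv.1
      rw [hN] at this
      exact_mod_cast this
    refine (hf (clientTask c)).1 N hN ((good he hwf hN.ge).enabled (hbusy N hpN hN.ge)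
      (key N hpN hN.ge fun s => ⟨?_, ?_, ?_⟩))
    · exact Multiset.eq_zero_of_forall_notMem fun a ha => (hf ⟨.toServer c s, a⟩).1 N hN
        (enabled_toServer ha)
    · by_contra hne
      obtain ⟨a, ha⟩ := exists_mem_of_outFor_ne_nil hne
      exact (hf ⟨.proc (.server s), PUnit.unit⟩).1 N hN
        (enabled_server (List.ne_nil_of_mem ha))
    · exact Multiset.eq_zero_of_forall_notMem fun a ha => (hf ⟨.toClient s c, a⟩).1 N hN
        (enabled_toClient ha)

end Liveness

/-! ### Two rounds and one version per object, read off the reader's state. -/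

section Rounds

variable {ℓ m k : ℕ} {V : Fin k → Type u} {v₀ : ∀ i, V i} {coord : Fin k}
  {e : (algorithmB ℓ m V v₀ coord).Fragment} {n : ℕ}

/-! ## Property o -/

/-- In its present `READ` the reader has sent the request `a` to server `s`. -/
def ReaderState.Sent (coord : Fin k) (s : Fin k) (a : Msg ℓ V) : ReaderState ℓ V → Prop
  | .getTag I true => s = coord ∧ a = .getTagArray I
  | .reading I _ κ unsent _ =>
      (s = coord ∧ a = .getTagArray I) ∨ (s ∈ I ∧ s ∉ unsent ∧ a = .readValue (κ s))
  | _ => False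

/-- In its present `READ` the reader has received the answer `a` from server `s`. -/
def ReaderState.Received (coord : Fin k) (s : Fin k) (a : Msg ℓ V) : ReaderState ℓ V → Prop
  | .reading _ t κ _ got => (s = coord ∧ a = .tagArray t κ) ∨ ∃ v, got s = some v ∧ a = .value s v
  | _ => False

/-- Action `x` occurs strictly between positions `n` and `j`. -/
def Done (e : (algorithmB ℓ m V v₀ coord).Fragment) (n j : ℕ) (x : Act ℓ m V) : Prop :=
  ∃ i, n < i ∧ i < j ∧ e.act i = x

theorem done_succ_iff {j : ℕ} (hj : n < j) {x : Act ℓ m V} :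
    Done e n (j + 1) x ↔ Done e n j x ∨ e.act j = x := by
  constructor
  · rintro ⟨i, h1, h2, h3⟩
    rcases Nat.lt_succ_iff_lt_or_eq.1 h2 with h | rfl
    · exact Or.inl ⟨i, h1, h, h3⟩
    · exact Or.inr h3
  · rintro (⟨i, h1, h2, h3⟩ | h)
    · exact ⟨i, h1, by omega, h3⟩
    · exact ⟨j, hj, by omega, h⟩

theorem ReaderStep.sent_iff {r : Fin m} {σ σ' : ReaderState ℓ V} {s₀ : Fin k} {a₀ : Msg ℓ V}
    (h : ReaderStep coord r σ (.send (.client (.reader r)) (.server s₀) a₀) σ') (hσ : σ.Shape)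
    (s : Fin k) (a : Msg ℓ V) :
    (σ'.Sent coord s a ↔ σ.Sent coord s a ∨ (s₀ = s ∧ a₀ = a)) ∧
      (σ'.Received coord s a ↔ σ.Received coord s a) := by
  cases h with
  | sendGetTag I => simp [ReaderState.Sent, ReaderState.Received, eq_comm]
  | sendRead I t κ un got _ hu =>
    refine ⟨?_, Iff.rfl⟩
    simp only [ReaderState.Sent, Finset.mem_erase, not_and, or_assoc]
    refine or_congr_right ?_
    constructor
    · rintro ⟨h1, h2, rfl⟩
      by_cases h : s = s₀
      · exact Or.inr ⟨h.symm, by rw [h]⟩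
      · exact Or.inl ⟨h1, h2 h, rfl⟩
    · rintro (⟨h1, h2, rfl⟩ | ⟨rfl, rfl⟩)
      · exact ⟨h1, fun _ => h2, rfl⟩
      · exact ⟨hσ.1 hu, fun h => (h rfl).elim, rfl⟩

theorem ReaderStep.received_iff {r : Fin m} {σ σ' : ReaderState ℓ V} {s₀ : Fin k} {a₀ q : Msg ℓ V}
    (h : ReaderStep coord r σ (.recv (.server s₀) (.client (.reader r)) a₀) σ')
    (hq : readerPend coord σ s₀ = some q) (hf : Fits s₀ q a₀) (s : Fin k) (a : Msg ℓ V) :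
    (σ'.Sent coord s a ↔ σ.Sent coord s a) ∧
      (σ'.Received coord s a ↔ σ.Received coord s a ∨ (s₀ = s ∧ a₀ = a)) := by
  cases h
  rcases σ with _ | ⟨I, _ | _⟩ | ⟨I, t, κ, un, got⟩ <;> simp only [readerPend] at hq
  · cases hq
  · cases hq
  · split_ifs at hq with hs
    subst hs
    cases hq
    cases a₀ <;> simp only [Fits] at hf
    -- Phase read-value starts with all requests unsent and no value received, so the new state
    -- records only the exchange with the coordinator.
    simp +contextual [readerRecv, ReaderState.Sent, ReaderState.Received, eq_comm]
  · split_ifs at hq with hs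
    cases hq
    cases a₀ with
    | value i v =>
      simp only [Fits] at hf
      subst hf
      simp only [readerRecv, if_true, ReaderState.Sent, ReaderState.Received, or_assoc, true_and]
      refine or_congr_right ?_
      by_cases h : s = i
      · subst h
        simp [hs.2.2, eq_comm]
      · simp [Function.update_of_ne h, Ne.symm h]
    | _ => simp only [Fits] at hf

theorem ReaderStep.not_sent {r : Fin m} {σ σ' : ReaderState ℓ V} {s : Fin k} {a a' : Msg ℓ V}
    (h : ReaderStep coord r σ (.send (.client (.reader r)) (.server s) a') σ')
    (hs : σ.Sent coord s a) : a.round ≠ a'.round := by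
  cases h with
  | sendGetTag I => exact hs.elim
  | sendRead I t κ un got _ hu =>
    rcases hs with ⟨-, rfl⟩ | ⟨-, h, -⟩
    · simp [Msg.round]
    · exact (h hu).elim

theorem not_received_of_pend {σ : ReaderState ℓ V} {s : Fin k} {q a a' : Msg ℓ V}
    (hq : readerPend coord σ s = some q) (hf : Fits s q a') (hr : σ.Received coord s a) :
    a.round ≠ a'.round := by
  rcases σ with _ | ⟨I, _ | _⟩ | ⟨I, t, κ, un, got⟩ <;> simp only [ReaderState.Received] at hr
  simp only [readerPend] at hq
  split_ifs at hq with hs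
  cases hq
  cases a' <;> simp only [Fits] at hf
  rcases hr with ⟨-, rfl⟩ | ⟨v, hv, -⟩
  · simp [Msg.round]
  · rw [hs.2.2] at hv
    cases hv

theorem sent_of_pend {σ : ReaderState ℓ V} {s : Fin k} {q a : Msg ℓ V}
    (hq : readerPend coord σ s = some q) (hf : Fits s q a) :
    σ.Sent coord s q ∧ Answers s q a := by
  rcases σ with _ | ⟨I, _ | _⟩ | ⟨I, t, κ, un, got⟩ <;> simp only [readerPend] at hq
  · cases hq
  · cases hq
  · split_ifs at hq with hs
    cases hq
    cases a <;> simp only [Fits] at hf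
    exact ⟨⟨hs, rfl⟩, trivial⟩
  · split_ifs at hq with hs
    cases hq
    cases a <;> simp only [Fits] at hf
    exact ⟨Or.inr ⟨hs.1, hs.2.1, rfl⟩, hf⟩

/-- While the tag array is awaited, no read-value request has been sent. This makes the rounds
sequential. -/
theorem round_of_pend_of_sent {σ : ReaderState ℓ V} {s s' : Fin k} {q a b : Msg ℓ V}
    (hq : readerPend coord σ s = some q) (hf : Fits s q a) (hb : σ.Sent coord s' b) :
    b.round ≤ a.round := by
  rcases σ with _ | ⟨I, _ | _⟩ | ⟨I, t, κ, un, got⟩ <;> simp only [readerPend] at hq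
  · cases hq
  · cases hq
  · split_ifs at hq with hs
    cases hq
    cases a <;> simp only [Fits] at hf
    rw [hb.2]
    exact le_rfl
  · split_ifs at hq with hs
    cases hq
    cases a <;> simp only [Fits] at hf
    rcases hb with ⟨-, rfl⟩ | ⟨-, -, rfl⟩ <;> simp [Msg.round]

theorem ReaderState.Sent.round {σ : ReaderState ℓ V} {s : Fin k} {a : Msg ℓ V}
    (h : σ.Sent coord s a) : 1 ≤ a.round ∧ a.round ≤ 2 := by
  rcases σ with _ | ⟨I, _ | _⟩ | ⟨I, t, κ, un, got⟩ <;> simp only [ReaderState.Sent] at h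
  · rw [h.2]
    simp [Msg.round]
  · rcases h with ⟨-, rfl⟩ | ⟨-, -, rfl⟩ <;> simp [Msg.round]

theorem round_eq_of_answers {s : Fin k} {q a : Msg ℓ V} (h : Answers s q a) : q.round = a.round := by
  cases q <;> cases a <;> simp only [Answers] at h <;> rfl

/-- The state of a reader records the requests and answers of its present `READ`. -/
theorem done_iff (he : e.IsExecution) (hwf : WellFormed e) {r : Fin m} {x : Inv V} {j : ℕ}
    (hj : (j : ℕ∞) ≤ e.len) (hp : Pending e (.reader r) j n x) (s : Fin k) (a : Msg ℓ V) :
    (Done e n j (.send (.client (.reader r)) (.server s) a) ↔ (rd (e.state j) r).Sent coord s a) ∧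
      (Done e n j (.recv (.server s) (.client (.reader r)) a) ↔
        (rd (e.state j) r).Received coord s a) := by
  obtain ⟨hnj, hinv, hno⟩ := hp
  induction j, hnj using Nat.le_induction with
  | base =>
    have hi := (good he hwf hinv.1.le).idle_of_inv hwf hinv
    have hs := clientStep_of_inv hinv.1 hinv.2
    have hd : ∀ y, ¬ Done e n (n + 1) y := fun y ⟨i, h1, h2, _⟩ => by omega
    simp only [Idle, ClientStep] at hi hs
    generalize rd (e.state n) r = σ at *
    generalize rd (e.state (n + 1)) r = σ' at *
    cases hs with
    | inv I hI => exact ⟨iff_of_false (hd _) id, iff_of_false (hd _) id⟩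
    | invBusy _ _ _ h => exact (h hi).elim
  | succ j hnj ih =>
    have hlt : (j : ℕ∞) < e.len := lt_of_lt_of_le (by exact_mod_cast Nat.lt_succ_self j) hj
    have hg := good he hwf hlt.le
    have ih := ih hlt.le fun i h1 h2 => hno i h1 (by omega)
    have hn := hno j (by omega) (by omega)
    rw [done_succ_iff (by omega), done_succ_iff (by omega), ih.1, ih.2]
    have hs := sysStep hlt
    have hsh := hg.shape (.reader r)
    have same : e.state (j + 1) (.proc (.client (.reader r))) =
        e.state j (.proc (.client (.reader r))) →
        (∀ a, e.act j ≠ .send (.client (.reader r)) (.server s) a) →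
        (∀ a, e.act j ≠ .recv (.server s) (.client (.reader r)) a) →
        ((rd (e.state j) r).Sent coord s a ∨
            e.act j = .send (.client (.reader r)) (.server s) a ↔
          (rd (e.state (j + 1)) r).Sent coord s a) ∧
        ((rd (e.state j) r).Received coord s a ∨
            e.act j = .recv (.server s) (.client (.reader r)) a ↔
          (rd (e.state (j + 1)) r).Received coord s a) := by
      intro h h1 h2
      simp only [rd, h, h1, h2, or_false, and_self]
    generalize ha : e.act j = b at hs same hn
    cases hs with
    | inv c y hs hf =>
      refine same (hf _ ?_) (by simp) (by simp)
      rintro h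
      cases h
      exact (hn.1 y rfl).elim
    | resp c y hs hf =>
      refine same (hf _ ?_) (by simp) (by simp)
      rintro h
      cases h
      exact (hn.2 y rfl).elim
    | sendS c s' b hs ht hf =>
      by_cases hc : c = .reader r
      · subst hc
        have := ReaderStep.sent_iff hs hsh s a
        simpa using ⟨this.1.symm, this.2.symm⟩
      · exact same (hf _ (by simpa using Ne.symm hc) (by simp)) (by simp [hc]) (by simp)
    | recvS c s' b _ _ hf => exact same (hf _ (by simp) (by simp)) (by simp) (by simp)
    | sendC c s' b _ _ _ _ hf => exact same (hf _ (by simp) (by simp)) (by simp) (by simp)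
    | recvC c s' b hs ht hf =>
      by_cases hc : c = .reader r
      · subst hc
        obtain ⟨q, hq, hans⟩ := hg.of_recvC hlt ha
        have := ReaderStep.received_iff hs hq hans.fits s a
        simpa using ⟨this.1.symm, this.2.symm⟩
      · exact same (hf _ (by simpa using Ne.symm hc) (by simp)) (by simp) (by simp [hc])

/-- By `done_iff` the state in which the reader responds lists all requests and answers of the READ,
and the intermediate states give their order. -/
theorem readInRounds (he : e.IsExecution) (hwf : WellFormed e) {r : Fin m} {I : Finset (Fin k)}
    {hI : I.Nonempty} {v : ∀ i : I, V i} {n' : ℕ} (hinv : InvAt e (.reader r) (.read I hI) n)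
    (hc : Completes e (.reader r) n (.values I v) n') : ReadInRounds 2 e r I v n n' := by
  have hp := pending_of_completes hwf hinv hc
  have hlen : ∀ j, j ≤ n' → (j : ℕ∞) < e.len := fun j hj =>
    lt_of_le_of_lt (by exact_mod_cast hj) hc.2.1.1
  have hdone : ∀ j, n < j → j ≤ n' → ∀ s a, _ := fun j h1 h2 =>
    done_iff he hwf (hlen j h2).le (hp.of_le h1 h2)
  obtain ⟨t, κ, got, hfin, hgot⟩ : ∃ t κ got, rd (e.state n') r = .reading I t κ ∅ got ∧
      ∀ i : I, got i = some (v i) := by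
    have hs := clientStep_of_resp hc.2.1.1 hc.2.1.2
    simp only [ClientStep] at hs
    generalize rd (e.state n') r = σ at *
    generalize rd (e.state (n' + 1)) r = σ' at *
    cases hs with
    | resp _ t κ got _ h => exact ⟨t, κ, got, rfl, h⟩
  have hend := hdone n' hc.1 le_rfl
  rw [hfin] at hend
  have hsend : ∀ j s a, n < j → j < n' →
      e.act j = .send (.client (.reader r)) (.server s) a →
      ∃ σ', ReaderStep coord r (rd (e.state j) r)
        (.send (.client (.reader r)) (.server s) a) σ' := by
    intro j s a h1 h2 ha
    have hs := sysStep (hlen j h2.le)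
    rw [ha] at hs
    cases hs with
    | sendS _ _ _ hs => exact ⟨_, hs⟩
  have hrecv : ∀ j s a, n < j → j < n' →
      e.act j = .recv (.server s) (.client (.reader r)) a →
      ∃ q, readerPend coord (rd (e.state j) r) s = some q ∧ Fits s q a := by
    intro j s a h1 h2 ha
    obtain ⟨q, hq, hans⟩ := (good he hwf (hlen j h2.le).le).of_recvC (hlen j h2.le) ha
    exact ⟨q, hq, hans.fits⟩
  have hreq : ∀ j j' s a a', n < j → j < j' → j' < n' →
      e.act j = .send (.client (.reader r)) (.server s) a →
      e.act j' = .send (.client (.reader r)) (.server s) a' → a.round ≠ a'.round := by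
    intro j j' s a a' h1 h2 h3 ha ha'
    obtain ⟨σ', hs⟩ := hsend j' s a' (by omega) h3 ha'
    exact hs.not_sent (((hdone j' (by omega) h3.le) s a).1.1 ⟨j, h1, h2, ha⟩)
  have hone : ∀ j j' s a a', n < j → j < n' → n < j' → j' < n' →
      e.act j = .send (.client (.reader r)) (.server s) a →
      e.act j' = .send (.client (.reader r)) (.server s) a' → a.round = a'.round → j = j' := by
    intro j j' s a a' h1 h2 h3 h4 ha ha' hr
    rcases lt_trichotomy j j' with h | h | h
    · exact (hreq j j' s a a' h1 h h4 ha ha' hr).elim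
    · exact h
    · exact (hreq j' j s a' a h3 h h2 ha' ha hr.symm).elim
  have hans : ∀ j j' s a a', n < j → j < j' → j' < n' →
      e.act j = .recv (.server s) (.client (.reader r)) a →
      e.act j' = .recv (.server s) (.client (.reader r)) a' → a.round ≠ a'.round := by
    intro j j' s a a' h1 h2 h3 ha ha'
    obtain ⟨q, hq, hf⟩ := hrecv j' s a' (by omega) h3 ha'
    exact not_received_of_pend hq hf (((hdone j' (by omega) h3.le) s a).2.1 ⟨j, h1, h2, ha⟩)
  have hone' : ∀ j j' s a a', n < j → j < n' → n < j' → j' < n' →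
      e.act j = .recv (.server s) (.client (.reader r)) a →
      e.act j' = .recv (.server s) (.client (.reader r)) a' → a.round = a'.round → j = j' := by
    intro j j' s a a' h1 h2 h3 h4 ha ha' hr
    rcases lt_trichotomy j j' with h | h | h
    · exact (hans j j' s a a' h1 h h4 ha ha' hr).elim
    · exact h
    · exact (hans j' j s a' a h3 h h2 ha' ha hr.symm).elim
  have hasked : ∀ j' s a', n < j' → j' < n' →
      e.act j' = .recv (.server s) (.client (.reader r)) a' →
      ∃ j a, n < j ∧ j < j' ∧ e.act j = .send (.client (.reader r)) (.server s) a ∧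
        Answers s a a' := by
    intro j' s a' h1 h2 ha'
    obtain ⟨q, hq, hf⟩ := hrecv j' s a' h1 h2 ha'
    obtain ⟨hs, hA⟩ := sent_of_pend hq hf
    obtain ⟨j, h3, h4, ha⟩ := ((hdone j' h1 h2.le) s q).1.2 hs
    exact ⟨j, q, h3, h4, ha, hA⟩
  have hround : ∀ j s a, n < j → j < n' →
      e.act j = .send (.client (.reader r)) (.server s) a → 1 ≤ a.round ∧ a.round ≤ 2 :=
    fun j s a h1 h2 ha => ((hend s a).1.1 ⟨j, h1, h2, ha⟩).round
  refine ⟨hround, fun ρ h1 h2 => ?_, hone, fun j s a h1 h2 ha => ?_, hasked,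
    fun j j' s s' a a' h1 h2 h3 h4 ha ha' hlt => ?_, fun i => ?_⟩
  · rcases (by omega : ρ = 1 ∨ ρ = 2) with rfl | rfl
    · obtain ⟨j, h3, h4, h5⟩ := (hend coord (.getTagArray I)).1.2 (Or.inl ⟨rfl, rfl⟩)
      exact ⟨j, _, _, h3, h4, h5, rfl⟩
    · obtain ⟨i, hi⟩ := hI
      obtain ⟨j, h3, h4, h5⟩ := (hend i (.readValue (κ i))).1.2
        -- The second round is not void because `I` is non-empty, and at the response nothing is
        -- left unsent.
        (Or.inr ⟨hi, Finset.notMem_empty i, rfl⟩)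
      exact ⟨j, _, _, h3, h4, h5, rfl⟩
  · obtain ⟨j', a', h3, h4, ha', hA⟩ : ∃ j' a', n < j' ∧ j' < n' ∧
        e.act j' = .recv (.server s) (.client (.reader r)) a' ∧ Answers s a a' := by
      rcases (hend s a).1.1 ⟨j, h1, h2, ha⟩ with ⟨rfl, rfl⟩ | ⟨hs, -, rfl⟩
      · obtain ⟨j', h3, h4, h5⟩ := (hend s (.tagArray t κ)).2.2 (Or.inl ⟨rfl, rfl⟩)
        exact ⟨j', _, h3, h4, h5, trivial⟩
      · obtain ⟨j', h3, h4, h5⟩ := (hend s (.value s (v ⟨s, hs⟩))).2.2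
          (Or.inr ⟨_, hgot ⟨s, hs⟩, rfl⟩)
        exact ⟨j', _, h3, h4, h5, rfl⟩
    -- The answer was preceded by a request of its own round to the same server, and the only such
    -- request is the one at `j`.
    have hjj : j < j' := by
      obtain ⟨i, b, h5, h6, hb, hB⟩ := hasked j' s a' h3 h4 ha'
      have := hone i j s b a h5 (by omega) h1 h2 hb ha
        ((round_eq_of_answers hB).trans (round_eq_of_answers hA).symm)
      omega
    refine ⟨j', ⟨h3, h4, hjj, a', ha', hA⟩, ?_⟩
    rintro i ⟨h5, h6, -, b, hb, hB⟩
    exact hone' i j' s b a' h5 h6 h3 h4 hb ha'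
      ((round_eq_of_answers hB).symm.trans (round_eq_of_answers hA))
  · by_contra hcon
    have hne : j ≠ j' := by
      rintro rfl
      rw [ha] at ha'
      cases ha'
    obtain ⟨q, hq, hf⟩ := hrecv j' s' a' h3 h4 ha'
    -- A request sent before an answer arrives belongs to no later round than that answer.
    have := round_of_pend_of_sent hq hf (((hdone j' h3 h4.le) s a).1.1 ⟨j, h1, by omega, ha⟩)
    omega
  · obtain ⟨j, h1, h2, h3⟩ := (hend i (.value i (v i))).2.2 (Or.inr ⟨_, hgot i, rfl⟩)
    refine ⟨j, _, h1, h2, h3, rfl, fun j' s a' x h4 h5 ha' hx => ?_⟩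
    -- The tag array carries no version, and a version of object `i` comes from the server of `i`,
    -- which answers once in the second round.
    rcases (hend s a').2.1 ⟨j', h4, h5, ha'⟩ with ⟨-, rfl⟩ | ⟨v', -, rfl⟩
    · simp [Msg.versions] at hx
    · simp only [Msg.versions, List.mem_singleton] at hx
      have hs : (i : Fin k) = s := congrArg Sigma.fst hx
      subst hs
      exact hone' j' j i _ _ h4 h5 h1 h2 ha' h3 rfl

theorem oneVersionReads (he : e.IsExecution) (hwf : WellFormed e) : OneVersionReads 2 e :=
  ⟨fun _ _ _ _ _ _ hi hc => readInRounds he hwf hi hc, fun _ _ _ a _ _ => by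
    cases a <;> simp [Msg.versions]⟩

end Rounds

end SNoW

theorem mainTheorem5 {ℓ m k : ℕ} (V : Fin k → Type u) (v₀ : ∀ i, V i) (coord : Fin k) :
    SNoW.NoClientToClient (SNoW.algorithmB ℓ m V v₀ coord) ∧
    (∀ e : (SNoW.algorithmB ℓ m V v₀ coord).Fragment,
      e.IsExecution → SNoW.WellFormed e → e.Fair →
        SNoW.ResponsesMatched e ∧ SNoW.StrictlySerializable v₀ e ∧ SNoW.OneVersionReads 2 e) ∧
    SNoW.NonBlocking (ℓ := ℓ) (m := m) V v₀ coord ∧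
    SNoW.ConcurrentWrites (SNoW.algorithmB ℓ m V v₀ coord) :=
  ⟨SNoW.noClientToClient,
    fun _ he hwf _ => ⟨SNoW.responsesMatched he hwf, SNoW.strictlySerializable he hwf,
      SNoW.oneVersionReads he hwf⟩,
    SNoW.nonBlocking, fun _ he hwf hf => SNoW.allComplete he hwf hf, SNoW.invocableAnytime⟩
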